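/- Let $N$ be a free $\mathbb Z$-module of finite rank $n$, $M=\mathrm{Hom}(N,\mathbb Z)$, and let $\Delta$ be a complete fan in $N$: a finite set of strictly convex rational polyhedral cones in $N_{\mathbb R}=N\otimes\mathbb R$, closed under taking faces, any two of which meet in a common face, with union $N_{\mathbb R}$. Fix an orientation of the vector space $\mathbb R\sigma$ for every $\sigma\in\Delta$, such that all $n$-dimensional cones are oriented by one and the same orientation of $N_{\mathbb R}$. For a face $\tau$ of codimension one in $\sigma$ let $\varepsilon(\tau,\sigma)=1$ if the orientation of $\mathbb R\tau$ agrees with the one induced by $\sigma$ (via $\mathbb R\sigma=\mathbb Rw\oplus\mathbb R\tau$ with $w\in\sigma\setminus\tau$), and $\varepsilon(\tau,\sigma)=-1$ otherwise. Let $k$ be a field, $R$ a commutative ring, and $X=X(\Delta)$ the toric variety obtained by gluing the schemes $X_\sigma=\mathrm{Spec}\,k[\sigma^\vee\cap M]$ along the open immersions $X_\tau\to X_\sigma$ ($\tau\le\sigma$); write $i_\sigma\colon X_\sigma\to X$ for the inclusion, $R_X$ for the constant sheaf, and $\Delta^{(p)}$ for the set of cones of codimension $p$. Put $$\check{\mathcal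 C}_p(\Delta,R_X)=\bigoplus_{\sigma\in\Delta^{(p)}} i_{\sigma!}i_\sigma^*R_X ,\qquad p\ge 0,$$ with differential $d_p\colon\check{\mathcal C}_p\to\check{\mathcal C}_{p-1}$ whose components are $\varepsilon(\tau,\sigma)$ times the natural inclusion $i_{\tau!}i_\tau^*R_X\to i_{\sigma!}i_\sigma^*R_X$ for $\tau\in\Delta^{(p)}$, $\sigma\in\Delta^{(p-1)}$, $\tau\le\sigma$ (and $0$ otherwise), and with augmentation $a\colon\check{\mathcal C}_0\to R_X$ induced by the natural morphisms $i_{\sigma!}i_\sigma^*R_X\to R_X$. Then $\cdots\to\check{\mathcal C}_1(\Delta,R_X)\to\check{\mathcal C}_0(\Delta,R_X)\xrightarrow{a}R_X\to 0$ is an exact complex of sheaves of $R$-modules on $X$; that is, $\check{\mathcal C}_*(\Delta,R_X)$ is a resolution of $R_X$. Moreover, every $x\in X$ lies in an orbit $T_\sigma=\mathrm{Spec}\,k[\sigma^\perp\cap M]$ with $\sigma\in\Delta$ for which the following holds. The stalk at $x$ of the augmented complex is isomorphic to the augmented complex $\check C_*(\Delta_\sigma,R)\to R$, where $\check C_p(\Delta_\sigma,R)$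 is the free $R$-module on the cones $\tau\ge\sigma$ of codimension $p$, $d[\tau]=\sum_\rho\varepsilon(\tau,\rho)[\rho]$ and $a(\sum x_\tau[\tau])=\sum x_\tau$. This complex is in turn isomorphic, compatibly with the augmentations, to the cellular chain complex $H_p(X_p,X_{p-1};R)$ of the dual cell decomposition of the simplicial complex whose simplices are the flags $\tau_0<\dots<\tau_q$ of cones $\tau_i\ge\sigma$ (a triangulation of an $(n-\dim\sigma)$-dimensional ball, a known fact that is not itself part of the statement). Here the cell dual to a cone $\tau\ge\sigma$ is the subcomplex of the flags with $\tau\le\tau_0$, the skeleton $X_p$ is the union of the cells dual to cones of codimension at most $p$, and the homology is simplicial. -/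

import Mathlib

open CategoryTheory Limits TopologicalSpace Opposite AlgebraicGeometry
open scoped TensorProduct

universe u

noncomputable section

namespace ToricRes

section Cones

variable (N : Type u) [AddCommGroup N]

/-- The real vector space `N_ℝ = N ⊗ ℝ`. -/
abbrev NReal : Type u := ℝ ⊗[ℤ] N

variable {N}

/-- The pairing `⟨u, m⟩` of `u ∈ N_ℝ` with an element `m` of the dual lattice `M = Hom(N, ℤ)`,
as a linear functional of `u`. -/
def pairing (m : Module.Dual ℤ N) : NReal N →ₗ[ℝ] ℝ :=
  Module.Dual.baseChange ℝ m

@[simp] lemma pairing_tmul (m : Module.Dual ℤ N) (r : ℝ) (v : N) :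
    pairing m (r ⊗ₜ[ℤ] v) = (m v : ℝ) * r := by
  simp [pairing]

lemma pairing_add (m m' : Module.Dual ℤ N) (x : NReal N) :
    pairing (m + m') x = pairing m x + pairing m' x := by
  simp [pairing]

@[simp] lemma pairing_zero (x : NReal N) : pairing (0 : Module.Dual ℤ N) x = 0 := by
  simp [pairing]

lemma pairing_neg (m : Module.Dual ℤ N) (x : NReal N) : pairing (-m) x = -pairing m x := by
  simp [pairing]

lemma pairing_nsmul (k : ℕ) (m : Module.Dual ℤ N) (x : NReal N) :
    pairing (k • m) x = k * pairing m x := by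
  induction k with
  | zero => simp
  | succ k ih => rw [succ_nsmul, pairing_add, ih]; push_cast; ring

/-- A rational polyhedral cone: the cone generated by finitely many vectors of the lattice `N`. -/
def IsRational (σ : PointedCone ℝ (NReal N)) : Prop :=
  ∃ s : Finset N, σ = PointedCone.hull ℝ ((fun v : N => (1 : ℝ) ⊗ₜ[ℤ] v) '' (s : Set N))

/-- A cone is strictly convex if it contains no nonzero linear subspace. -/
def IsStrictlyConvex (σ : PointedCone ℝ (NReal N)) : Prop :=
  ∀ W : Submodule ℝ (NReal N), (W : Set (NReal N)) ⊆ σ → W = ⊥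

/-- `τ` is a face of `σ`: there is a functional `u ∈ M_ℝ`, nonnegative on `σ`, such that
`τ = σ ∩ u^⊥`. -/
def IsFace (τ σ : PointedCone ℝ (NReal N)) : Prop :=
  ∃ u : Module.Dual ℝ (NReal N), (∀ x ∈ σ, 0 ≤ u x) ∧ ∀ x, x ∈ τ ↔ x ∈ σ ∧ u x = 0

/-- The subspace `ℝσ` generated by a cone. -/
abbrev coneSpan (σ : PointedCone ℝ (NReal N)) : Submodule ℝ (NReal N) :=
  Submodule.span ℝ (σ : Set (NReal N))

/-- The dimension of a cone. -/
def coneDim (σ : PointedCone ℝ (NReal N)) : ℕ := Module.finrank ℝ (coneSpan σ)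

/-- The monoid `σ^∨ ∩ M`. -/
def dualMonoid (σ : PointedCone ℝ (NReal N)) : AddSubmonoid (Module.Dual ℤ N) where
  carrier := {m | ∀ x ∈ σ, 0 ≤ pairing m x}
  zero_mem' := by simp
  add_mem' := by
    intro a b ha hb x hx
    rw [pairing_add]
    exact add_nonneg (ha x hx) (hb x hx)

/-- The group `σ^⊥ ∩ M`. -/
def orthMonoid (σ : PointedCone ℝ (NReal N)) : AddSubgroup (Module.Dual ℤ N) where
  carrier := {m | ∀ x ∈ σ, pairing m x = 0}
  zero_mem' := by simp
  add_mem' := by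
    intro a b ha hb x hx
    rw [pairing_add, ha x hx, hb x hx, add_zero]
  neg_mem' := by
    intro a ha x hx
    rw [pairing_neg, ha x hx, neg_zero]

lemma dualMonoid_anti {τ σ : PointedCone ℝ (NReal N)} (h : τ ≤ σ) :
    dualMonoid σ ≤ dualMonoid τ := fun _ hm x hx => hm x (h hx)

/-- The signs of finitely many values of an additive map `N → ℝ` are those of the values of an
additive map `N → ℤ`, as long as they are nonnegative. -/
lemma exists_integral (s : Finset N) (f : N →+ ℝ) (hN : Module.Finite ℤ N) :
    ∃ m : Module.Dual ℤ N, ∀ v ∈ s, (f v = 0 → m v = 0) ∧ (0 < f v → 0 < m v) := by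
  let g : N →ₗ[ℤ] ℝ := f.toIntLinearMap
  let H := LinearMap.range g
  have : Module.Finite ℤ H := inferInstance
  have : Module.Free ℤ H := inferInstance
  let b := Module.Free.chooseBasis ℤ H
  let ι := Module.Free.ChooseBasisIndex ℤ H
  let Φ : (ι → ℝ) → N → ℝ := fun q v => ∑ i, (b.repr (g.rangeRestrict v) i : ℝ) * q i
  let r : ι → ℝ := fun i => (b i : ℝ)
  have hr : ∀ v, Φ r v = f v := by
    intro v
    have h := congrArg (fun z : H => (z : ℝ)) (b.sum_repr (g.rangeRestrict v))
    simp only [AddSubmonoidClass.coe_finsetSum, SetLike.val_smul, zsmul_eq_mul] at h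
    exact h
  have hopen : IsOpen {q : ι → ℝ | ∀ v ∈ s, 0 < f v → 0 < Φ q v} := by
    have : {q : ι → ℝ | ∀ v ∈ s, 0 < f v → 0 < Φ q v} =
        ⋂ v ∈ s, {q : ι → ℝ | 0 < f v → 0 < Φ q v} := by ext; simp
    rw [this]
    refine isOpen_biInter_finset fun v _ => ?_
    by_cases hv : 0 < f v
    · simp only [hv, true_imp_iff]
      exact isOpen_lt continuous_const (by fun_prop)
    · simp [hv]
  have hd : DenseRange (fun (q : ι → ℚ) (i : ι) => (q i : ℝ)) :=
    DenseRange.piMap (fun _ => Rat.denseRange_cast)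
  obtain ⟨q, hq⟩ := hd.exists_mem_open hopen ⟨r, fun v _ hv => by rw [hr]; exact hv⟩
  let D : ℕ := ∏ i, (q i).den
  have hD : 0 < D := Finset.prod_pos fun i _ => (q i).den_pos
  have hint : ∀ i, ∃ z : ℤ, (z : ℝ) = D * (q i : ℝ) := by
    intro i
    obtain ⟨c, hc⟩ : (q i).den ∣ D := Finset.dvd_prod_of_mem _ (Finset.mem_univ i)
    refine ⟨c * (q i).num, ?_⟩
    have h2 : ((q i).den : ℝ) * (q i : ℝ) = (q i).num := by exact_mod_cast Rat.den_mul_eq_num (q i)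
    rw [hc]; push_cast
    rw [← h2]; ring
  choose z hz using hint
  let h : H →ₗ[ℤ] ℤ := b.constr ℤ z
  have hh : ∀ v, ((h (g.rangeRestrict v) : ℤ) : ℝ) = D * Φ (fun i => (q i : ℝ)) v := by
    intro v
    simp only [h, Module.Basis.constr_apply_fintype, Φ]
    push_cast
    rw [Finset.mul_sum]
    refine Finset.sum_congr rfl fun i _ => ?_
    simp [hz]; ring
  refine ⟨h ∘ₗ g.rangeRestrict, fun v hv => ⟨fun h0 => ?_, fun hpos => ?_⟩⟩
  · have : g.rangeRestrict v = 0 := Subtype.ext h0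
    simp [this]
  · have h1 : (0 : ℝ) < ((h (g.rangeRestrict v) : ℤ) : ℝ) := by
      rw [hh]; exact mul_pos (by exact_mod_cast hD) (hq v hv hpos)
    exact_mod_cast h1

lemma hull_nonneg (s : Finset N) (φ : NReal N →ₗ[ℝ] ℝ)
    (h : ∀ v ∈ s, 0 ≤ φ ((1 : ℝ) ⊗ₜ[ℤ] v)) :
    ∀ x ∈ PointedCone.hull ℝ ((fun v : N => (1 : ℝ) ⊗ₜ[ℤ] v) '' (s : Set N)), 0 ≤ φ x := by
  intro x hx
  induction hx using Submodule.span_induction with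
  | mem x hx => obtain ⟨v, hv, rfl⟩ := hx; exact h v hv
  | zero => simp
  | add x y _ _ hx hy => rw [map_add]; exact add_nonneg hx hy
  | smul c x _ hx =>
    rw [← Nonneg.coe_smul, map_smul]
    exact mul_nonneg c.2 hx

lemma exists_nat_bound (s : Finset N) (φ ψ : NReal N →ₗ[ℝ] ℝ)
    (h : ∀ v ∈ s, 0 ≤ ψ ((1 : ℝ) ⊗ₜ[ℤ] v))
    (h0 : ∀ v ∈ s, ψ ((1 : ℝ) ⊗ₜ[ℤ] v) = 0 → 0 ≤ φ ((1 : ℝ) ⊗ₜ[ℤ] v)) :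
    ∃ k : ℕ, ∀ x ∈ PointedCone.hull ℝ ((fun v : N => (1 : ℝ) ⊗ₜ[ℤ] v) '' (s : Set N)),
      0 ≤ φ x + k * ψ x := by
  have key : ∀ v ∈ s, ∃ k : ℕ, ∀ j : ℕ, k ≤ j →
      0 ≤ φ ((1 : ℝ) ⊗ₜ[ℤ] v) + j * ψ ((1 : ℝ) ⊗ₜ[ℤ] v) := by
    intro v hv
    rcases (h v hv).eq_or_lt with h1 | h1
    · exact ⟨0, fun j _ => by rw [← h1, mul_zero, add_zero]; exact h0 v hv h1.symm⟩
    · obtain ⟨k, hk⟩ := exists_nat_gt (-φ ((1 : ℝ) ⊗ₜ[ℤ] v) / ψ ((1 : ℝ) ⊗ₜ[ℤ] v))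
      refine ⟨k, fun j hj => ?_⟩
      rw [div_lt_iff₀ h1] at hk
      have : (k : ℝ) ≤ j := by exact_mod_cast hj
      nlinarith
  choose! K hK using key
  refine ⟨s.sup K, fun x hx => ?_⟩
  have := hull_nonneg s (φ + ((s.sup K : ℕ) : ℝ) • ψ) (fun v hv => by
    simpa using hK v hv _ (Finset.le_sup hv)) x hx
  simpa using this

lemma exists_add_nsmul_mem {τ σ : PointedCone ℝ (NReal N)} (hσ : IsRational σ)
    {m : Module.Dual ℤ N} (hm : m ∈ dualMonoid σ) (h : ∀ x ∈ σ, pairing m x = 0 → x ∈ τ)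
    {w : Module.Dual ℤ N} (hw : w ∈ dualMonoid τ) : ∃ k : ℕ, w + k • m ∈ dualMonoid σ := by
  obtain ⟨s, rfl⟩ := hσ
  have hmem : ∀ v ∈ s, (1 : ℝ) ⊗ₜ[ℤ] v ∈
      PointedCone.hull ℝ ((fun v : N => (1 : ℝ) ⊗ₜ[ℤ] v) '' (s : Set N)) := fun v hv =>
    Submodule.subset_span ⟨v, hv, rfl⟩
  obtain ⟨k, hk⟩ := exists_nat_bound s (pairing w) (pairing m) (fun v hv => hm _ (hmem v hv))
    (fun v hv h0 => hw _ (h _ (hmem v hv) h0))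
  exact ⟨k, fun x hx => by rw [pairing_add, pairing_nsmul]; exact hk x hx⟩

/-- A face of a rational cone is cut out by an integral functional `m ∈ σ^∨ ∩ M`. -/
lemma IsFace.exists_integral [Module.Finite ℤ N] {τ σ : PointedCone ℝ (NReal N)}
    (hσ : IsRational σ) (h : IsFace τ σ) :
    ∃ m ∈ dualMonoid σ, ∀ x, x ∈ τ ↔ x ∈ σ ∧ pairing m x = 0 := by
  obtain ⟨s, rfl⟩ := hσ
  obtain ⟨u, hu, hτ⟩ := h
  have hmem : ∀ v ∈ s, (1 : ℝ) ⊗ₜ[ℤ] v ∈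
      PointedCone.hull ℝ ((fun v : N => (1 : ℝ) ⊗ₜ[ℤ] v) '' (s : Set N)) := fun v hv =>
    Submodule.subset_span ⟨v, hv, rfl⟩
  obtain ⟨m, hm⟩ := ToricRes.exists_integral s
    (u.toAddMonoidHom.comp (TensorProduct.mk ℤ ℝ N 1).toAddMonoidHom) inferInstance
  have hm0 : ∀ v ∈ s, u ((1 : ℝ) ⊗ₜ[ℤ] v) = 0 → m v = 0 := fun v hv => (hm v hv).1
  have hm1 : ∀ v ∈ s, 0 < u ((1 : ℝ) ⊗ₜ[ℤ] v) → 0 < m v := fun v hv => (hm v hv).2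
  have hmn : ∀ v ∈ s, 0 ≤ pairing m ((1 : ℝ) ⊗ₜ[ℤ] v) := by
    intro v hv
    simp only [pairing_tmul, mul_one]
    rcases (hu _ (hmem v hv)).eq_or_lt with h1 | h1
    · simp [hm0 v hv h1.symm]
    · exact_mod_cast (hm1 v hv h1).le
  have hmz : ∀ v ∈ s, pairing m ((1 : ℝ) ⊗ₜ[ℤ] v) = 0 → u ((1 : ℝ) ⊗ₜ[ℤ] v) = 0 := by
    intro v hv h0
    rcases (hu _ (hmem v hv)).eq_or_lt with h1 | h1
    · exact h1.symm
    · have := hm1 v hv h1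
      simp only [pairing_tmul, mul_one, Int.cast_eq_zero] at h0
      omega
  have hdual := hull_nonneg s (pairing m) hmn
  obtain ⟨a, ha⟩ := exists_nat_bound s (-u) (pairing m) hmn (fun v hv h0 => by
    simp [hmz v hv h0])
  obtain ⟨b, hb⟩ := exists_nat_bound s (-(pairing m)) u (fun v hv => hu _ (hmem v hv))
    (fun v hv h0 => by simp [hm0 v hv h0])
  refine ⟨m, hdual, fun x => ?_⟩
  rw [hτ]
  refine and_congr_right fun hx => ?_
  have h1 := ha x hx
  have h2 := hb x hx
  have h3 := hu x hx
  have h4 := hdual x hx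
  simp only [LinearMap.neg_apply] at h1 h2
  constructor
  · intro h0; rw [h0] at h2; linarith
  · intro h0; rw [h0] at h1; linarith

end Cones

section Affine

variable {N : Type u} [AddCommGroup N] (k : Type u) [Field k]

/-- The coordinate ring `k[σ^∨ ∩ M]` of the affine piece `X_σ`. -/
abbrev coordRing (σ : PointedCone ℝ (NReal N)) : Type u := AddMonoidAlgebra k (dualMonoid σ)

/-- The coordinate ring `k[σ^⊥ ∩ M]` of the torus `T_σ`. -/
abbrev orbitRing (σ : PointedCone ℝ (NReal N)) : Type u := AddMonoidAlgebra k (orthMonoid σ)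

/-- The inclusion `k[σ^∨ ∩ M] → k[τ^∨ ∩ M]` for `τ ⊆ σ`. -/
def coordMap {τ σ : PointedCone ℝ (NReal N)} (h : τ ≤ σ) : coordRing k σ →+* coordRing k τ :=
  AddMonoidAlgebra.mapDomainRingHom k (AddSubmonoid.inclusion (dualMonoid_anti h))

lemma coordMap_injective {τ σ : PointedCone ℝ (NReal N)} (h : τ ≤ σ) :
    Function.Injective (coordMap k h) :=
  AddMonoidAlgebra.mapDomain_injective (AddSubmonoid.inclusion_injective _)

@[simp] lemma coordMap_single {τ σ : PointedCone ℝ (NReal N)} (h : τ ≤ σ) (m : dualMonoid σ)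
    (c : k) : coordMap k h (AddMonoidAlgebra.single m c) =
      AddMonoidAlgebra.single (AddSubmonoid.inclusion (dualMonoid_anti h) m) c := by
  simp [coordMap]

/-- For a face `τ` of `σ`, the ring `k[τ^∨ ∩ M]` is the localization of `k[σ^∨ ∩ M]` at the
character of an integral functional cutting out `τ`. -/
lemma coordRing_isLocalization {τ σ : PointedCone ℝ (NReal N)} (h : τ ≤ σ)
    (m : dualMonoid σ) (hm : ∀ x ∈ τ, pairing m.1 x = 0)
    (hw : ∀ w ∈ dualMonoid τ, ∃ j : ℕ, w + j • m.1 ∈ dualMonoid σ) :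
    letI := (coordMap k h).toAlgebra
    IsLocalization.Away (AddMonoidAlgebra.single m (1 : k)) (coordRing k τ) := by
  let _ := (coordMap k h).toAlgebra
  have hmap : ∀ f, algebraMap (coordRing k σ) (coordRing k τ) f = coordMap k h f := fun f => rfl
  have hneg : -m.1 ∈ dualMonoid τ := fun x hx => by rw [pairing_neg, hm x hx, neg_zero]
  have hunit : IsUnit (coordMap k h (AddMonoidAlgebra.single m (1 : k))) := by
    refine IsUnit.of_mul_eq_one (AddMonoidAlgebra.single (⟨-m.1, hneg⟩ : dualMonoid τ) (1 : k)) ?_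
    rw [coordMap_single, AddMonoidAlgebra.single_mul_single, AddMonoidAlgebra.one_def, mul_one]
    congr 1
    ext1
    simp
  refine { map_units := ?_, surj := ?_, exists_of_eq := ?_ }
  · rintro ⟨_, n, rfl⟩
    rw [hmap, map_pow]
    exact hunit.pow n
  · intro f
    suffices H : ∃ n : ℕ, ∃ g, f * coordMap k h (AddMonoidAlgebra.single m (1 : k)) ^ n =
        coordMap k h g by
      obtain ⟨n, g, hg⟩ := H
      exact ⟨(g, ⟨_, n, rfl⟩), by rw [hmap, hmap, map_pow]; exact hg⟩
    induction f using AddMonoidAlgebra.induction_linear with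
    | zero => exact ⟨0, 0, by simp⟩
    | add f g hf hg =>
      obtain ⟨a, f', hf⟩ := hf
      obtain ⟨b, g', hg⟩ := hg
      refine ⟨a + b, f' * AddMonoidAlgebra.single m (1 : k) ^ b +
        g' * AddMonoidAlgebra.single m (1 : k) ^ a, ?_⟩
      rw [map_add, map_mul, map_mul, ← hf, ← hg, map_pow, map_pow]
      ring
    | single w c =>
      obtain ⟨j, hj⟩ := hw w.1 w.2
      refine ⟨j, AddMonoidAlgebra.single ⟨_, hj⟩ c, ?_⟩
      rw [coordMap_single, coordMap_single, AddMonoidAlgebra.single_pow,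
        AddMonoidAlgebra.single_mul_single, one_pow, mul_one]
      congr 1
  · intro f g hfg
    rw [hmap, hmap] at hfg
    rw [coordMap_injective k h hfg]
    exact ⟨1, rfl⟩

/-- The affine piece `X_σ = Spec k[σ^∨ ∩ M]`. -/
abbrev affinePiece (σ : PointedCone ℝ (NReal N)) : Scheme.{u} := Spec (CommRingCat.of (coordRing k σ))

/-- The morphism `X_τ → X_σ` for `τ ⊆ σ`. -/
def affineMap {τ σ : PointedCone ℝ (NReal N)} (h : τ ≤ σ) : affinePiece k τ ⟶ affinePiece k σ :=
  Spec.map (CommRingCat.ofHom (coordMap k h))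

lemma IsFace.le {τ σ : PointedCone ℝ (NReal N)} (h : IsFace τ σ) : τ ≤ σ := by
  obtain ⟨u, _, h⟩ := h
  exact fun x hx => ((h x).1 hx).1

lemma affineMap_isOpenImmersion [Module.Finite ℤ N] {τ σ : PointedCone ℝ (NReal N)}
    (hσ : IsRational σ) (hf : IsFace τ σ) (h : τ ≤ σ) : IsOpenImmersion (affineMap k h) := by
  obtain ⟨m, hm, hτ⟩ := hf.exists_integral hσ
  let _ := (coordMap k h).toAlgebra
  have := coordRing_isLocalization k h ⟨m, hm⟩ (fun x hx => ((hτ x).1 hx).2)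
    fun w hw => exists_add_nsmul_mem hσ hm (fun x hx h0 => (hτ x).2 ⟨hx, h0⟩) hw
  exact IsOpenImmersion.of_isLocalization (AddMonoidAlgebra.single (⟨m, hm⟩ : dualMonoid σ) (1 : k))

lemma range_affineMap {τ σ : PointedCone ℝ (NReal N)} (hσ : IsRational σ) (h : τ ≤ σ)
    (m : dualMonoid σ) (hτ : ∀ x, x ∈ τ ↔ x ∈ σ ∧ pairing m.1 x = 0) :
    Set.range (affineMap k h) =
      (PrimeSpectrum.basicOpen (AddMonoidAlgebra.single m (1 : k)) :
        Set (PrimeSpectrum (coordRing k σ))) := by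
  let _ := (coordMap k h).toAlgebra
  have := coordRing_isLocalization k h m (fun x hx => ((hτ x).1 hx).2)
    fun w hw => exists_add_nsmul_mem hσ m.2 (fun x hx h0 => (hτ x).2 ⟨hx, h0⟩) hw
  exact PrimeSpectrum.localization_away_comap_range (coordRing k τ)
    (AddMonoidAlgebra.single m (1 : k))

lemma affineMap_id (σ : PointedCone ℝ (NReal N)) : affineMap k (le_refl σ) = 𝟙 _ := by
  have : coordMap k (le_refl σ) = RingHom.id _ := by
    apply AddMonoidAlgebra.ringHom_ext <;> intros <;> simp <;> rfl
  rw [affineMap, this]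
  exact Spec.map_id _

lemma affineMap_comp {ρ τ σ : PointedCone ℝ (NReal N)} (h : ρ ≤ τ) (h' : τ ≤ σ) :
    affineMap k (h.trans h') = affineMap k h ≫ affineMap k h' := by
  have : coordMap k (h.trans h') = (coordMap k h).comp (coordMap k h') := by
    apply AddMonoidAlgebra.ringHom_ext <;> intros <;> simp <;> rfl
  rw [affineMap, this, affineMap, affineMap, ← Spec.map_comp]
  rfl

lemma add_mem_orthMonoid_iff {σ : PointedCone ℝ (NReal N)} {a b : Module.Dual ℤ N}
    (ha : a ∈ dualMonoid σ) (hb : b ∈ dualMonoid σ) :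
    a + b ∈ orthMonoid σ ↔ a ∈ orthMonoid σ ∧ b ∈ orthMonoid σ := by
  constructor
  · intro h
    have h' : ∀ x ∈ σ, pairing a x + pairing b x = 0 := fun x hx => by
      rw [← pairing_add]; exact h x hx
    exact ⟨fun x hx => by linarith [h' x hx, ha x hx, hb x hx],
      fun x hx => by linarith [h' x hx, ha x hx, hb x hx]⟩
  · exact fun h => add_mem h.1 h.2

open Classical in
/-- The ring homomorphism `k[σ^∨ ∩ M] → k[σ^⊥ ∩ M]` which is the identity on the elements of
`σ^⊥ ∩ M` and sends the other elements of `σ^∨ ∩ M` to `0`. -/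
def orbitRingHom (σ : PointedCone ℝ (NReal N)) : coordRing k σ →+* orbitRing k σ :=
  (AddMonoidAlgebra.lift k (orbitRing k σ) (dualMonoid σ)
    { toFun := fun m =>
        if h : m.toAdd.1 ∈ orthMonoid σ then
          AddMonoidAlgebra.single (⟨m.toAdd.1, h⟩ : orthMonoid σ) (1 : k) else 0
      map_one' := by
        have h : (0 : Module.Dual ℤ N) ∈ orthMonoid σ := zero_mem _
        simp [AddMonoidAlgebra.one_def]
        rfl
      map_mul' := by
        intro a b
        have key := add_mem_orthMonoid_iff a.toAdd.2 b.toAdd.2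
        by_cases ha : a.toAdd.1 ∈ orthMonoid σ
        · by_cases hb : b.toAdd.1 ∈ orthMonoid σ
          · simp [ha, hb, add_mem ha hb, AddMonoidAlgebra.single_mul_single]
          · simp [ha, hb, key]
        · simp [ha, key] }).toRingHom

/-- The closed immersion `T_σ = Spec k[σ^⊥ ∩ M] → X_σ`. -/
def orbitToAffine (σ : PointedCone ℝ (NReal N)) :
    Spec (CommRingCat.of (orbitRing k σ)) ⟶ affinePiece k σ :=
  Spec.map (CommRingCat.ofHom (orbitRingHom k σ))

end Affine

section Fans

/-- A fan in the lattice `N`: a finite set of strictly convex rational polyhedral cones, closed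
under taking faces, such that any two cones intersect in a common face. -/
structure Fan (N : Type u) [AddCommGroup N] where
  cones : Set (PointedCone ℝ (NReal N))
  finite : cones.Finite
  rational : ∀ σ ∈ cones, IsRational σ
  strictlyConvex : ∀ σ ∈ cones, IsStrictlyConvex σ
  face_mem : ∀ σ ∈ cones, ∀ τ, IsFace τ σ → τ ∈ cones
  inter_face : ∀ σ ∈ cones, ∀ τ ∈ cones, IsFace (σ ⊓ τ) σ ∧ IsFace (σ ⊓ τ) τ

variable {N : Type u} [AddCommGroup N]

namespace Fan

/-- A fan is complete if its cones cover `N_ℝ`. -/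
def IsComplete (Δ : Fan N) : Prop := ∀ x : NReal N, ∃ σ ∈ Δ.cones, x ∈ σ

variable (Δ : Fan N)

/-- The cones of a fan, ordered by inclusion. By `Fan.le_iff_isFace` this is the face order. -/
abbrev Cone : Type u := {σ : PointedCone ℝ (NReal N) // σ ∈ Δ.cones}

variable {Δ}

lemma isFace_of_le {τ σ : Δ.Cone} (h : τ ≤ σ) : IsFace τ.1 σ.1 := by
  have h1 := (Δ.inter_face σ.1 σ.2 τ.1 τ.2).1
  rwa [inf_eq_right.2 (show τ.1 ≤ σ.1 from h)] at h1

lemma le_iff_isFace {τ σ : Δ.Cone} : τ ≤ σ ↔ IsFace τ.1 σ.1 :=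
  ⟨isFace_of_le, fun h => h.le⟩

instance : Finite Δ.Cone := Δ.finite

/-- The intersection of two cones of a fan. -/
def inter (σ τ : Δ.Cone) : Δ.Cone :=
  ⟨σ.1 ⊓ τ.1, Δ.face_mem _ σ.2 _ (Δ.inter_face _ σ.2 _ τ.2).1⟩

/-- `σ` has codimension `p`. -/
def HasCodim (σ : Δ.Cone) (p : ℕ) : Prop := coneDim σ.1 + p = Module.finrank ℤ N

variable (Δ)

/-- The set `Δ^{(p)}` of the cones of codimension `p`. -/
abbrev OfCodim (p : ℕ) : Type u := {σ : Δ.Cone // HasCodim σ p}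

variable (k : Type u) [Field k]

/-- The diagram of the affine schemes `X_σ`, `σ ∈ Δ`, and the morphisms `X_τ → X_σ`, `τ ≤ σ`. -/
def diagram : Δ.Cone ⥤ Scheme.{u} where
  obj σ := affinePiece k σ.1
  map h := affineMap k (leOfHom h)
  map_id σ := affineMap_id k σ.1
  map_comp f g := affineMap_comp k (leOfHom f) (leOfHom g)

instance [Module.Finite ℤ N] {σ τ : Δ.Cone} (f : τ ⟶ σ) : IsOpenImmersion ((Δ.diagram k).map f) :=
  affineMap_isOpenImmersion k (Δ.rational _ σ.2) (isFace_of_le (leOfHom f)) (leOfHom f)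

instance [Module.Finite ℤ N] : (Δ.diagram k ⋙ Scheme.forget).IsLocallyDirected where
  cond := by
    intro i j l fi fj xi xj h
    change affineMap k (leOfHom fi) xi = affineMap k (leOfHom fj) xj at h
    have hσ := Δ.rational _ l.2
    obtain ⟨a, ha, ha'⟩ := (isFace_of_le (leOfHom fi)).exists_integral hσ
    obtain ⟨b, hb, hb'⟩ := (isFace_of_le (leOfHom fj)).exists_integral hσ
    have hle : (inter i j).1 ≤ l.1 := fun x hx => leOfHom fi hx.1
    have hy : affineMap k (leOfHom fi) xi ∈ Set.range (affineMap k hle) := by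
      rw [range_affineMap k hσ hle (⟨a, ha⟩ + ⟨b, hb⟩)]
      · have h1 := range_affineMap k hσ (leOfHom fi) ⟨a, ha⟩ ha'
        have h2 := range_affineMap k hσ (leOfHom fj) ⟨b, hb⟩ hb'
        have m1 : affineMap k (leOfHom fi) xi ∈ Set.range (affineMap k (leOfHom fi)) := ⟨xi, rfl⟩
        have m2 : affineMap k (leOfHom fi) xi ∈ Set.range (affineMap k (leOfHom fj)) :=
          ⟨xj, h.symm⟩
        rw [h1] at m1
        rw [h2] at m2
        have h3 : (AddMonoidAlgebra.single (⟨a, ha⟩ + ⟨b, hb⟩ : dualMonoid l.1) (1 : k)) =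
            AddMonoidAlgebra.single (⟨a, ha⟩ : dualMonoid l.1) (1 : k) *
              AddMonoidAlgebra.single (⟨b, hb⟩ : dualMonoid l.1) (1 : k) := by
          rw [AddMonoidAlgebra.single_mul_single, mul_one]
        rw [h3, PrimeSpectrum.basicOpen_mul]
        exact ⟨m1, m2⟩
      · intro x
        change (x ∈ i.1 ∧ x ∈ j.1) ↔ x ∈ l.1 ∧ pairing (a + b) x = 0
        rw [ha', hb', pairing_add]
        constructor
        · rintro ⟨⟨h1, h2⟩, _, h3⟩
          exact ⟨h1, by rw [h2, h3, add_zero]⟩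
        · rintro ⟨h1, h2⟩
          have p1 := ha x h1
          have p2 := hb x h1
          exact ⟨⟨h1, by linarith⟩, h1, by linarith⟩
    obtain ⟨y, hy⟩ := hy
    have li : inter i j ≤ i := fun x hx => hx.1
    have lj : inter i j ≤ j := fun x hx => hx.2
    refine ⟨inter i j, homOfLE li, homOfLE lj, y, ?_, ?_⟩
    · have : IsOpenImmersion (affineMap k (leOfHom fi)) :=
        inferInstanceAs (IsOpenImmersion ((Δ.diagram k).map fi))
      apply (affineMap k (leOfHom fi)).isOpenEmbedding.injective
      rw [← hy, affineMap_comp k li (leOfHom fi)]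
      rfl
    · have : IsOpenImmersion (affineMap k (leOfHom fj)) :=
        inferInstanceAs (IsOpenImmersion ((Δ.diagram k).map fj))
      apply (affineMap k (leOfHom fj)).isOpenEmbedding.injective
      rw [← h, ← hy, affineMap_comp k lj (leOfHom fj)]
      rfl

variable [Module.Finite ℤ N]

/-- The toric variety `X(Δ)`: the affine schemes `X_σ`, glued along the open immersions
`X_τ → X_σ` for `τ ≤ σ`. -/
def toricVariety : Scheme.{u} := colimit (Δ.diagram k)

/-- The open immersion `i_σ : X_σ → X(Δ)`. -/
def inclusion (σ : Δ.Cone) : affinePiece k σ.1 ⟶ Δ.toricVariety k := colimit.ι (Δ.diagram k) σ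

instance (σ : Δ.Cone) : IsOpenImmersion (Δ.inclusion k σ) :=
  inferInstanceAs (IsOpenImmersion (colimit.ι (Δ.diagram k) σ))

/-- `X_σ` as an open subset of `X(Δ)`. -/
def affineOpen (σ : Δ.Cone) : Opens (Δ.toricVariety k) := (Δ.inclusion k σ).opensRange

lemma affineOpen_mono {τ σ : Δ.Cone} (h : τ ≤ σ) : Δ.affineOpen k τ ≤ Δ.affineOpen k σ := by
  rintro _ ⟨x, rfl⟩
  refine ⟨affineMap k h x, ?_⟩
  have : affineMap k h ≫ Δ.inclusion k σ = Δ.inclusion k τ :=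
    colimit.w (Δ.diagram k) (homOfLE h)
  rw [← this]
  rfl

/-- The orbit `T_σ` as a subset of `X(Δ)`: the image of `j_σ : T_σ → X_σ → X(Δ)`. -/
def orbit (σ : Δ.Cone) : Set (Δ.toricVariety k) :=
  Set.range (orbitToAffine k σ.1 ≫ Δ.inclusion k σ)

end Fan

end Fans

section Sheaves

variable {X : TopCat.{u}} (R : Type u) [CommRing R]

instance : HasFiniteBiproducts (TopCat.Sheaf (ModuleCat.{u} R) X) :=
  Abelian.hasFiniteBiproducts

/-- The constant sheaf `R_X`. -/
def constSheaf (X : TopCat.{u}) : TopCat.Sheaf (ModuleCat.{u} R) X :=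
  (constantSheaf (Opens.grothendieckTopology X) (ModuleCat.{u} R)).obj (ModuleCat.of R R)

variable {R}

/-- The presheaf `V ↦ F(V)` if `V ⊆ U`, and `V ↦ 0` otherwise, as a subpresheaf of `F`. -/
def extPresheaf (F : TopCat.Presheaf (ModuleCat.{u} R) X) (U : Opens X) :
    TopCat.Presheaf (ModuleCat.{u} R) X where
  obj V := ModuleCat.of R
    ({ carrier := {s | ¬ V.unop ≤ U → s = 0}
       add_mem' := fun ha hb h => by rw [ha h, hb h, add_zero]
       zero_mem' := fun _ => rfl
       smul_mem' := fun c _ ha h => by rw [ha h, smul_zero] } : Submodule R (F.obj V))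
  map {V W} f := ModuleCat.ofHom
    ((F.map f).hom.restrict fun s hs h => by
      rw [hs fun h' => h ((leOfHom f.unop).trans h'), map_zero])
  map_id V := by
    refine ModuleCat.hom_ext (LinearMap.ext fun s => Subtype.ext ?_)
    exact congrArg (fun φ => φ.hom s.1) (F.map_id V)
  map_comp f g := by
    refine ModuleCat.hom_ext (LinearMap.ext fun s => Subtype.ext ?_)
    exact congrArg (fun φ => φ.hom s.1) (F.map_comp f g)

/-- The inclusion `extPresheaf F U → extPresheaf F U'` for `U ⊆ U'`. -/
def extPresheafMap (F : TopCat.Presheaf (ModuleCat.{u} R) X) {U U' : Opens X} (h : U ≤ U') :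
    extPresheaf F U ⟶ extPresheaf F U' where
  app V := ModuleCat.ofHom (Submodule.inclusion fun _ hs h' => hs fun h'' => h' (h''.trans h))

/-- The inclusion `extPresheaf F U → F`. -/
def extPresheafι (F : TopCat.Presheaf (ModuleCat.{u} R) X) (U : Opens X) :
    extPresheaf F U ⟶ F where
  app V := ModuleCat.ofHom (Submodule.subtype _)

/-- For the inclusion `i : U → X` of an open subset, the sheaf `i_! i^* F`: the extension by zero
of the restriction `F|_U`, that is, the sheaf associated with the presheaf sending `V` to
`F|_U(V) = F(V)` if `V ⊆ U` and to `0` otherwise. -/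
def extZero (F : TopCat.Sheaf (ModuleCat.{u} R) X) (U : Opens X) :
    TopCat.Sheaf (ModuleCat.{u} R) X :=
  (presheafToSheaf (Opens.grothendieckTopology X) (ModuleCat.{u} R)).obj
    (extPresheaf F.presheaf U)

/-- The natural inclusion `i_! i^* F → i'_! i'^* F` for open subsets `U ⊆ U'`. -/
def extZeroMap (F : TopCat.Sheaf (ModuleCat.{u} R) X) {U U' : Opens X} (h : U ≤ U') :
    extZero F U ⟶ extZero F U' :=
  (presheafToSheaf (Opens.grothendieckTopology X) (ModuleCat.{u} R)).map
    (extPresheafMap F.presheaf h)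

/-- The natural morphism `i_! i^* F → F`. -/
def extZeroι (F : TopCat.Sheaf (ModuleCat.{u} R) X) (U : Opens X) : extZero F U ⟶ F :=
  ((sheafificationAdjunction (Opens.grothendieckTopology X) (ModuleCat.{u} R)).homEquiv _ _).symm
    (extPresheafι F.presheaf U)

end Sheaves

section Orientations

variable {N : Type u} [AddCommGroup N]

/-- An orientation of a fan: an orientation of the vector space `ℝσ` for every cone `σ`. -/
def Fan.Orientation (Δ : Fan N) : Type u :=
  ∀ σ : Δ.Cone, _root_.Orientation ℝ (coneSpan σ.1) (Fin (coneDim σ.1))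

namespace Fan.Orientation

variable {Δ : Fan N}

/-- The cones of full dimension are all oriented by one and the same orientation of `N_ℝ`,
represented by the volume form `ω`. -/
def IsCoherent (o : Δ.Orientation) : Prop :=
  ∃ ω : NReal N [⋀^Fin (Module.finrank ℤ N)]→ₗ[ℝ] ℝ,
    ∀ (σ : Δ.Cone) (h : coneDim σ.1 = Module.finrank ℤ N),
      ∃ hω : (ω.domDomCongr (finCongr h.symm)).compLinearMap (coneSpan σ.1).subtype ≠ 0,
        o σ = rayOfNeZero ℝ _ hω

/-- For a face `τ` of codimension one in `σ`, the orientation induced by `σ` on `τ` coincides with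
the orientation of `τ`. The induced orientation is represented by the alternating form
`ω(w, -, …, -)` on `ℝτ`, where `ω` represents the orientation of `σ` and `w ∈ σ` is a vector
outside `τ`: it is the orientation of `ℝτ` compatible with `ℝσ = ℝw ⊕ ℝτ`. -/
def Coincide (o : Δ.Orientation) (τ σ : Δ.Cone) : Prop :=
  ∃ (hle : coneSpan τ.1 ≤ coneSpan σ.1) (hdim : coneDim σ.1 = coneDim τ.1 + 1)
    (ω : coneSpan σ.1 [⋀^Fin (coneDim τ.1 + 1)]→ₗ[ℝ] ℝ) (hω : ω ≠ 0) (w : coneSpan σ.1)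
    (hη : (ω.curryLeft w).compLinearMap (Submodule.inclusion hle) ≠ 0),
    w.1 ∈ σ.1 ∧ Orientation.reindex ℝ _ (finCongr hdim) (o σ) = rayOfNeZero ℝ ω hω ∧
      o τ = rayOfNeZero ℝ _ hη

open Classical in
/-- The sign `ε(τ, σ)`: for a face `τ` of codimension one in `σ`, it is `1` if the orientation
induced by `σ` on `τ` coincides with the orientation of `τ` and `-1` otherwise; it is `0` if `τ`
is not a face of codimension one in `σ`. -/
def sign (o : Δ.Orientation) (τ σ : Δ.Cone) : ℤ :=
  if τ ≤ σ ∧ coneDim σ.1 = coneDim τ.1 + 1 then (if o.Coincide τ σ then 1 else -1) else 0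

end Fan.Orientation

end Orientations

section CechSheaves

variable {N : Type u} [AddCommGroup N] [Module.Finite ℤ N] (Δ : Fan N) (k : Type u) [Field k]
  (R : Type u) [CommRing R]

namespace Fan

/-- The constant sheaf on `X(Δ)`. -/
def toricConst : TopCat.Sheaf (ModuleCat.{u} R) (Δ.toricVariety k).toTopCat :=
  constSheaf R (Δ.toricVariety k).toTopCat

/-- The sheaf `i_{σ!} i_σ^* R_X` on `X(Δ)`. -/
def cechSummand (σ : Δ.Cone) : TopCat.Sheaf (ModuleCat.{u} R) (Δ.toricVariety k).toTopCat :=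
  extZero (Δ.toricConst k R) (Δ.affineOpen k σ)

/-- The sheaf `⨁_{σ ∈ Δ^{(p)}} i_{σ!} i_σ^* R_X`. -/
def cechSheaf (p : ℕ) : TopCat.Sheaf (ModuleCat.{u} R) (Δ.toricVariety k).toTopCat :=
  ⨁ fun σ : Δ.OfCodim p => Δ.cechSummand k R σ.1

open Classical in
/-- The differential, whose component from the summand of `τ` to the summand of `σ` is
`ε(τ, σ) ι_{τ,σ}` if `τ ≤ σ`, and zero otherwise. -/
def cechD (o : Δ.Orientation) (p : ℕ) : Δ.cechSheaf k R (p + 1) ⟶ Δ.cechSheaf k R p :=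
  biproduct.desc fun τ : Δ.OfCodim (p + 1) => biproduct.lift fun σ : Δ.OfCodim p =>
    if h : τ.1 ≤ σ.1 then
      o.sign τ.1 σ.1 • extZeroMap (Δ.toricConst k R) (Δ.affineOpen_mono k h)
    else 0

/-- The augmentation, induced by the natural morphisms `i_{σ!} i_σ^* R_X → R_X`. -/
def cechAug : Δ.cechSheaf k R 0 ⟶ Δ.toricConst k R :=
  biproduct.desc fun σ : Δ.OfCodim 0 => extZeroι (Δ.toricConst k R) (Δ.affineOpen k σ.1)

/-- The stalk functor at a point of `X(Δ)`. -/
def stalkAt (x : Δ.toricVariety k) :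
    TopCat.Sheaf (ModuleCat.{u} R) (Δ.toricVariety k).toTopCat ⥤ ModuleCat.{u} R :=
  TopCat.Sheaf.forget (ModuleCat.{u} R) (Δ.toricVariety k).toTopCat ⋙
    TopCat.Presheaf.stalkFunctor (ModuleCat.{u} R) x

end Fan

end CechSheaves

section Star

variable {N : Type u} [AddCommGroup N] {Δ : Fan N} (R : Type u) [CommRing R]

namespace Fan

/-- The cones `τ ≥ σ` of codimension `p`. They correspond bijectively, with the same codimension,
to the cones of the quotient fan `Δ_σ` in `N / (ℝσ ∩ N)`. -/
abbrev StarOfCodim (σ : Δ.Cone) (p : ℕ) : Type u := {τ : Δ.Cone // σ ≤ τ ∧ HasCodim τ p}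

/-- The free module on the cones of codimension `p` of the fan `Δ_σ`. -/
abbrev StarChains (σ : Δ.Cone) (p : ℕ) : Type u := StarOfCodim σ p →₀ R

/-- The differential `[τ] ↦ ∑_ρ ε(τ, ρ) [ρ]`. -/
def starD (o : Δ.Orientation) (σ : Δ.Cone) (p : ℕ) :
    StarChains R σ (p + 1) →ₗ[R] StarChains R σ p :=
  Finsupp.linearCombination R fun τ : StarOfCodim σ (p + 1) =>
    Finsupp.equivFunOnFinite.symm fun ρ : StarOfCodim σ p => ((o.sign τ.1 ρ.1 : ℤ) : R)

/-- The augmentation `∑ x_τ [τ] ↦ ∑ x_τ`. -/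
def starAug (σ : Δ.Cone) : StarChains R σ 0 →ₗ[R] R :=
  Finsupp.linearCombination R fun _ => (1 : R)

/-- The `q`-simplices `τ_0 < ⋯ < τ_q` of the simplicial complex of flags of the fan `Δ_σ`, written
as flags of cones `τ_i ≥ σ` of `Δ`. -/
abbrev Flag (σ : Δ.Cone) (q : ℕ) : Type u := Fin (q + 1) ↪o {τ : Δ.Cone // σ ≤ τ}

/-- The face of a flag omitting its `i`-th cone. -/
def flagFace {σ : Δ.Cone} {q : ℕ} (f : Flag σ (q + 1)) (i : Fin (q + 2)) : Flag σ q :=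
  (Fin.succAboveOrderEmb i).trans f

/-- The simplicial boundary `∑ (-1)^i ∂_i` of the complex of flags. -/
def flagD (σ : Δ.Cone) (q : ℕ) : (Flag σ (q + 1) →₀ R) →ₗ[R] (Flag σ q →₀ R) :=
  Finsupp.linearCombination R fun f : Flag σ (q + 1) =>
    ∑ i : Fin (q + 2), Finsupp.single (flagFace f i) ((-1 : R) ^ (i : ℕ))

/-- The dual cell of a cone `τ` is the subcomplex of the flags `τ_0 < ⋯ < τ_q` with `τ ≤ τ_0`; it
has dimension the codimension of `τ`. These are the simplicial `q`-chains of the `p`-skeleton of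
the dual cell decomposition, the union of the dual cells of dimension at most `p`: it consists of
the flags with `τ_0` of codimension at most `p`. -/
def skeletonChains (σ : Δ.Cone) (q p : ℕ) : Submodule R (Flag σ q →₀ R) :=
  Finsupp.supported R R {f | Module.finrank ℤ N ≤ coneDim (f 0).1.1 + p}

/-- The cellular `p`-chains of the dual cell decomposition: the relative homology
`H_p(X_p, X_{p-1})` of its skeleta `X_p`, computed with simplicial chains. As dimensions increase
strictly along a flag, the skeleton `X_p` has no `(p+1)`-simplices and `X_{p-1}` has no
`p`-simplices, so this is the module of the relative cycles, the chains of `X_p` with boundary in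
`X_{p-1}`; the cellular differential is the restriction of the simplicial boundary. -/
def cellularChains (σ : Δ.Cone) : (p : ℕ) → Submodule R (Flag σ p →₀ R)
  | 0 => skeletonChains R σ 0 0
  | p + 1 => skeletonChains R σ (p + 1) (p + 1) ⊓ (skeletonChains R σ p p).comap (flagD R σ p)

end Fan

end Star

end ToricRes

end

/-! Exactness of sheaves is tested on stalks. Every point `x` of `X(Δ)` has a smallest affine piece
`X_σ`; then `x` lies in the orbit `T_σ`, and `x ∈ X_τ` exactly when `σ ≤ τ`. Hence the stalk of
`i_{τ!} i_τ^* R_X` at `x` is `R` for `τ ≥ σ` and zero otherwise, and the stalk of the Čech complex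
is the free complex on the cones `τ ≥ σ` with the incidence signs as differential
(`cechStalkMap_bijective`, `cechStalkMap_cechD`). Everything reduces to the exactness of this
combinatorial complex.

Near a point of the relative interior of `σ`, the relative interiors of the cones `τ ≥ σ` decompose
an open convex set `U` into polyhedral cells. After rescaling each basis element by a sign, the
combinatorial complex becomes the complex of this decomposition in which a cell is sent to the cells
having it as a facet (`sign_eq`, `cellD_extend`). That the differential squares to zero is the
diamond property (`sum_incid_mul_incid`): if one cell lies between two cells whose dimensions differ
by two, then exactly two do, and their sign products are opposite. Coherence of the orientations
makes the augmentation compatible with the rescaling.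

Exactness is proved by cutting. Cutting all cells along a hyperplane `u = 0` does not affect whether
the augmented complex is a resolution: merging the two halves of every cut cell is a surjective
chain map, compatible with the augmentations, whose kernel is acyclic (`exists_of_collapse_eq_zero`,
`cellExact_cut_iff`). After cutting along all functionals that define the cones, the fan
decomposition and the decomposition with the single cell `U` become equal, and for the latter the
claim is trivial (`IsDecomp.isCellResolution`).

For the comparison with dual cells, `[τ]` is sent to the sum of all maximal flags starting at `τ`,
each weighted by the product of the signs along it (`dualCell`). In the simplicial boundary, the
faces omitting an inner cone cancel because the differential squares to zero, those omitting the
last cone cancel because augmentation after differential is zero, and those omitting the first cone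
give the differential of `[τ]`. That every cellular chain arises in this way follows by induction on
the length of flags, using exactness around the first cone of a flag (`IsCellularTuple.exists_eq`).
-/

namespace ToricRes

noncomputable section

/-! ### Volume elements of subspaces in the exterior algebra -/

section Volume

open Module

variable {V : Type*} [AddCommGroup V] [Module ℝ V]

/-- Over a field the inclusion of `L` induces an injection of exterior algebras, and on the exterior
algebra of `L` the functional extending `b.det` takes the value 1 at this element. -/
lemma ιMulti_basis_ne_zero {L : Submodule ℝ V} {d : ℕ} (b : Basis (Fin d) ℝ L) :
    ExteriorAlgebra.ιMulti ℝ d (fun i => (b i : V)) ≠ 0 := by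
  intro h
  have h1 : ExteriorAlgebra.map L.subtype (ExteriorAlgebra.ιMulti ℝ d b) = 0 := by
    rw [ExteriorAlgebra.map_apply_ιMulti]; exact h
  have h2 : ExteriorAlgebra.ιMulti ℝ d b = 0 :=
    ExteriorAlgebra.map_injective_field (f := L.subtype) (Submodule.ker_subtype _)
      (by rw [h1, map_zero])
  have h3 := ExteriorAlgebra.liftAlternating_apply_ιMulti (R := ℝ)
    (Pi.single (M := fun i => L [⋀^Fin i]→ₗ[ℝ] ℝ) d b.det) b
  rw [h2, map_zero, Pi.single_eq_same, b.det_self] at h3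
  exact zero_ne_one h3

/-- Both sides are alternating in `v`, so it suffices to compare them on injective tuples of basis
vectors, where each changes by the sign of the permutation. -/
lemma ιMulti_eq_det_smul {L : Submodule ℝ V} {d : ℕ} (b : Basis (Fin d) ℝ L) (v : Fin d → L) :
    ExteriorAlgebra.ιMulti ℝ d (fun i => (v i : V)) =
      b.det v • ExteriorAlgebra.ιMulti ℝ d (fun i => (b i : V)) := by
  have h : (ExteriorAlgebra.ιMulti ℝ d).compLinearMap L.subtype =
      b.det.smulRight (ExteriorAlgebra.ιMulti ℝ d (fun i => (b i : V))) := by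
    refine b.ext_alternating fun w hw => ?_
    let e := Equiv.ofBijective w (Finite.injective_iff_bijective.1 hw)
    have h1 := AlternatingMap.map_perm ((ExteriorAlgebra.ιMulti ℝ d).compLinearMap L.subtype) b e
    have h2 := AlternatingMap.map_perm b.det b e
    simp only [AlternatingMap.smulRight_apply]
    change _ = b.det (⇑b ∘ ⇑e) • _
    change ((ExteriorAlgebra.ιMulti ℝ d).compLinearMap L.subtype) (⇑b ∘ ⇑e) = _
    rw [h1, h2, b.det_self, smul_assoc, one_smul]
    rfl
  exact congrArg (fun φ => φ v) h

lemma ι_mul_ι_mul_self (a : V) (x : ExteriorAlgebra ℝ V) :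
    ExteriorAlgebra.ι ℝ a * (ExteriorAlgebra.ι ℝ a * x) = 0 := by
  rw [← mul_assoc, ExteriorAlgebra.ι_sq_zero, zero_mul]

variable [FiniteDimensional ℝ V]

/-- The volume element of a subspace with respect to a fixed basis, in the exterior algebra. -/
def volElt (L : Submodule ℝ V) : ExteriorAlgebra ℝ V :=
  ExteriorAlgebra.ιMulti ℝ (finrank ℝ L) (fun i => (Module.finBasis ℝ L i : V))

/-- `L` is a hyperplane in `M`. -/
def Covers (L M : Submodule ℝ V) : Prop := L ≤ M ∧ finrank ℝ M = finrank ℝ L + 1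

open Classical in
/-- The number `c` such that `w ∧ vol L = c • vol M`. -/
def volCoeff (L M : Submodule ℝ V) (w : V) : ℝ :=
  -- Such a scalar is unique because `volElt M` is nonzero; 0 is only a default value for pairs
  -- without such a relation.
  if h : ∃ c : ℝ, ExteriorAlgebra.ι ℝ w * volElt L = c • volElt M then h.choose else 0

lemma volElt_ne_zero (L : Submodule ℝ V) : volElt L ≠ 0 :=
  ιMulti_basis_ne_zero _

lemma volElt_eq_of_eq {L : Submodule ℝ V} {d : ℕ} (h : finrank ℝ L = d) :
    volElt L = ExteriorAlgebra.ιMulti ℝ d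
      (fun i => ((Module.finBasis ℝ L).reindex (finCongr h) i : V)) := by
  subst h; simp [volElt]

lemma ι_mul_volElt {L M : Submodule ℝ V} (h : Covers L M) {w : V} (hw : w ∈ M) :
    ExteriorAlgebra.ι ℝ w * volElt L =
      ((Module.finBasis ℝ M).reindex (finCongr h.2)).det
        (Fin.cons ⟨w, hw⟩ fun i => Submodule.inclusion h.1 (Module.finBasis ℝ L i)) •
          volElt M := by
  rw [volElt_eq_of_eq h.2, ← ιMulti_eq_det_smul, ExteriorAlgebra.ιMulti_succ_apply]
  rfl

lemma volCoeff_eq_of_smul {L M : Submodule ℝ V} {w : V} {c : ℝ}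
    (h : ExteriorAlgebra.ι ℝ w * volElt L = c • volElt M) : volCoeff L M w = c := by
  have h1 : ∃ c : ℝ, ExteriorAlgebra.ι ℝ w * volElt L = c • volElt M := ⟨c, h⟩
  rw [volCoeff, dif_pos h1]
  have h2 : _ = h1.choose • volElt M := h1.choose_spec
  exact smul_left_injective ℝ (volElt_ne_zero M) (h2.symm.trans h)

lemma volCoeff_eq_det {L M : Submodule ℝ V} (h : Covers L M) {w : V} (hw : w ∈ M) :
    volCoeff L M w = ((Module.finBasis ℝ M).reindex (finCongr h.2)).det
        (Fin.cons ⟨w, hw⟩ fun i => Submodule.inclusion h.1 (Module.finBasis ℝ L i)) :=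
  volCoeff_eq_of_smul (ι_mul_volElt h hw)

lemma volCoeff_spec {L M : Submodule ℝ V} (h : Covers L M) {w : V} (hw : w ∈ M) :
    ExteriorAlgebra.ι ℝ w * volElt L = volCoeff L M w • volElt M := by
  rw [volCoeff_eq_det h hw]; exact ι_mul_volElt h hw

lemma volCoeff_add {L M : Submodule ℝ V} (h : Covers L M) {w w' : V} (hw : w ∈ M) (hw' : w' ∈ M) :
    volCoeff L M (w + w') = volCoeff L M w + volCoeff L M w' := by
  apply volCoeff_eq_of_smul
  rw [map_add, add_mul, volCoeff_spec h hw, volCoeff_spec h hw', add_smul]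

lemma volCoeff_smul {L M : Submodule ℝ V} (h : Covers L M) {w : V} (hw : w ∈ M) (t : ℝ) :
    volCoeff L M (t • w) = t * volCoeff L M w := by
  apply volCoeff_eq_of_smul
  rw [map_smul, smul_mul_assoc, volCoeff_spec h hw, mul_smul]

lemma ι_mul_volElt_eq_zero {L : Submodule ℝ V} {w : V} (hw : w ∈ L) :
    ExteriorAlgebra.ι ℝ w * volElt L = 0 := by
  have : ExteriorAlgebra.ι ℝ w * volElt L = ExteriorAlgebra.ιMulti ℝ (finrank ℝ L + 1)
      (Fin.cons w fun i => (Module.finBasis ℝ L i : V)) := by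
    rw [ExteriorAlgebra.ιMulti_succ_apply]; rfl
  rw [this]
  apply AlternatingMap.map_linearDependent
  intro h
  have h1 := (linearIndependent_finCons.1 h).2
  apply h1
  have : Set.range (fun i => (Module.finBasis ℝ L i : V)) = L.subtype '' Set.range (finBasis ℝ L) := by
    rw [← Set.range_comp]; rfl
  rw [this, Submodule.span_image, (Module.finBasis ℝ L).span_eq]
  simpa using hw

lemma volCoeff_eq_zero_of_mem {L M : Submodule ℝ V} {w : V} (hw : w ∈ L) :
    volCoeff L M w = 0 := by
  apply volCoeff_eq_of_smul
  rw [ι_mul_volElt_eq_zero hw, zero_smul]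

/-- A vector outside `L` followed by a basis of `L` is linearly independent, so its wedge product
does not vanish. -/
lemma volCoeff_ne_zero {L M : Submodule ℝ V} (h : Covers L M) {w : V} (hw : w ∈ M) (hwL : w ∉ L) :
    volCoeff L M w ≠ 0 := by
  intro h0
  have h1 := volCoeff_spec h hw
  rw [h0, zero_smul] at h1
  have hli : LinearIndependent ℝ (Fin.cons w fun i => (Module.finBasis ℝ L i : V) : Fin _ → V) := by
    refine linearIndependent_finCons.2 ⟨(Module.finBasis ℝ L).linearIndependent.map' L.subtype (by simp), ?_⟩
    intro h2
    apply hwL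
    refine Submodule.span_le.2 ?_ h2
    rintro _ ⟨i, rfl⟩
    exact (Module.finBasis ℝ L i).2
  refine ιMulti_basis_ne_zero (Basis.span hli) ?_
  have h3 : ∀ i, ((Basis.span hli i : Submodule.span ℝ _) : V) =
    (Fin.cons w fun i => (Module.finBasis ℝ L i : V) : Fin _ → V) i := fun i =>
      congrArg Subtype.val (Basis.span_apply hli i)
  simp only [h3]
  rw [ExteriorAlgebra.ιMulti_succ_apply]
  exact h1

lemma Covers.exists_eq_add_smul {L M : Submodule ℝ V} (h : Covers L M) {w : V} (hw : w ∈ M)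
    (hwL : w ∉ L) {v : V} (hv : v ∈ M) : ∃ l ∈ L, ∃ t : ℝ, v = l + t • w := by
  have h1 : L ⊔ Submodule.span ℝ {w} = M := by
    refine Submodule.eq_of_le_of_finrank_le
      (sup_le h.1 ((Submodule.span_singleton_le_iff_mem _ _).2 hw)) ?_
    rw [h.2]
    refine Submodule.finrank_lt_finrank_of_lt (lt_of_le_of_ne le_sup_left fun h2 => hwL ?_)
    rw [h2]
    exact Submodule.mem_sup_right (Submodule.mem_span_singleton_self w)
  rw [← h1] at hv
  obtain ⟨l, hl, z, hz, rfl⟩ := Submodule.mem_sup.1 hv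
  obtain ⟨t, rfl⟩ := Submodule.mem_span_singleton.1 hz
  exact ⟨l, hl, t, rfl⟩

lemma covers_of_forall {L M : Submodule ℝ V} (h : L ≤ M) {w : V} (hw : w ∈ M) (hwL : w ∉ L)
    (H : ∀ v ∈ M, ∃ t : ℝ, v - t • w ∈ L) : Covers L M := by
  refine ⟨h, ?_⟩
  have h1 : M = L ⊔ Submodule.span ℝ {w} := by
    refine le_antisymm (fun v hv => ?_) (sup_le h ((Submodule.span_singleton_le_iff_mem _ _).2 hw))
    obtain ⟨t, ht⟩ := H v hv
    rw [← sub_add_cancel v (t • w)]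
    exact Submodule.add_mem_sup ht (Submodule.smul_mem _ _ (Submodule.mem_span_singleton_self w))
  have h2 : L ⊓ Submodule.span ℝ {w} = ⊥ := by
    rw [eq_bot_iff]
    rintro v ⟨hv, hv'⟩
    obtain ⟨t, rfl⟩ := Submodule.mem_span_singleton.1 hv'
    by_cases ht : t = 0
    · simp [ht]
    · exact absurd ((Submodule.smul_mem_iff _ ht).1 hv) hwL
  have h3 := Submodule.finrank_sup_add_finrank_inf_eq L (Submodule.span ℝ {w})
  rw [h2, finrank_bot, ← h1, finrank_span_singleton (show w ≠ 0 from fun h0 => hwL (h0 ▸ L.zero_mem))] at h3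
  omega

end Volume

end

end ToricRes

namespace ToricRes

noncomputable section

/-! ### Polyhedral cell decompositions of open convex sets and their incidence numbers -/

section Cells

open Module

variable {V : Type*} [AddCommGroup V] [Module ℝ V]

/-- `c` lies in the closure of `c'`, in the sense that all half-open segments from `c` to `c'` are
contained in `c'`. -/
def Adheres (c c' : Set V) : Prop :=
  ∀ x ∈ c, ∀ y ∈ c', ∀ t : ℝ, 0 < t → t ≤ 1 → x + t • (y - x) ∈ c'

/-- Convex subsets which are open along lines. -/
structure IsOpenConvex (U : Set V) : Prop where
  convex : Convex ℝ U
  isOpen : ∀ x ∈ U, ∀ v : V, ∃ δ > (0 : ℝ), ∀ t : ℝ, 0 ≤ t → t ≤ δ → x + t • v ∈ U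

/-- A nonempty subset of `U` defined by linear equations and strict linear inequalities. -/
def IsCell (U c : Set V) : Prop :=
  c.Nonempty ∧ ∃ (W : Submodule ℝ V) (A : Finset (Dual ℝ V)),
    c = {x | x ∈ U ∧ x ∈ W ∧ ∀ α ∈ A, 0 < α x}

/-- A finite decomposition of `U` into cells satisfying the frontier condition. -/
structure IsDecomp (U : Set V) (𝒞 : Finset (Set V)) : Prop where
  cell : ∀ c ∈ 𝒞, IsCell U c
  disj : ∀ c ∈ 𝒞, ∀ c' ∈ 𝒞, ∀ x, x ∈ c → x ∈ c' → c = c'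
  cover : ∀ x ∈ U, ∃ c ∈ 𝒞, x ∈ c
  frontier : ∀ c ∈ 𝒞, ∀ c' ∈ 𝒞, ∀ x ∈ c, ∀ y ∈ c',
    (∀ t : ℝ, 0 < t → t ≤ 1 → x + t • (y - x) ∈ c') → Adheres c c'

lemma exists_forall_pos (A : Finset (Dual ℝ V)) {x : V} (h : ∀ α ∈ A, 0 < α x) (v : V) :
    ∃ δ > (0 : ℝ), ∀ t : ℝ, 0 ≤ t → t ≤ δ → ∀ α ∈ A, 0 < α (x + t • v) := by
  classical
  induction A using Finset.induction_on with
  | empty => exact ⟨1, one_pos, by simp⟩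
  | insert a A _ ih =>
    obtain ⟨δ, hδ, H⟩ := ih fun α hα => h α (Finset.mem_insert_of_mem hα)
    have ha := h a (Finset.mem_insert_self _ _)
    refine ⟨min δ (a x / (2 * (|a v| + 1))), lt_min hδ (by positivity), fun t h0 ht α hα => ?_⟩
    rcases Finset.mem_insert.1 hα with rfl | hα
    · have h1 := ht.trans (min_le_right _ _)
      rw [le_div_iff₀ (by positivity)] at h1
      rw [map_add, map_smul, smul_eq_mul]
      nlinarith [neg_abs_le (α v), abs_nonneg (α v)]
    · exact H t h0 (ht.trans (min_le_left _ _)) α hα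

lemma IsCell.subset {U c : Set V} (hc : IsCell U c) : c ⊆ U := by
  obtain ⟨_, W, A, rfl⟩ := hc
  exact fun x hx => hx.1

lemma IsCell.convex {U c : Set V} (hU : IsOpenConvex U) (hc : IsCell U c) : Convex ℝ c := by
  obtain ⟨_, W, A, rfl⟩ := hc
  intro x hx y hy a b ha hb hab
  refine ⟨hU.convex hx.1 hy.1 ha hb hab, W.add_mem (W.smul_mem _ hx.2.1) (W.smul_mem _ hy.2.1),
    fun α hα => ?_⟩
  have h1 := hx.2.2 α hα
  have h2 := hy.2.2 α hα
  rw [map_add, map_smul, map_smul, smul_eq_mul, smul_eq_mul]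
  rcases ha.eq_or_lt with rfl | ha
  · rw [zero_add] at hab; subst hab; simpa using h2
  · have := mul_pos ha h1
    have := mul_nonneg hb h2.le
    linarith

lemma sub_mem_vectorSpan {c : Set V} {x y : V} (hx : x ∈ c) (hy : y ∈ c) :
    y - x ∈ vectorSpan ℝ c := vsub_mem_vectorSpan ℝ hy hx

lemma vectorSpan_le {c : Set V} {W : Submodule ℝ V} (h : ∀ x ∈ c, ∀ y ∈ c, y - x ∈ W) :
    vectorSpan ℝ c ≤ W := by
  refine Submodule.span_le.2 ?_
  rintro _ ⟨y, hy, x, hx, rfl⟩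
  exact h x hx y hy

lemma IsCell.exists_add_smul_mem {U c : Set V} (hU : IsOpenConvex U) (hc : IsCell U c) {x v : V}
    (hx : x ∈ c) (hv : v ∈ vectorSpan ℝ c) :
    ∃ δ > (0 : ℝ), ∀ t : ℝ, 0 ≤ t → t ≤ δ → x + t • v ∈ c := by
  obtain ⟨_, W, A, rfl⟩ := hc
  have hW : v ∈ W := vectorSpan_le (fun x hx y hy => W.sub_mem hy.2.1 hx.2.1) hv
  obtain ⟨δ, hδ, H⟩ := exists_forall_pos A hx.2.2 v
  obtain ⟨δ', hδ', H'⟩ := hU.isOpen x hx.1 v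
  exact ⟨min δ δ', lt_min hδ hδ', fun t h0 h1 => ⟨H' t h0 (h1.trans (min_le_right _ _)),
    W.add_mem hx.2.1 (W.smul_mem _ hW), H t h0 (h1.trans (min_le_left _ _))⟩⟩

/-- The midpoint of the segment already belongs to `c'`, and `y - x` is twice the difference of `y`
and this midpoint. -/
lemma Adheres.sub_mem {c c' : Set V} (h : Adheres c c') {x y : V} (hx : x ∈ c) (hy : y ∈ c') :
    y - x ∈ vectorSpan ℝ c' := by
  have h1 := sub_mem_vectorSpan (h x hx y hy (1 / 2) (by norm_num) (by norm_num)) hy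
  have h2 : y - x = (2 : ℝ) • (y - (x + (1 / 2 : ℝ) • (y - x))) := by module
  rw [h2]
  exact Submodule.smul_mem _ _ h1

lemma Adheres.vectorSpan_le {c c' : Set V} (h : Adheres c c') (hc' : c'.Nonempty) :
    vectorSpan ℝ c ≤ vectorSpan ℝ c' := by
  obtain ⟨y, hy⟩ := hc'
  refine ToricRes.vectorSpan_le fun a ha b hb => ?_
  have : b - a = (y - a) - (y - b) := by abel
  rw [this]
  exact Submodule.sub_mem _ (h.sub_mem ha hy) (h.sub_mem hb hy)

namespace IsDecomp

variable {U : Set V} {𝒞 : Finset (Set V)} (hU : IsOpenConvex U) (h𝒞 : IsDecomp U 𝒞)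

include hU h𝒞

/-- A cell is open in its span, so a short displacement from `x` in the direction `y - x` stays in
`c`, while adherence puts the same points into `c'`; cells are disjoint. -/
lemma eq_of_sub_mem {c c' : Set V} (hc : c ∈ 𝒞) (hc' : c' ∈ 𝒞) (h : Adheres c c') {x y : V}
    (hx : x ∈ c) (hy : y ∈ c') (hxy : y - x ∈ vectorSpan ℝ c) : c = c' := by
  obtain ⟨δ, hδ, H⟩ := (h𝒞.cell c hc).exists_add_smul_mem hU hx hxy
  refine h𝒞.disj c hc c' hc' _ (H (min δ 1) (le_min hδ.le zero_le_one) (min_le_left _ _)) ?_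
  exact h x hx y hy _ (lt_min hδ one_pos) (min_le_right _ _)

/-- Cells are convex and therefore meet the ray in intervals. A cell containing no initial piece of
the ray avoids some initial piece, and by finiteness a common initial piece would avoid all cells,
against the covering of `U`. -/
lemma germ {x : V} (hx : x ∈ U) (v : V) :
    ∃ c ∈ 𝒞, ∃ δ > (0 : ℝ), ∀ t : ℝ, 0 < t → t ≤ δ → x + t • v ∈ c := by
  obtain ⟨δ, hδ, H⟩ := hU.isOpen x hx v
  by_contra! hcon
  have key : ∀ c ∈ 𝒞, ∃ δ' > (0 : ℝ), ∀ t : ℝ, 0 < t → t ≤ δ' → x + t • v ∉ c := by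
    intro c hc
    by_contra! h1
    -- If the ray met `c` at arbitrarily small parameters, there would be `b ≤ t ≤ a` with the outer
    -- two points in `c` and the middle one outside, against convexity.
    obtain ⟨a, ha0, ha1, hac⟩ := h1 1 one_pos
    obtain ⟨t, ht0, ht1, htc⟩ := hcon c hc a ha0
    obtain ⟨b, hb0, hb1, hbc⟩ := h1 t ht0
    apply htc
    have hab : b < a ∨ a = t := by
      rcases hb1.lt_or_eq with h | h
      · exact Or.inl (h.trans_le ht1)
      · subst h; exact absurd hbc htc
    rcases hab with hab | rfl
    · have h2 := ((h𝒞.cell c hc).convex hU) hbc hac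
        (show (0 : ℝ) ≤ (a - t) / (a - b) from div_nonneg (by linarith) (by linarith))
        (show (0 : ℝ) ≤ (t - b) / (a - b) from div_nonneg (by linarith) (by linarith))
        (by rw [← add_div]; rw [div_eq_one_iff_eq (by linarith)]; ring)
      convert h2 using 1
      have h3 : a - b ≠ 0 := by linarith
      have h4 : t = (a - t) / (a - b) * b + (t - b) / (a - b) * a := by field_simp; ring
      have h5 : (a - t) / (a - b) + (t - b) / (a - b) = 1 := by field_simp; ring
      rw [smul_add, smul_add, smul_smul, smul_smul]
      nth_rewrite 1 [h4]
      nth_rewrite 1 [← one_smul ℝ x]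
      rw [← h5]
      module
    · exact hac
  choose! δ' hδ' H' using key
  obtain ⟨η, hη, hηδ, hη'⟩ : ∃ η > (0 : ℝ), η ≤ δ ∧ ∀ c ∈ 𝒞, η ≤ δ' c := by
    rcases 𝒞.eq_empty_or_nonempty with rfl | hne
    · exact ⟨δ, hδ, le_rfl, by simp⟩
    · refine ⟨min δ (𝒞.inf' hne δ'), lt_min hδ ?_, min_le_left _ _, fun c hc =>
        (min_le_right _ _).trans (Finset.inf'_le _ hc)⟩
      rw [Finset.lt_inf'_iff]
      exact hδ'
  obtain ⟨c, hc, hxc⟩ := h𝒞.cover _ (H η hη.le hηδ)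
  exact H' c hc η hη (hη' c hc) hxc

end IsDecomp

variable [FiniteDimensional ℝ V]

open Classical in
/-- The incidence number of two cells, with respect to the chosen volume elements. -/
def incid (c c' : Set V) : ℤ :=
  if h : (c.Nonempty ∧ c'.Nonempty) ∧ Adheres c c' ∧ Covers (vectorSpan ℝ c) (vectorSpan ℝ c') then
    SignType.sign (volCoeff (vectorSpan ℝ c) (vectorSpan ℝ c') (h.1.2.some - h.1.1.some))
  else 0

lemma incid_eq_zero {c c' : Set V}
    (h : Adheres c c' → ¬ Covers (vectorSpan ℝ c) (vectorSpan ℝ c')) : incid c c' = 0 :=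
  dif_neg fun h' => h h'.2.1 h'.2.2

lemma adheres_of_incid_ne_zero {c c' : Set V} (h : incid c c' ≠ 0) :
    Adheres c c' ∧ Covers (vectorSpan ℝ c) (vectorSpan ℝ c') := by
  by_contra h'
  exact h (incid_eq_zero fun h1 h2 => h' ⟨h1, h2⟩)

namespace IsDecomp

variable {U : Set V} {𝒞 : Finset (Set V)} (hU : IsOpenConvex U) (h𝒞 : IsDecomp U 𝒞)

include hU h𝒞

omit [FiniteDimensional ℝ V] in
lemma sub_notMem {c c' : Set V} (hc : c ∈ 𝒞) (hc' : c' ∈ 𝒞) (h : Adheres c c')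
    (hcov : Covers (vectorSpan ℝ c) (vectorSpan ℝ c')) {x y : V} (hx : x ∈ c) (hy : y ∈ c') :
    y - x ∉ vectorSpan ℝ c := by
  intro hxy
  have h1 := hcov.2
  rw [h𝒞.eq_of_sub_mem hU hc hc' h hx hy hxy] at h1
  omega

lemma volCoeff_sub_ne_zero {c c' : Set V} (hc : c ∈ 𝒞) (hc' : c' ∈ 𝒞) (h : Adheres c c')
    (hcov : Covers (vectorSpan ℝ c) (vectorSpan ℝ c')) {x y : V} (hx : x ∈ c) (hy : y ∈ c') :
    volCoeff (vectorSpan ℝ c) (vectorSpan ℝ c') (y - x) ≠ 0 :=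
  volCoeff_ne_zero hcov (h.sub_mem hx hy) (h𝒞.sub_notMem hU hc hc' h hcov hx hy)

/-- The coefficient of `y - x` is affine in the pair `(x, y)`, which runs through a convex set, and
it never vanishes there. If both signs occurred, the weights `-b / (a - b)` and `a / (a - b)` would
produce a zero. -/
lemma sign_volCoeff_eq {c c' : Set V} (hc : c ∈ 𝒞) (hc' : c' ∈ 𝒞) (h : Adheres c c')
    (hcov : Covers (vectorSpan ℝ c) (vectorSpan ℝ c')) {x y x' y' : V} (hx : x ∈ c) (hy : y ∈ c')
    (hx' : x' ∈ c) (hy' : y' ∈ c') (hp : 0 < volCoeff (vectorSpan ℝ c) (vectorSpan ℝ c') (y - x)) :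
    0 < volCoeff (vectorSpan ℝ c) (vectorSpan ℝ c') (y' - x') := by
  by_contra! hn
  set a := volCoeff (vectorSpan ℝ c) (vectorSpan ℝ c') (y - x) with ha
  set b := volCoeff (vectorSpan ℝ c) (vectorSpan ℝ c') (y' - x') with hb
  have hab : 0 < a - b := by linarith
  have hs : (-b) / (a - b) + a / (a - b) = 1 := by field_simp; ring
  have h0 : 0 ≤ (-b) / (a - b) := div_nonneg (by linarith) hab.le
  have h1 : 0 ≤ a / (a - b) := div_nonneg hp.le hab.le
  have hx'' := ((h𝒞.cell c hc).convex hU) hx hx' h0 h1 hs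
  have hy'' := ((h𝒞.cell c' hc').convex hU) hy hy' h0 h1 hs
  refine h𝒞.volCoeff_sub_ne_zero hU hc hc' h hcov hx'' hy'' ?_
  have : ((-b) / (a - b)) • y + (a / (a - b)) • y' - (((-b) / (a - b)) • x + (a / (a - b)) • x') =
    ((-b) / (a - b)) • (y - x) + (a / (a - b)) • (y' - x') := by module
  rw [this, volCoeff_add hcov (Submodule.smul_mem _ _ (h.sub_mem hx hy))
    (Submodule.smul_mem _ _ (h.sub_mem hx' hy')), volCoeff_smul hcov (h.sub_mem hx hy),
    volCoeff_smul hcov (h.sub_mem hx' hy'), ← ha, ← hb]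
  field_simp
  ring

lemma incid_eq {c c' : Set V} (hc : c ∈ 𝒞) (hc' : c' ∈ 𝒞) (h : Adheres c c')
    (hcov : Covers (vectorSpan ℝ c) (vectorSpan ℝ c')) {x y : V} (hx : x ∈ c) (hy : y ∈ c') :
    incid c c' = SignType.sign (volCoeff (vectorSpan ℝ c) (vectorSpan ℝ c') (y - x)) := by
  have hne : (c.Nonempty ∧ c'.Nonempty) ∧ Adheres c c' ∧
      Covers (vectorSpan ℝ c) (vectorSpan ℝ c') := ⟨⟨⟨x, hx⟩, ⟨y, hy⟩⟩, h, hcov⟩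
  rw [incid, dif_pos hne]
  congr 1
  have hx0 := hne.1.1.some_mem
  have hy0 := hne.1.2.some_mem
  rcases (h𝒞.volCoeff_sub_ne_zero hU hc hc' h hcov hx hy).lt_or_gt with h1 | h1
  · rw [sign_neg h1, sign_neg]
    refine lt_of_le_of_ne (not_lt.1 fun h2 => ?_)
      (h𝒞.volCoeff_sub_ne_zero hU hc hc' h hcov hx0 hy0)
    exact absurd (h𝒞.sign_volCoeff_eq hU hc hc' h hcov hx0 hy0 hx hy h2) h1.not_gt
  · rw [sign_pos h1, sign_pos (h𝒞.sign_volCoeff_eq hU hc hc' h hcov hx hy hx0 hy0 h1)]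

lemma incid_mul_self {c c' : Set V} (hc : c ∈ 𝒞) (hc' : c' ∈ 𝒞) (h : Adheres c c')
    (hcov : Covers (vectorSpan ℝ c) (vectorSpan ℝ c')) : incid c c' * incid c c' = 1 := by
  obtain ⟨x, hx⟩ := (h𝒞.cell c hc).1
  obtain ⟨y, hy⟩ := (h𝒞.cell c' hc').1
  rw [h𝒞.incid_eq hU hc hc' h hcov hx hy]
  rcases (h𝒞.volCoeff_sub_ne_zero hU hc hc' h hcov hx hy).lt_or_gt with h1 | h1
  · rw [sign_neg h1]; rfl
  · rw [sign_pos h1]; rfl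

end IsDecomp

end Cells

end

end ToricRes

namespace ToricRes

noncomputable section

/-! ### Cutting a decomposition along a hyperplane -/

section Cut

open Module

variable {V : Type*} [AddCommGroup V] [Module ℝ V]

/-- The part of `c` on which `u` is positive. -/
def posPart (u : Dual ℝ V) (c : Set V) : Set V := c ∩ {x | 0 < u x}

/-- The part of `c` on which `u` vanishes. -/
def zeroPart (u : Dual ℝ V) (c : Set V) : Set V := c ∩ {x | u x = 0}

/-- `c` has points on both sides of the hyperplane `u = 0`. -/
def Crosses (u : Dual ℝ V) (c : Set V) : Prop := (posPart u c).Nonempty ∧ (posPart (-u) c).Nonempty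

lemma Crosses.neg {u : Dual ℝ V} {c : Set V} (h : Crosses u c) : Crosses (-u) c :=
  ⟨h.2, by rw [neg_neg]; exact h.1⟩

lemma crosses_neg {u : Dual ℝ V} {c : Set V} : Crosses (-u) c ↔ Crosses u c :=
  ⟨fun h => by simpa using h.neg, Crosses.neg⟩

lemma zeroPart_neg (u : Dual ℝ V) (c : Set V) : zeroPart (-u) c = zeroPart u c := by
  ext x; simp [zeroPart]

open Classical in
/-- The decomposition obtained by cutting all cells along the hyperplane `u = 0`. -/
def cut (u : Dual ℝ V) (𝒞 : Finset (Set V)) : Finset (Set V) :=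
  𝒞.biUnion fun c => if Crosses u c then {posPart u c, posPart (-u) c, zeroPart u c} else {c}

lemma posPart_subset {u : Dual ℝ V} {c : Set V} : posPart u c ⊆ c := Set.inter_subset_left

lemma zeroPart_subset {u : Dual ℝ V} {c : Set V} : zeroPart u c ⊆ c := Set.inter_subset_left

/-- A strict inequality at a point of `c` persists for a short time on a segment into `c'`, so both
signs of `u` occur on `c'` as well. -/
lemma Adheres.crosses {u : Dual ℝ V} {c c' : Set V} (h : Adheres c c') (hc' : c'.Nonempty)
    (hc : Crosses u c) : Crosses u c' := by
  have key : ∀ u : Dual ℝ V, (posPart u c).Nonempty → (posPart u c').Nonempty := by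
    rintro u ⟨x, hx, hux⟩
    obtain ⟨y, hy⟩ := hc'
    obtain ⟨δ, hδ, H⟩ := exists_forall_pos {u} (x := x) (by simpa using hux) (y - x)
    refine ⟨x + min δ 1 • (y - x), h x hx y hy _ (lt_min hδ one_pos) (min_le_right _ _), ?_⟩
    exact H _ (le_min hδ.le zero_le_one) (min_le_left _ _) u (by simp)
  exact ⟨key u hc.1, key (-u) hc.2⟩

lemma Adheres.posPart {u : Dual ℝ V} {c c' : Set V} (h : Adheres c c') (hc : ∀ x ∈ c, 0 ≤ u x) :
    Adheres c (posPart u c') := by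
  intro x hx y hy t h0 h1
  refine ⟨h x hx y hy.1 t h0 h1, ?_⟩
  have h2 := hc x hx
  have h3 : 0 < u y := hy.2
  have : u (x + t • (y - x)) = (1 - t) * u x + t * u y := by simp; ring
  rw [Set.mem_ofPred_eq, this]
  have := mul_pos h0 h3
  have := mul_nonneg (show 0 ≤ 1 - t by linarith) h2
  linarith

lemma Adheres.nonneg {u : Dual ℝ V} {c c' : Set V} (h : Adheres c c') (hc' : c'.Nonempty)
    (hpos : ∀ y ∈ c', 0 < u y) : ∀ x ∈ c, 0 ≤ u x := by
  intro x hx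
  by_contra! hneg
  obtain ⟨y, hy⟩ := hc'
  obtain ⟨δ, hδ, H⟩ := exists_forall_pos {-u} (x := x) (by simpa using hneg) (y - x)
  have h1 := hpos _ (h x hx y hy _ (lt_min hδ one_pos) (min_le_right _ _))
  have h2 := H _ (le_min hδ.le zero_le_one) (min_le_left _ _) (-u) (by simp)
  rw [LinearMap.neg_apply] at h2
  linarith

lemma IsCell.posPart {U c : Set V} (hc : IsCell U c) {u : Dual ℝ V} (hne : (posPart u c).Nonempty) :
    IsCell U (posPart u c) := by
  classical
  refine ⟨hne, ?_⟩
  obtain ⟨_, W, A, rfl⟩ := hc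
  refine ⟨W, insert u A, ?_⟩
  ext x
  simp only [ToricRes.posPart, Set.mem_inter_iff, Set.mem_ofPred_eq, Finset.forall_mem_insert]
  tauto

lemma IsCell.zeroPart {U c : Set V} (hc : IsCell U c) {u : Dual ℝ V}
    (hne : (zeroPart u c).Nonempty) : IsCell U (zeroPart u c) := by
  refine ⟨hne, ?_⟩
  obtain ⟨_, W, A, rfl⟩ := hc
  refine ⟨W ⊓ LinearMap.ker u, A, ?_⟩
  ext x
  simp only [ToricRes.zeroPart, Set.mem_inter_iff, Set.mem_ofPred_eq, Submodule.mem_inf,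
    LinearMap.mem_ker]
  tauto

/-- Given a point of `c` with `u > 0`, a point of `c` with `u = 0` could be pushed directly away
from it, because `c` is open in its span, and would reach `u < 0`. Without crossing, the sign of `u`
is therefore constant. -/
lemma IsCell.trichotomy {U c : Set V} (hU : IsOpenConvex U) (hc : IsCell U c) (u : Dual ℝ V)
    (h : ¬ Crosses u c) :
    (∀ x ∈ c, 0 < u x) ∨ (∀ x ∈ c, u x < 0) ∨ ∀ x ∈ c, u x = 0 := by
  have key : ∀ u : Dual ℝ V, ¬ Crosses u c → ∀ x ∈ c, 0 < u x → ∀ y ∈ c, 0 < u y := by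
    intro u h x hx hux y hy
    by_contra! hy0
    rcases hy0.lt_or_eq with hy0 | hy0
    · exact h ⟨⟨x, hx, hux⟩, ⟨y, hy, by simpa using hy0⟩⟩
    · obtain ⟨δ, hδ, H⟩ := hc.exists_add_smul_mem hU hy (sub_mem_vectorSpan hx hy)
      refine h ⟨⟨x, hx, hux⟩, ⟨_, H δ hδ.le le_rfl, ?_⟩⟩
      simp only [Set.mem_ofPred_eq, LinearMap.neg_apply, map_add, map_smul, map_sub, hy0, smul_eq_mul]
      nlinarith
  by_cases h1 : ∃ x ∈ c, 0 < u x
  · obtain ⟨x, hx, hux⟩ := h1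
    exact Or.inl (key u h x hx hux)
  by_cases h2 : ∃ x ∈ c, u x < 0
  · obtain ⟨x, hx, hux⟩ := h2
    refine Or.inr (Or.inl fun y hy => ?_)
    have := key (-u) (fun h' => h (crosses_neg.1 h')) x hx (by simpa using hux) y hy
    simpa using this
  · push Not at h1 h2
    exact Or.inr (Or.inr fun x hx => le_antisymm (h1 x hx) (h2 x hx))

lemma IsCell.zeroPart_nonempty {U c : Set V} (hU : IsOpenConvex U) (hc : IsCell U c) {u : Dual ℝ V}
    (h : Crosses u c) : (ToricRes.zeroPart u c).Nonempty := by
  obtain ⟨⟨x, hx, hux⟩, ⟨y, hy, huy⟩⟩ := h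
  simp only [Set.mem_ofPred_eq, LinearMap.neg_apply] at hux huy
  have hd : 0 < u x - u y := by linarith
  refine ⟨_, (hc.convex hU) hx hy (show 0 ≤ -u y / (u x - u y) from div_nonneg huy.le hd.le)
    (show 0 ≤ u x / (u x - u y) from div_nonneg hux.le hd.le) (by field_simp; ring), ?_⟩
  simp only [Set.mem_ofPred_eq, map_add, map_smul, smul_eq_mul]
  field_simp
  ring

/-- Every direction of `c` is realised, up to scaling, by a displacement from a point with `u > 0`
that is short enough to preserve this inequality. -/
lemma IsCell.vectorSpan_posPart {U c : Set V} (hU : IsOpenConvex U) (hc : IsCell U c)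
    {u : Dual ℝ V} (hne : (ToricRes.posPart u c).Nonempty) :
    vectorSpan ℝ (ToricRes.posPart u c) = vectorSpan ℝ c := by
  refine le_antisymm (vectorSpan_mono ℝ posPart_subset) ?_
  obtain ⟨x, hx, hux⟩ := hne
  refine ToricRes.vectorSpan_le fun a ha b hb => ?_
  have hab := sub_mem_vectorSpan ha hb
  obtain ⟨δ, hδ, H⟩ := exists_forall_pos {u} (x := x) (by simpa using hux) (b - a)
  obtain ⟨δ', hδ', H'⟩ := hc.exists_add_smul_mem hU hx hab
  have h0 : 0 < min δ δ' := lt_min hδ hδ'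
  have h1 : x + min δ δ' • (b - a) ∈ ToricRes.posPart u c :=
    ⟨H' _ h0.le (min_le_right _ _), H _ h0.le (min_le_left _ _) u (by simp)⟩
  have h2 := sub_mem_vectorSpan (c := ToricRes.posPart u c) ⟨hx, hux⟩ h1
  rw [add_sub_cancel_left] at h2
  exact (Submodule.smul_mem_iff _ h0.ne').1 h2

lemma IsCell.vectorSpan_zeroPart {U c : Set V} (hU : IsOpenConvex U) (hc : IsCell U c)
    {u : Dual ℝ V} (hne : (ToricRes.zeroPart u c).Nonempty) :
    vectorSpan ℝ (ToricRes.zeroPart u c) = vectorSpan ℝ c ⊓ LinearMap.ker u := by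
  refine le_antisymm (le_inf (vectorSpan_mono ℝ zeroPart_subset)
    (ToricRes.vectorSpan_le fun x hx y hy => ?_)) ?_
  · rw [LinearMap.mem_ker, map_sub, hx.2, hy.2, sub_zero]
  · rintro v ⟨hv, huv⟩
    obtain ⟨x, hx, hux⟩ := hne
    obtain ⟨δ, hδ, H⟩ := hc.exists_add_smul_mem hU hx hv
    have h1 : x + δ • v ∈ ToricRes.zeroPart u c := by
      refine ⟨H δ hδ.le le_rfl, ?_⟩
      have hux' : u x = 0 := hux
      have huv' : u v = 0 := huv
      simp [hux', huv']
    have h2 := sub_mem_vectorSpan (c := ToricRes.zeroPart u c) ⟨hx, hux⟩ h1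
    rw [add_sub_cancel_left] at h2
    exact (Submodule.smul_mem_iff _ hδ.ne').1 h2

lemma mem_cut_of_crosses {u : Dual ℝ V} {𝒞 : Finset (Set V)} {c : Set V} (hc : c ∈ 𝒞)
    (h : Crosses u c) : posPart u c ∈ cut u 𝒞 ∧ posPart (-u) c ∈ cut u 𝒞 ∧ zeroPart u c ∈ cut u 𝒞 := by
  classical
  unfold cut
  refine ⟨?_, ?_, ?_⟩ <;> refine Finset.mem_biUnion.2 ⟨c, hc, ?_⟩ <;> simp [h]

lemma mem_cut_of_not_crosses {u : Dual ℝ V} {𝒞 : Finset (Set V)} {c : Set V} (hc : c ∈ 𝒞)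
    (h : ¬ Crosses u c) : c ∈ cut u 𝒞 := by
  classical
  unfold cut
  refine Finset.mem_biUnion.2 ⟨c, hc, ?_⟩
  simp [h]

namespace IsDecomp

variable {U : Set V} {𝒞 : Finset (Set V)} (hU : IsOpenConvex U) (h𝒞 : IsDecomp U 𝒞)

include hU h𝒞

/-- This description no longer distinguishes crossed cells from uncrossed ones, since an uncrossed
cell coincides with its only nonempty piece. Disjointness, covering and the frontier condition are
read off from it. -/
lemma mem_cut_iff {u : Dual ℝ V} {c' : Set V} :
    c' ∈ cut u 𝒞 ↔ c'.Nonempty ∧ ∃ c ∈ 𝒞, ∃ s : SignType, c' = c ∩ {x | SignType.sign (u x) = s} := by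
  classical
  have e1 : ∀ c, posPart u c = c ∩ {x | SignType.sign (u x) = 1} := by
    intro c; ext x; simp [posPart, sign_eq_one_iff]
  have e2 : ∀ c, posPart (-u) c = c ∩ {x | SignType.sign (u x) = -1} := by
    intro c; ext x; simp [posPart, sign_eq_neg_one_iff]
  have e3 : ∀ c, zeroPart u c = c ∩ {x | SignType.sign (u x) = 0} := by
    intro c; ext x; simp [zeroPart, sign_eq_zero_iff]
  constructor
  · intro h
    obtain ⟨c, hc, hc'⟩ := Finset.mem_biUnion.1 h
    split_ifs at hc' with hx
    · simp only [Finset.mem_insert, Finset.mem_singleton] at hc'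
      rcases hc' with rfl | rfl | rfl
      · exact ⟨hx.1, c, hc, _, e1 c⟩
      · exact ⟨hx.2, c, hc, _, e2 c⟩
      · exact ⟨(h𝒞.cell c hc).zeroPart_nonempty hU hx, c, hc, _, e3 c⟩
    · rw [Finset.mem_singleton] at hc'
      subst hc'
      refine ⟨(h𝒞.cell _ hc).1, c', hc, ?_⟩
      rcases (h𝒞.cell _ hc).trichotomy hU u hx with h | h | h
      · exact ⟨1, by rw [← e1]; exact (Set.inter_eq_left.2 h).symm⟩
      · exact ⟨-1, by rw [← e2]; exact (Set.inter_eq_left.2 fun x hx => by simpa using h x hx).symm⟩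
      · exact ⟨0, by rw [← e3]; exact (Set.inter_eq_left.2 h).symm⟩
  · rintro ⟨hne, c, hc, s, rfl⟩
    by_cases hx : Crosses u c
    · obtain ⟨h1, h2, h3⟩ := mem_cut_of_crosses hc hx
      rcases s with _ | _ | _
      · have := e3 c; rw [this] at h3; exact h3
      · have := e2 c; rw [this] at h2; exact h2
      · have := e1 c; rw [this] at h1; exact h1
    · obtain ⟨y, hy, hys⟩ := hne
      have : c ∩ {x | SignType.sign (u x) = s} = c := by
        refine Set.inter_eq_left.2 fun x hxc => ?_
        rw [Set.mem_ofPred_eq] at hys ⊢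
        rw [← hys]
        rcases (h𝒞.cell _ hc).trichotomy hU u hx with h | h | h
        · rw [sign_pos (h x hxc), sign_pos (h y hy)]
        · rw [sign_neg (h x hxc), sign_neg (h y hy)]
        · rw [h x hxc, h y hy]
      rw [this]
      exact mem_cut_of_not_crosses hc hx

protected lemma cut (u : Dual ℝ V) : IsDecomp U (cut u 𝒞) where
  cell := by
    classical
    intro c' h
    obtain ⟨c, hc, hc'⟩ := Finset.mem_biUnion.1 h
    split_ifs at hc' with hx
    · simp only [Finset.mem_insert, Finset.mem_singleton] at hc'
      rcases hc' with rfl | rfl | rfl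
      · exact (h𝒞.cell c hc).posPart hx.1
      · exact (h𝒞.cell c hc).posPart hx.2
      · exact (h𝒞.cell c hc).zeroPart ((h𝒞.cell c hc).zeroPart_nonempty hU hx)
    · rw [Finset.mem_singleton] at hc'
      subst hc'
      exact h𝒞.cell _ hc
  disj := by
    intro c1 h1 c2 h2 x hx1 hx2
    obtain ⟨_, d1, hd1, s1, rfl⟩ := (h𝒞.mem_cut_iff hU).1 h1
    obtain ⟨_, d2, hd2, s2, rfl⟩ := (h𝒞.mem_cut_iff hU).1 h2
    rw [h𝒞.disj d1 hd1 d2 hd2 x hx1.1 hx2.1, ← hx1.2, ← hx2.2]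
  cover := by
    intro x hx
    obtain ⟨c, hc, hxc⟩ := h𝒞.cover x hx
    exact ⟨c ∩ {y | SignType.sign (u y) = SignType.sign (u x)},
      (h𝒞.mem_cut_iff hU).2 ⟨⟨x, hxc, rfl⟩, c, hc, _, rfl⟩, hxc, rfl⟩
  frontier := by
    intro c1 h1 c2 h2 x hx y hy hxy a ha b hb t h0 h1'
    obtain ⟨_, d1, hd1, s1, rfl⟩ := (h𝒞.mem_cut_iff hU).1 h1
    obtain ⟨_, d2, hd2, s2, rfl⟩ := (h𝒞.mem_cut_iff hU).1 h2
    have hA := h𝒞.frontier d1 hd1 d2 hd2 x hx.1 y hy.1 fun t h0 h1 => (hxy t h0 h1).1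
    refine ⟨hA a ha.1 b hb.1 t h0 h1', ?_⟩
    -- Along a segment `u` interpolates linearly between its end values, and here its sign is
    -- constant for `0 < t ≤ 1`. This excludes strictly opposite end values, since the interpolation
    -- would have a zero, and also `u y = 0` with `u x ≠ 0`. In the remaining cases the two end
    -- signs determine the sign in between, for `a` and `b` just as for `x` and `y`.
    have hsg : ∀ t : ℝ, 0 < t → t ≤ 1 → SignType.sign ((1 - t) * u x + t * u y) = s2 := by
      intro t h0 h1
      have := (hxy t h0 h1).2
      have e : u (x + t • (y - x)) = (1 - t) * u x + t * u y := by simp; ring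
      rwa [Set.mem_ofPred_eq, e] at this
    have e : u (a + t • (b - a)) = (1 - t) * u a + t * u b := by simp; ring
    rw [Set.mem_ofPred_eq, e]
    have hx2 : SignType.sign (u x) = s1 := hx.2
    have hy2 : SignType.sign (u y) = s2 := hy.2
    have ha2 : SignType.sign (u a) = s1 := ha.2
    have hb2 : SignType.sign (u b) = s2 := hb.2
    have ht1 : 0 ≤ 1 - t := by linarith
    have hmid := hsg (1 / 2) (by norm_num) (by norm_num)
    rcases lt_trichotomy (u x) 0 with hx0 | hx0 | hx0 <;>
      rcases lt_trichotomy (u y) 0 with hy0 | hy0 | hy0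
    · rw [sign_neg hx0] at hx2; rw [sign_neg hy0] at hy2
      rw [← hx2, sign_eq_neg_one_iff] at ha2; rw [← hy2, sign_eq_neg_one_iff] at hb2
      rw [← hy2, sign_neg]
      have := mul_neg_of_pos_of_neg h0 hb2
      have := mul_nonpos_of_nonneg_of_nonpos ht1 ha2.le
      linarith
    · rw [hy0, sign_zero] at hy2
      rw [← hy2, sign_eq_zero_iff] at hmid
      linarith
    · have hd : 0 < u y - u x := by linarith
      have := hsg (-u x / (u y - u x)) (div_pos (by linarith) hd)
        ((div_le_one hd).2 (by linarith))
      rw [← hy2, sign_pos hy0, sign_eq_one_iff] at this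
      have e : (1 - -u x / (u y - u x)) * u x + -u x / (u y - u x) * u y = 0 := by
        field_simp; ring
      linarith
    · rw [hx0, sign_zero] at hx2; rw [sign_neg hy0] at hy2
      rw [← hx2, sign_eq_zero_iff] at ha2; rw [← hy2, sign_eq_neg_one_iff] at hb2
      rw [← hy2, sign_neg]
      have := mul_neg_of_pos_of_neg h0 hb2
      rw [ha2]; linarith
    · rw [hx0, sign_zero] at hx2; rw [hy0, sign_zero] at hy2
      rw [← hx2, sign_eq_zero_iff] at ha2; rw [← hy2, sign_eq_zero_iff] at hb2
      rw [← hy2, ha2, hb2]; simp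
    · rw [hx0, sign_zero] at hx2; rw [sign_pos hy0] at hy2
      rw [← hx2, sign_eq_zero_iff] at ha2; rw [← hy2, sign_eq_one_iff] at hb2
      rw [← hy2, sign_pos]
      have := mul_pos h0 hb2
      rw [ha2]; linarith
    · have hd : 0 < u x - u y := by linarith
      have := hsg (u x / (u x - u y)) (div_pos (by linarith) hd)
        ((div_le_one hd).2 (by linarith))
      rw [← hy2, sign_neg hy0, sign_eq_neg_one_iff] at this
      have e : (1 - u x / (u x - u y)) * u x + u x / (u x - u y) * u y = 0 := by
        field_simp; ring
      linarith
    · rw [hy0, sign_zero] at hy2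
      rw [← hy2, sign_eq_zero_iff] at hmid
      linarith
    · rw [sign_pos hx0] at hx2; rw [sign_pos hy0] at hy2
      rw [← hx2, sign_eq_one_iff] at ha2; rw [← hy2, sign_eq_one_iff] at hb2
      rw [← hy2, sign_pos]
      have := mul_pos h0 hb2
      have := mul_nonneg ht1 ha2.le
      linarith

/-- A decomposition is determined by the relation of lying in a common cell. In this form the effect
of many successive cuts is easy to follow. -/
lemma exists_mem_cut_iff {u : Dual ℝ V} {x y : V} :
    (∃ c ∈ cut u 𝒞, x ∈ c ∧ y ∈ c) ↔
      (∃ c ∈ 𝒞, x ∈ c ∧ y ∈ c) ∧ SignType.sign (u x) = SignType.sign (u y) := by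
  constructor
  · rintro ⟨c', h, hx, hy⟩
    obtain ⟨_, c, hc, s, rfl⟩ := (h𝒞.mem_cut_iff hU).1 h
    exact ⟨⟨c, hc, hx.1, hy.1⟩, hx.2.trans hy.2.symm⟩
  · rintro ⟨⟨c, hc, hx, hy⟩, hs⟩
    exact ⟨c ∩ {z | SignType.sign (u z) = SignType.sign (u x)},
      (h𝒞.mem_cut_iff hU).2 ⟨⟨x, hx, rfl⟩, c, hc, _, rfl⟩, ⟨hx, rfl⟩, hy, hs.symm⟩

end IsDecomp

end Cut

end

end ToricRes

namespace ToricRes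

noncomputable section

/-! ### The diamond property and the vanishing of the squared differential -/

section Diamond

open Module

variable {V : Type*} [AddCommGroup V] [Module ℝ V]

/-- The displaced point is the convex combination, with weight `s * b` on `y`, of `y` and the point
`x + (s / (1 - s * b)) • l` of `c`. -/
lemma Adheres.mem_of_add_mem {c c' : Set V} (h : Adheres c c') {x y l : V} {δ : ℝ} (hδ : 0 < δ)
    (hx : ∀ s : ℝ, 0 ≤ s → s ≤ δ → x + s • l ∈ c) (hy : y ∈ c') {b : ℝ} (hb : 0 < b) :
    ∃ η > (0 : ℝ), ∀ s : ℝ, 0 < s → s ≤ η → x + s • (l + b • (y - x)) ∈ c' := by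
  -- The bound gives `s * b ≤ 1 / 2`, hence `s / (1 - s * b) ≤ 2 * s ≤ δ`.
  refine ⟨min (1 / (2 * b)) (δ / 2), by positivity, fun s h0 h1 => ?_⟩
  have hs1 : s * b ≤ 1 / 2 := by
    have := h1.trans (min_le_left _ _)
    rw [le_div_iff₀ (by positivity)] at this
    linarith
  have hs2 : s ≤ δ / 2 := h1.trans (min_le_right _ _)
  have hw : (0 : ℝ) < 1 - s * b := by linarith
  have h2 : s / (1 - s * b) ≤ δ := by
    rw [div_le_iff₀ hw]; nlinarith
  have h3 := h _ (hx (s / (1 - s * b)) (by positivity) h2) y hy (s * b) (by positivity) (by linarith)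
  convert h3 using 1
  have h4 : s • l = (1 - s * b) • ((s / (1 - s * b)) • l) := by
    rw [smul_smul]; congr 1; field_simp
  rw [smul_add, h4]
  module

lemma Adheres.subset_of_subset {c c' : Set V} (h : Adheres c c') (hc' : c'.Nonempty)
    {W : Submodule ℝ V} (hW : ∀ x ∈ c', x ∈ W) : ∀ x ∈ c, x ∈ W := by
  intro x hx
  obtain ⟨y, hy⟩ := hc'
  have h1 := hW _ (h x hx y hy (1 / 2) (by norm_num) (by norm_num))
  have h2 : x = (2 : ℝ) • (x + (1 / 2 : ℝ) • (y - x)) - y := by module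
  rw [h2]
  exact W.sub_mem (W.smul_mem _ h1) (hW y hy)

lemma IsCell.eq_zero_of_mem_vectorSpan {U c : Set V} (hU : IsOpenConvex U) (hc : IsCell U c)
    {α : Dual ℝ V} (hα : ∀ x ∈ c, 0 ≤ α x) {y : V} (hy : y ∈ c) (hαy : α y = 0) {v : V}
    (hv : v ∈ vectorSpan ℝ c) : α v = 0 := by
  have key : ∀ v ∈ vectorSpan ℝ c, 0 ≤ α v := by
    intro v hv
    obtain ⟨δ, hδ, H⟩ := hc.exists_add_smul_mem hU hy hv
    have := hα _ (H δ hδ.le le_rfl)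
    rw [map_add, hαy, map_smul, smul_eq_mul, zero_add] at this
    exact nonneg_of_mul_nonneg_right this hδ
  have h1 := key v hv
  have h2 := key (-v) (Submodule.neg_mem _ hv)
  rw [map_neg] at h2
  linarith

/-- In `p - x = (p - y) + (y - x)` the second summand is annihilated by the following factor. The
product of the two coefficients thus depends on the middle cell only through the direction `y - x`,
which makes different middle cells comparable. -/
lemma Adheres.ι_mul_ι_mul_volElt [FiniteDimensional ℝ V] {τ ρ κ : Set V}
    (h1 : Adheres τ ρ) (h2 : Adheres ρ κ)
    (c1 : Covers (vectorSpan ℝ τ) (vectorSpan ℝ ρ)) (c2 : Covers (vectorSpan ℝ ρ) (vectorSpan ℝ κ))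
    {x y p : V} (hx : x ∈ τ) (hy : y ∈ ρ) (hp : p ∈ κ) :
    ExteriorAlgebra.ι ℝ (p - x) * (ExteriorAlgebra.ι ℝ (y - x) * volElt (vectorSpan ℝ τ)) =
      (volCoeff (vectorSpan ℝ τ) (vectorSpan ℝ ρ) (y - x) *
        volCoeff (vectorSpan ℝ ρ) (vectorSpan ℝ κ) (p - y)) • volElt (vectorSpan ℝ κ) := by
  have e : p - x = (p - y) + (y - x) := by abel
  rw [e, map_add, add_mul, ι_mul_ι_mul_self, add_zero, volCoeff_spec c1 (h1.sub_mem hx hy),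
    mul_smul_comm, volCoeff_spec c2 (h2.sub_mem hy hp), smul_smul]

namespace IsDecomp

variable {U : Set V} {𝒞 : Finset (Set V)} (hU : IsOpenConvex U) (h𝒞 : IsDecomp U 𝒞)

include hU h𝒞

/-- Uniqueness of a cell between `τ` and `κ` on a given side. -/
lemma eq_of_same_side {τ ρ ρ' κ : Set V} (hτ : τ ∈ 𝒞) (hρ : ρ ∈ 𝒞) (hρ' : ρ' ∈ 𝒞) (hκ : κ ∈ 𝒞)
    (h1 : Adheres τ ρ) (h2 : Adheres ρ κ) (h1' : Adheres τ ρ') (h2' : Adheres ρ' κ)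
    (hne : ρ ≠ κ) (hne' : ρ' ≠ κ) {x y y' p l : V} (hx : x ∈ τ) (hy : y ∈ ρ) (hy' : y' ∈ ρ')
    (hp : p ∈ κ) (hl : l ∈ vectorSpan ℝ τ) {a b : ℝ} (hb : 0 < b)
    (e : y' - x = l + a • (p - x) + b • (y - x)) : ρ = ρ' := by
  -- Modulo directions of `τ`, `y' - x` equals `a • (p - x) + b • (y - x)`. If `a = 0`, short
  -- displacements lie in both `ρ` and `ρ'`; if `a > 0`, they lie in both `ρ'` and `κ`, which is
  -- excluded. For `a < 0`, solving for `y - x` exchanges the two cells and makes the coefficient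
  -- positive.
  have key : ∀ ρ ρ' : Set V, ρ ∈ 𝒞 → ρ' ∈ 𝒞 → Adheres τ ρ → Adheres ρ κ → Adheres τ ρ' → ρ' ≠ κ →
      ∀ y y' l : V, y ∈ ρ → y' ∈ ρ' → l ∈ vectorSpan ℝ τ → ∀ a b : ℝ, 0 ≤ a → 0 < b →
      y' - x = l + a • (p - x) + b • (y - x) → ρ = ρ' := by
    intro ρ ρ' hρ hρ' h1 h2 h1' hne' y y' l hy hy' hl a b ha hb e
    obtain ⟨δ, hδ, H⟩ := (h𝒞.cell τ hτ).exists_add_smul_mem hU hx hl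
    obtain ⟨η, hη, H1⟩ := h1.mem_of_add_mem hδ H hy hb
    rcases ha.eq_or_lt with rfl | ha
    · rw [zero_smul, add_zero] at e
      have hm : 0 < min η 1 := lt_min hη one_pos
      refine h𝒞.disj ρ hρ ρ' hρ' _ (H1 (min η 1) hm (min_le_left _ _)) ?_
      rw [← e]
      exact h1' x hx y' hy' _ hm (min_le_right _ _)
    · exfalso
      obtain ⟨ζ, hζ, H2⟩ : ∃ ζ > (0 : ℝ), ∀ s : ℝ, 0 < s → s ≤ ζ →
          x + s • ((l + b • (y - x)) + a • (p - x)) ∈ κ := by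
        refine ⟨min (1 / (2 * a)) (η / 2), by positivity, fun s h0 h1 => ?_⟩
        have hs1 : s * a ≤ 1 / 2 := by
          have := h1.trans (min_le_left _ _)
          rw [le_div_iff₀ (by positivity)] at this
          linarith
        have hs2 : s ≤ η / 2 := h1.trans (min_le_right _ _)
        have hw : (0 : ℝ) < 1 - s * a := by linarith
        have h2'' : s / (1 - s * a) ≤ η := by
          rw [div_le_iff₀ hw]; nlinarith
        have h3 := h2 _ (H1 (s / (1 - s * a)) (by positivity) h2'') p hp (s * a) (by positivity)
          (by linarith)
        convert h3 using 1
        have h4 : s • (l + b • (y - x)) = (1 - s * a) • ((s / (1 - s * a)) • (l + b • (y - x))) := by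
          rw [smul_smul]; congr 1; field_simp
        rw [smul_add, h4]
        module
      have hm : 0 < min ζ 1 := lt_min hζ one_pos
      refine hne' (h𝒞.disj ρ' hρ' κ hκ _ ?_ (H2 (min ζ 1) hm (min_le_left _ _)))
      have e' : l + b • (y - x) + a • (p - x) = y' - x := by rw [e]; abel
      rw [e']
      exact h1' x hx y' hy' _ hm (min_le_right _ _)
  rcases le_or_gt 0 a with ha | ha
  · exact key ρ ρ' hρ hρ' h1 h2 h1' hne' y y' l hy hy' hl a b ha hb e
  · refine (key ρ' ρ hρ' hρ h1' h2' h1 hne y' y (-(b⁻¹ • l)) hy' hy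
      (Submodule.neg_mem _ (Submodule.smul_mem _ _ hl)) (-(b⁻¹ * a)) b⁻¹ ?_ (by positivity) ?_).symm
    · have : 0 < b⁻¹ := by positivity
      nlinarith
    · rw [e, smul_add, smul_add, smul_smul, smul_smul, inv_mul_cancel₀ hb.ne']
      module

variable [FiniteDimensional ℝ V]

/-- On the other side of `ρ₀` there is another cell between `τ` and `κ`. -/
lemma exists_other_side {τ ρ₀ κ : Set V} (hτ : τ ∈ 𝒞) (hρ₀ : ρ₀ ∈ 𝒞) (hκ : κ ∈ 𝒞)
    (h1 : Adheres τ ρ₀) (h2 : Adheres ρ₀ κ)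
    (c1 : Covers (vectorSpan ℝ τ) (vectorSpan ℝ ρ₀)) (c2 : Covers (vectorSpan ℝ ρ₀) (vectorSpan ℝ κ))
    {x y₀ p : V} (hx : x ∈ τ) (hy₀ : y₀ ∈ ρ₀) (hp : p ∈ κ) :
    ∃ ρ ∈ 𝒞, ∃ y ∈ ρ, ∃ δ > (0 : ℝ), ∃ c : ℝ, y - x = δ • (-(y₀ - x) + c • (p - x)) ∧
      Adheres τ ρ ∧ Adheres ρ κ ∧ Covers (vectorSpan ℝ τ) (vectorSpan ℝ ρ) ∧
      Covers (vectorSpan ℝ ρ) (vectorSpan ℝ κ) := by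
  classical
  have hcτ := h𝒞.cell τ hτ
  have hcκ := h𝒞.cell κ hκ
  obtain ⟨hκne, W, A, hκA⟩ := hcκ
  have hκW : ∀ z ∈ κ, z ∈ W := by rw [hκA]; exact fun z hz => hz.2.1
  have hκα : ∀ α ∈ A, ∀ z ∈ κ, 0 < α z := by rw [hκA]; exact fun α hα z hz => hz.2.2 α hα
  have hsub := h2.sub_mem hy₀ hp
  have hQ : y₀ - x ∈ vectorSpan ℝ ρ₀ := h1.sub_mem hx hy₀
  have hQτ : y₀ - x ∉ vectorSpan ℝ τ := h𝒞.sub_notMem hU hτ hρ₀ h1 c1 hx hy₀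
  have hPρ : p - x ∉ vectorSpan ℝ ρ₀ := by
    intro h
    refine h𝒞.sub_notMem hU hρ₀ hκ h2 c2 hy₀ hp ?_
    have := Submodule.sub_mem _ h hQ
    rwa [sub_sub_sub_cancel_right] at this
  have hPκ : p - x ∈ vectorSpan ℝ κ := by
    have := Submodule.add_mem _ hsub (c2.1 hQ)
    rwa [sub_add_sub_cancel] at this
  have hy₀W := h2.subset_of_subset hκne hκW y₀ hy₀
  have hρ₀W := h2.subset_of_subset hκne hκW
  have hxW : x ∈ W := h1.subset_of_subset ⟨y₀, hy₀⟩ hρ₀W x hx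
  have hτα : ∀ α ∈ A, 0 ≤ α x := by
    intro α hα
    have h3 := h2.nonneg hκne (hκα α hα)
    by_contra! hneg
    have h4 := h3 _ (h1 x hx y₀ hy₀ 1 one_pos le_rfl)
    obtain ⟨δ, hδ, H⟩ := exists_forall_pos {-α} (x := x) (by simpa using hneg) (y₀ - x)
    have h5 := h3 _ (h1 x hx y₀ hy₀ _ (lt_min hδ one_pos) (min_le_right _ _))
    have h6 := H _ (le_min hδ.le zero_le_one) (min_le_left _ _) (-α) (by simp)
    rw [LinearMap.neg_apply] at h6
    linarith
  have hxU := hcτ.subset hx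
  have hτκ : τ ≠ κ := by
    rintro rfl
    have := c1.2; have := c2.2; omega
  have hxκ : x ∉ κ := fun h => hτκ (h𝒞.disj τ hτ κ hκ x hx h)
  have hZne : (A.filter fun α => α x = 0).Nonempty := by
    by_contra hne
    rw [Finset.not_nonempty_iff_eq_empty, Finset.filter_eq_empty_iff] at hne
    apply hxκ
    rw [hκA]
    exact ⟨hxU, hxW, fun α hα => lt_of_le_of_ne (hτα α hα) (Ne.symm (hne hα))⟩
  -- Only the inequalities of `κ` that vanish at `x` matter near `x`. The direction `-(y₀ - x) + c •
  -- (p - x)` satisfies them weakly exactly when `c` is at least each of these ratios, so the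
  -- largest ratio gives the extreme direction, on which `α₀` vanishes.
  obtain ⟨α₀, hα₀, hmax⟩ := Finset.exists_max_image _ (fun α : Dual ℝ V => α (y₀ - x) / α (p - x)) hZne
  have hZP : ∀ α ∈ A.filter (fun α => α x = 0), 0 < α (p - x) := by
    intro α hα
    rw [Finset.mem_filter] at hα
    rw [map_sub, hα.2, sub_zero]
    exact hκα α hα.1 p hp
  set c := α₀ (y₀ - x) / α₀ (p - x) with hc
  set r := -(y₀ - x) + c • (p - x) with hr
  have hα₀r : α₀ r = 0 := by
    have := (hZP α₀ hα₀).ne'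
    rw [hr, map_add, map_neg, map_smul, smul_eq_mul, hc]
    field_simp
    ring
  have hαr : ∀ α ∈ A.filter (fun α => α x = 0), 0 ≤ α r := by
    intro α hα
    have h3 := hmax α hα
    rw [div_le_iff₀ (hZP α hα)] at h3
    rw [hr, map_add, map_neg, map_smul, smul_eq_mul]
    linarith
  have hrW : r ∈ W := W.add_mem (W.neg_mem (W.sub_mem hy₀W hxW))
    (W.smul_mem _ (W.sub_mem (hκW p hp) hxW))
  -- The other middle cell is the one into which the ray from `x` in the extreme direction starts.
  obtain ⟨ρ, hρ, δ₁, hδ₁, H1⟩ := h𝒞.germ hU hxU r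
  obtain ⟨δ₂, hδ₂, H2⟩ := exists_forall_pos (A.filter fun α => ¬ α x = 0) (x := x) (fun α hα => by
    rw [Finset.mem_filter] at hα
    exact lt_of_le_of_ne (hτα α hα.1) (Ne.symm hα.2)) r
  have hδ : 0 < min δ₁ δ₂ := lt_min hδ₁ hδ₂
  set δ := min δ₁ δ₂ with hδdef
  have hy : x + δ • r ∈ ρ := H1 δ hδ (min_le_left _ _)
  have hyx : x + δ • r - x = δ • r := add_sub_cancel_left _ _
  have hτρ : Adheres τ ρ := by
    refine h𝒞.frontier τ hτ ρ hρ x hx _ hy fun t h0 h1 => ?_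
    rw [hyx, smul_smul]
    exact H1 _ (mul_pos h0 hδ) ((mul_le_of_le_one_left hδ.le h1).trans (min_le_left _ _))
  have hcρ := h𝒞.cell ρ hρ
  have hρκ : Adheres ρ κ := by
    refine h𝒞.frontier ρ hρ κ hκ _ hy p hp fun t h0 h1 => ?_
    have hyW : x + δ • r ∈ W := W.add_mem hxW (W.smul_mem _ hrW)
    have hpU : p ∈ U := (h𝒞.cell κ hκ).subset hp
    rw [hκA]
    refine ⟨hU.convex.add_smul_sub_mem (hcρ.subset hy) hpU ⟨h0.le, h1⟩,
      W.add_mem hyW (W.smul_mem _ (W.sub_mem (hκW p hp) hyW)), fun α hα => ?_⟩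
    have h3 : 0 ≤ α (x + δ • r) := by
      by_cases h4 : α x = 0
      · rw [map_add, h4, map_smul, smul_eq_mul, zero_add]
        exact mul_nonneg hδ.le (hαr α (Finset.mem_filter.2 ⟨hα, h4⟩))
      · exact (H2 δ hδ.le (min_le_right _ _) α (Finset.mem_filter.2 ⟨hα, h4⟩)).le
    have h5 := hκα α hα p hp
    have e : α (x + δ • r + t • (p - (x + δ • r))) = (1 - t) * α (x + δ • r) + t * α p := by
      simp; ring
    rw [e]
    have := mul_pos h0 h5
    have := mul_nonneg (show 0 ≤ 1 - t by linarith) h3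
    linarith
  have hrρ : r ∈ vectorSpan ℝ ρ := by
    have := hτρ.sub_mem hx hy
    rw [hyx] at this
    exact (Submodule.smul_mem_iff _ hδ.ne').1 this
  have hrτ : r ∉ vectorSpan ℝ τ := by
    intro h
    have h3 : c • (p - x) ∈ vectorSpan ℝ ρ₀ := by
      have := Submodule.add_mem _ (c1.1 h) hQ
      rw [hr] at this
      convert this using 1
      abel
    have h4 : c = 0 := by
      by_contra h5
      exact hPρ ((Submodule.smul_mem_iff _ h5).1 h3)
    rw [hr, h4, zero_smul, add_zero] at h
    exact hQτ (neg_neg (y₀ - x) ▸ Submodule.neg_mem _ h)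
  -- Since `α₀` is nonnegative on `ρ` and zero at one of its points, it kills all directions of `ρ`.
  -- As `α₀ (p - x) > 0`, only directions of `τ` and multiples of `r` are left, so `τ` has
  -- codimension one in `ρ`.
  have hα₀ρ : ∀ v ∈ vectorSpan ℝ ρ, α₀ v = 0 := by
    intro v hv
    rw [Finset.mem_filter] at hα₀
    refine hcρ.eq_zero_of_mem_vectorSpan hU (hρκ.nonneg hκne (hκα α₀ hα₀.1)) hy ?_ hv
    rw [map_add, hα₀.2, map_smul, hα₀r, smul_zero, add_zero]
  have hcov : Covers (vectorSpan ℝ τ) (vectorSpan ℝ ρ) := by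
    refine covers_of_forall (hτρ.vectorSpan_le ⟨_, hy⟩) hrρ hrτ fun v hv => ?_
    obtain ⟨l', hl', a, rfl⟩ := c2.exists_eq_add_smul hPκ hPρ (hρκ.vectorSpan_le hκne hv)
    obtain ⟨l, hl, b, rfl⟩ := c1.exists_eq_add_smul hQ hQτ hl'
    refine ⟨-b, ?_⟩
    have e : l + b • (y₀ - x) + a • (p - x) = l + (a + b * c) • (p - x) + (-b) • r := by
      rw [hr]; module
    have h3 := hα₀ρ _ hv
    rw [e, map_add, map_add, map_smul, map_smul, hα₀r,
      hα₀ρ l (hτρ.vectorSpan_le ⟨_, hy⟩ hl), zero_add, smul_zero, add_zero, smul_eq_mul] at h3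
    have h4 : a + b * c = 0 := (mul_eq_zero.1 h3).resolve_right (hZP α₀ hα₀).ne'
    rw [e, h4, zero_smul, add_zero, add_sub_cancel_right]
    exact hl
  refine ⟨ρ, hρ, _, hy, δ, hδ, c, hyx, hτρ, hρκ, hcov, hρκ.vectorSpan_le hκne, ?_⟩
  have := hcov.2; have := c1.2; have := c2.2; omega

/-- If one middle cell `ρ₀` contributes, there is a second one on the other side, reached from `x`
by a negative multiple of `y₀ - x` plus a multiple of `p - x`. Wedging with `p - x` removes the last
term, so the two products of signs are opposite. Every further contributing cell would lie on the
side of one of these two and hence coincide with it. -/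
lemma sum_incid_mul_incid {τ κ : Set V} (hτ : τ ∈ 𝒞) (hκ : κ ∈ 𝒞) :
    ∑ ρ ∈ 𝒞, incid τ ρ * incid ρ κ = 0 := by
  classical
  by_cases hall : ∀ ρ ∈ 𝒞, incid τ ρ * incid ρ κ = 0
  · exact Finset.sum_eq_zero hall
  push Not at hall
  obtain ⟨ρ₀, hρ₀, hne⟩ := hall
  obtain ⟨h1, c1⟩ := adheres_of_incid_ne_zero (left_ne_zero_of_mul hne)
  obtain ⟨h2, c2⟩ := adheres_of_incid_ne_zero (right_ne_zero_of_mul hne)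
  obtain ⟨x, hx⟩ := (h𝒞.cell τ hτ).1
  obtain ⟨y₀, hy₀⟩ := (h𝒞.cell ρ₀ hρ₀).1
  obtain ⟨p, hp⟩ := (h𝒞.cell κ hκ).1
  obtain ⟨ρ, hρ, y, hy, δ, hδ, c, e, h1', h2', c1', c2'⟩ :=
    h𝒞.exists_other_side hU hτ hρ₀ hκ h1 h2 c1 c2 hx hy₀ hp
  have hnek : ∀ ρ : Set V, Covers (vectorSpan ℝ ρ) (vectorSpan ℝ κ) → ρ ≠ κ := by
    rintro ρ hc rfl
    have := hc.2; omega
  have hprod : incid τ ρ * incid ρ κ = -(incid τ ρ₀ * incid ρ₀ κ) := by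
    have e1 := h1.ι_mul_ι_mul_volElt h2 c1 c2 hx hy₀ hp
    have e2 := h1'.ι_mul_ι_mul_volElt h2' c1' c2' hx hy hp
    have e3 : ExteriorAlgebra.ι ℝ (p - x) * (ExteriorAlgebra.ι ℝ (y - x) * volElt (vectorSpan ℝ τ)) =
        (-δ) • (ExteriorAlgebra.ι ℝ (p - x) *
          (ExteriorAlgebra.ι ℝ (y₀ - x) * volElt (vectorSpan ℝ τ))) := by
      rw [e, map_smul, map_add, map_neg, map_smul, smul_mul_assoc, add_mul, mul_smul_comm, mul_add,
        smul_mul_assoc, mul_smul_comm, ι_mul_ι_mul_self, smul_zero, add_zero, neg_mul, mul_neg,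
        smul_neg, neg_smul]
    rw [e1, e2, smul_smul] at e3
    have e4 := smul_left_injective ℝ (volElt_ne_zero (vectorSpan ℝ κ)) e3
    rw [h𝒞.incid_eq hU hτ hρ h1' c1' hx hy, h𝒞.incid_eq hU hρ hκ h2' c2' hy hp,
      h𝒞.incid_eq hU hτ hρ₀ h1 c1 hx hy₀, h𝒞.incid_eq hU hρ₀ hκ h2 c2 hy₀ hp,
      ← SignType.coe_mul, ← SignType.coe_mul, ← sign_mul, ← sign_mul, e4, sign_mul, sign_neg (by linarith)]
    simp
  have hne' : ρ ≠ ρ₀ := by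
    rintro rfl
    have : incid τ ρ * incid ρ κ = 0 := by omega
    exact hne this
  rw [Finset.sum_eq_add ρ ρ₀ hne' ?_ (fun h => absurd hρ h) (fun h => absurd hρ₀ h), hprod]
  · ring
  · rintro σ hσ ⟨hσρ, hσρ₀⟩
    by_contra hσne
    obtain ⟨g1, d1⟩ := adheres_of_incid_ne_zero (left_ne_zero_of_mul hσne)
    obtain ⟨g2, d2⟩ := adheres_of_incid_ne_zero (right_ne_zero_of_mul hσne)
    obtain ⟨z, hz⟩ := (h𝒞.cell σ hσ).1
    have hQ : y₀ - x ∈ vectorSpan ℝ ρ₀ := h1.sub_mem hx hy₀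
    have hPρ : p - x ∉ vectorSpan ℝ ρ₀ := by
      intro h
      refine h𝒞.sub_notMem hU hρ₀ hκ h2 c2 hy₀ hp ?_
      have := Submodule.sub_mem _ h hQ
      rwa [sub_sub_sub_cancel_right] at this
    have hPκ : p - x ∈ vectorSpan ℝ κ := by
      have := Submodule.add_mem _ (h2.sub_mem hy₀ hp) (c2.1 hQ)
      rwa [sub_add_sub_cancel] at this
    have hzσ := g1.sub_mem hx hz
    obtain ⟨l', hl', a, e'⟩ := c2.exists_eq_add_smul hPκ hPρ (g2.vectorSpan_le ⟨p, hp⟩ hzσ)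
    obtain ⟨l, hl, b, rfl⟩ := c1.exists_eq_add_smul hQ
      (h𝒞.sub_notMem hU hτ hρ₀ h1 c1 hx hy₀) hl'
    -- The sign of the coefficient `b` of `y₀ - x` tells the side. For `b = 0` the direction `p - x`
    -- would belong to the span of `σ`, although `σ` is a proper facet of `κ`.
    rcases lt_trichotomy b 0 with hb | rfl | hb
    · refine hσρ (h𝒞.eq_of_same_side hU hτ hρ hσ hκ h1' h2' g1 g2 (hnek _ c2') (hnek _ d2) hx hy hz
        hp hl (a := a + b * c) (b := -(b / δ)) (by rw [neg_pos]; exact div_neg_of_neg_of_pos hb hδ)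
        ?_).symm
      rw [e', e, smul_smul, neg_mul, div_mul_cancel₀ _ hδ.ne']
      module
    · rw [zero_smul, add_zero] at e'
      have ha : a ≠ 0 := by
        rintro rfl
        rw [zero_smul, add_zero] at e'
        exact h𝒞.sub_notMem hU hτ hσ g1 d1 hx hz (e' ▸ hl)
      have hP : p - x ∈ vectorSpan ℝ σ := by
        have : a • (p - x) ∈ vectorSpan ℝ σ := by
          have := Submodule.sub_mem _ hzσ (d1.1 hl)
          rwa [e', add_sub_cancel_left] at this
        exact (Submodule.smul_mem_iff _ ha).1 this
      refine h𝒞.sub_notMem hU hσ hκ g2 d2 hz hp ?_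
      have := Submodule.sub_mem _ hP hzσ
      rwa [sub_sub_sub_cancel_right] at this
    · refine hσρ₀ (h𝒞.eq_of_same_side hU hτ hρ₀ hσ hκ h1 h2 g1 g2 (hnek _ c2) (hnek _ d2) hx hy₀ hz
        hp hl (a := a) hb ?_).symm
      rw [e']
      abel

end IsDecomp

end Diamond

end

end ToricRes

namespace ToricRes

noncomputable section

/-! ### The cellular complex and its invariance under cutting -/

section CellComplex

open Module

variable {V : Type*} [AddCommGroup V] [Module ℝ V]

variable [FiniteDimensional ℝ V]

section Incidence

namespace IsDecomp

variable {U : Set V} {𝒞 : Finset (Set V)} (hU : IsOpenConvex U) (h𝒞 : IsDecomp U 𝒞)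

include hU h𝒞

omit [FiniteDimensional ℝ V] hU in
lemma adheres_of_subset {c c' d d' : Set V} (hc : c ∈ 𝒞) (hc' : c' ∈ 𝒞) (hd : d ⊆ c) (hd' : d' ⊆ c')
    (hne : d.Nonempty) (hne' : d'.Nonempty) (h : Adheres d d') : Adheres c c' := by
  obtain ⟨x, hx⟩ := hne
  obtain ⟨y, hy⟩ := hne'
  exact h𝒞.frontier c hc c' hc' x (hd hx) y (hd' hy) fun t h0 h1 => hd' (h x hx y hy t h0 h1)

/-- Incidence numbers may be computed from any points of the two cells, in particular from points of
smaller cells with the same spans. -/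
lemma incid_eq_of_subset {𝒟 : Finset (Set V)} (h𝒟 : IsDecomp U 𝒟) {c c' d d' : Set V} (hc : c ∈ 𝒞)
    (hc' : c' ∈ 𝒞) (hdm : d ∈ 𝒟) (hdm' : d' ∈ 𝒟) (hd : d ⊆ c) (hd' : d' ⊆ c')
    (hs : vectorSpan ℝ d = vectorSpan ℝ c) (hs' : vectorSpan ℝ d' = vectorSpan ℝ c')
    (hA : Adheres c c' → Adheres d d') : incid d d' = incid c c' := by
  obtain ⟨x, hx⟩ := (h𝒟.cell d hdm).1
  obtain ⟨y, hy⟩ := (h𝒟.cell d' hdm').1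
  by_cases h : Adheres c c' ∧ Covers (vectorSpan ℝ c) (vectorSpan ℝ c')
  · rw [h𝒞.incid_eq hU hc hc' h.1 h.2 (hd hx) (hd' hy),
      h𝒟.incid_eq hU hdm hdm' (hA h.1) (by rw [hs, hs']; exact h.2) hx hy, hs, hs']
  · rw [incid_eq_zero fun h1 h2 => h ⟨h1, h2⟩, incid_eq_zero fun h1 h2 => h ⟨?_, ?_⟩]
    · exact h𝒞.adheres_of_subset hc hc' hd hd' ⟨x, hx⟩ ⟨y, hy⟩ h1
    · rwa [← hs, ← hs']

omit hU in
lemma incid_eq_zero_of_crosses {u : Dual ℝ V} {c c' d d' : Set V} (hc : c ∈ 𝒞) (hc' : c' ∈ 𝒞)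
    (hd : d ⊆ c) (hd' : d' ⊆ c') (hne : d.Nonempty) (hne' : d'.Nonempty) (hx : Crosses u c)
    (hx' : ¬ Crosses u c') : incid d d' = 0 :=
  incid_eq_zero fun h1 _ => hx' <|
    (h𝒞.adheres_of_subset hc hc' hd hd' hne hne' h1).crosses (h𝒞.cell c' hc').1 hx

variable {u : Dual ℝ V}

lemma incid_posPart_posPart {c c' : Set V} (hc : c ∈ 𝒞) (hc' : c' ∈ 𝒞)
    (hx : Crosses u c) (hx' : Crosses u c') :
    incid (posPart u c) (posPart u c') = incid c c' :=
  h𝒞.incid_eq_of_subset hU (h𝒞.cut hU u) hc hc' (mem_cut_of_crosses hc hx).1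
    (mem_cut_of_crosses hc' hx').1 posPart_subset posPart_subset
    ((h𝒞.cell c hc).vectorSpan_posPart hU hx.1) ((h𝒞.cell c' hc').vectorSpan_posPart hU hx'.1)
    fun h => Adheres.posPart (fun x hx y hy => h x hx.1 y hy) fun _ hx => le_of_lt hx.2

omit [FiniteDimensional ℝ V] hU h𝒞 in
lemma not_adheres_posPart_neg {c c' : Set V} (hne : (posPart (-u) c').Nonempty) {x : V} (hx : x ∈ c)
    (hux : 0 < u x) : ¬ Adheres c (posPart (-u) c') := by
  intro h
  have := h.nonneg (u := -u) hne (fun y hy => hy.2) x hx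
  rw [LinearMap.neg_apply] at this
  linarith

omit hU h𝒞 in
lemma incid_posPart_neg {c c' : Set V}
    (hx : Crosses u c) (hx' : Crosses u c') :
    incid (posPart u c) (posPart (-u) c') = 0 := by
  obtain ⟨x, hx⟩ := hx.1
  exact incid_eq_zero fun h _ => not_adheres_posPart_neg hx'.2 hx hx.2 h

/-- If the zero part of `c` were a facet of the positive half of `c'`, one direction of `c`
transverse to `u = 0` would complete its span to that of `c'`. Then the spans of `c` and `c'` agree,
and adherence forces `c = c'`. -/
lemma incid_zeroPart_posPart_of_ne {c c' : Set V} (hc : c ∈ 𝒞) (hc' : c' ∈ 𝒞)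
    (hx : Crosses u c) (hx' : Crosses u c') (hne : c ≠ c') :
    incid (zeroPart u c) (posPart u c') = 0 := by
  refine incid_eq_zero fun h hcov => hne ?_
  have h0 := (h𝒞.cell c hc).zeroPart_nonempty hU hx
  have hA := h𝒞.adheres_of_subset hc hc' zeroPart_subset posPart_subset h0 hx'.1 h
  obtain ⟨x, hxp⟩ := hx.1
  obtain ⟨z, hz⟩ := h0
  obtain ⟨y, hy⟩ := (h𝒞.cell c' hc').1
  refine h𝒞.eq_of_sub_mem hU hc hc' hA hz.1 hy ?_
  have hle := hA.vectorSpan_le ⟨y, hy⟩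
  have h2 := (h𝒞.cell c' hc').vectorSpan_posPart hU hx'.1
  have h3 := (h𝒞.cell c hc).vectorSpan_zeroPart hU (u := u) ⟨z, hz⟩
  rw [h2] at hcov
  have hzx : x - z ∈ vectorSpan ℝ c := sub_mem_vectorSpan hz.1 hxp.1
  have hnot : x - z ∉ vectorSpan ℝ (zeroPart u c) := by
    rw [h3]
    rintro ⟨_, h4⟩
    have h5 : 0 < u x := hxp.2
    have h6 : u z = 0 := hz.2
    have h7 : u (x - z) = 0 := h4
    rw [map_sub, h6] at h7
    linarith
  obtain ⟨l, hl, t, e⟩ := hcov.exists_eq_add_smul (hle hzx) hnot (hA.sub_mem hz.1 hy)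
  rw [e]
  exact Submodule.add_mem _ (vectorSpan_mono ℝ zeroPart_subset hl) (Submodule.smul_mem _ _ hzx)

omit [FiniteDimensional ℝ V] in
lemma adheres_zeroPart_posPart {c : Set V} (hc : c ∈ 𝒞) : Adheres (zeroPart u c) (posPart u c) :=
  Adheres.posPart (fun _ hx _ hy _ h0 h1 => ((h𝒞.cell c hc).convex hU).add_smul_sub_mem hx.1 hy
    ⟨h0.le, h1⟩) fun _ hx => le_of_eq (Eq.symm hx.2)

lemma covers_zeroPart {c : Set V} (hc : c ∈ 𝒞) (hx : Crosses u c) :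
    Covers (vectorSpan ℝ (zeroPart u c)) (vectorSpan ℝ c) := by
  obtain ⟨z, hz⟩ := (h𝒞.cell c hc).zeroPart_nonempty hU hx
  obtain ⟨x, hxp⟩ := hx.1
  have hs := (h𝒞.cell c hc).vectorSpan_zeroPart hU (u := u) ⟨z, hz⟩
  have h5 : 0 < u x := hxp.2
  have h6 : u z = 0 := hz.2
  have h7 : u (x - z) = u x := by rw [map_sub, h6, sub_zero]
  refine covers_of_forall (vectorSpan_mono ℝ zeroPart_subset) (sub_mem_vectorSpan hz.1 hxp.1)
    (fun h => ?_) fun v hv => ⟨u v / u x, ?_⟩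
  · rw [hs] at h
    have h8 : u (x - z) = 0 := h.2
    rw [h7] at h8
    linarith
  · rw [hs]
    refine ⟨Submodule.sub_mem _ hv (Submodule.smul_mem _ _ (sub_mem_vectorSpan hz.1 hxp.1)), ?_⟩
    change u (v - (u v / u x) • (x - z)) = 0
    rw [map_sub, map_smul, h7, smul_eq_mul, div_mul_cancel₀ _ h5.ne', sub_self]

lemma incid_zeroPart_mul_self {c : Set V} (hc : c ∈ 𝒞) (hx : Crosses u c) :
    incid (zeroPart u c) (posPart u c) * incid (zeroPart u c) (posPart u c) = 1 :=
  (h𝒞.cut hU u).incid_mul_self hU (mem_cut_of_crosses hc hx).2.2 (mem_cut_of_crosses hc hx).1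
    (h𝒞.adheres_zeroPart_posPart hU hc) (by
      rw [(h𝒞.cell c hc).vectorSpan_posPart hU hx.1]; exact h𝒞.covers_zeroPart hU hc hx)

/-- From a point of the zero part, opposite vectors lead into the two halves. -/
lemma incid_zeroPart_add {c : Set V} (hc : c ∈ 𝒞) (hx : Crosses u c) :
    incid (zeroPart u c) (posPart u c) + incid (zeroPart u c) (posPart (-u) c) = 0 := by
  obtain ⟨z, hz⟩ := (h𝒞.cell c hc).zeroPart_nonempty hU hx
  obtain ⟨x, hxp⟩ := hx.1
  have hm := mem_cut_of_crosses hc hx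
  have hA := h𝒞.adheres_zeroPart_posPart hU (u := u) hc
  have hA' := h𝒞.adheres_zeroPart_posPart hU (u := -u) hc
  rw [zeroPart_neg] at hA'
  have hcov := h𝒞.covers_zeroPart hU hc hx
  have hs := (h𝒞.cell c hc).vectorSpan_posPart hU hx.1
  have hs' := (h𝒞.cell c hc).vectorSpan_posPart hU hx.2
  have hzx := sub_mem_vectorSpan hxp.1 hz.1
  obtain ⟨δ, hδ, H⟩ := (h𝒞.cell c hc).exists_add_smul_mem hU hz.1 hzx
  have h5 : 0 < u x := hxp.2
  have h6 : u z = 0 := hz.2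
  have hy : z + δ • (z - x) ∈ posPart (-u) c := by
    refine ⟨H δ hδ.le le_rfl, ?_⟩
    simp only [Set.mem_ofPred_eq, LinearMap.neg_apply, map_add, map_smul, map_sub, h6, smul_eq_mul]
    nlinarith
  have hzx' := sub_mem_vectorSpan hz.1 hxp.1
  rw [(h𝒞.cut hU u).incid_eq hU hm.2.2 hm.1 hA (by rw [hs]; exact hcov) hz hxp,
    (h𝒞.cut hU u).incid_eq hU hm.2.2 hm.2.1 hA' (by rw [hs']; exact hcov) hz hy, hs, hs']
  have e : z + δ • (z - x) - z = (-δ) • (x - z) := by module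
  rw [e, volCoeff_smul hcov hzx', sign_mul, sign_neg (a := -δ) (by linarith)]
  simp

/-- If `c` lay in `u = 0` as a facet of `c'`, every point of `c'` with `u = 0` would differ from a
point of `c` by a direction of `c`. A crossed cell has such points, against the disjointness of
cells. -/
lemma not_covers_of_zero {c c' : Set V} (hc : c ∈ 𝒞) (hc' : c' ∈ 𝒞) (h0 : ∀ x ∈ c, u x = 0)
    (hx' : Crosses u c') (hA : Adheres c c') : ¬ Covers (vectorSpan ℝ c) (vectorSpan ℝ c') := by
  intro hcov
  obtain ⟨z, hz⟩ := (h𝒞.cell c' hc').zeroPart_nonempty hU hx'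
  obtain ⟨y, hy⟩ := hx'.1
  obtain ⟨x, hx⟩ := (h𝒞.cell c hc).1
  have hyx := h𝒞.sub_notMem hU hc hc' hA hcov hx hy.1
  obtain ⟨l, hl, t, e⟩ := hcov.exists_eq_add_smul (hA.sub_mem hx hy.1) hyx (hA.sub_mem hx hz.1)
  have hul : u l = 0 := by
    have : vectorSpan ℝ c ≤ LinearMap.ker u := vectorSpan_le fun a ha b hb => by
      rw [LinearMap.mem_ker, map_sub, h0 a ha, h0 b hb, sub_zero]
    exact this hl
  have h5 : 0 < u y := hy.2
  have h6 : u z = 0 := hz.2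
  have ht := congrArg u e
  rw [map_sub, map_add, map_smul, map_sub, h0 x hx, h6, hul, smul_eq_mul] at ht
  have ht0 : t = 0 := by
    have : t * u y = 0 := by linarith
    exact (mul_eq_zero.1 this).resolve_right h5.ne'
  rw [ht0, zero_smul, add_zero] at e
  exact h𝒞.sub_notMem hU hc hc' hA hcov hx hz.1 (e ▸ hl)

/-- If `u` has constant nonzero sign on `c`, only the half of `c'` on that side can be adjacent, and
its incidence number is unchanged. If `u` vanishes on `c`, all three numbers are zero. -/
lemma incid_posPart_add {c c' : Set V} (hc : c ∈ 𝒞) (hc' : c' ∈ 𝒞) (hx : ¬ Crosses u c)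
    (hx' : Crosses u c') : incid c (posPart u c') + incid c (posPart (-u) c') = incid c c' := by
  have key : ∀ u : Dual ℝ V, ¬ Crosses u c → Crosses u c' → (∀ x ∈ c, 0 < u x) →
      incid c (posPart u c') + incid c (posPart (-u) c') = incid c c' := by
    intro u hx hx' hpos
    obtain ⟨x, hxc⟩ := (h𝒞.cell c hc).1
    rw [incid_eq_zero (c' := posPart (-u) c') fun h _ =>
      not_adheres_posPart_neg hx'.2 hxc (hpos x hxc) h, add_zero]
    exact h𝒞.incid_eq_of_subset hU (h𝒞.cut hU u) hc hc' (mem_cut_of_not_crosses hc hx)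
      (mem_cut_of_crosses hc' hx').1 subset_rfl posPart_subset rfl
      ((h𝒞.cell c' hc').vectorSpan_posPart hU hx'.1) fun h => h.posPart fun x hx => (hpos x hx).le
  rcases (h𝒞.cell c hc).trichotomy hU u hx with h | h | h
  · exact key u hx hx' h
  · have := key (-u) (fun h => hx (crosses_neg.1 h)) hx'.neg (fun x hx => by simpa using h x hx)
    rw [neg_neg] at this
    rw [add_comm]
    exact this
  · have hz : ∀ d ⊆ c', d.Nonempty → vectorSpan ℝ d = vectorSpan ℝ c' → incid c d = 0 := by
      intro d hd hne hs
      refine incid_eq_zero fun hA => ?_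
      rw [hs]
      exact h𝒞.not_covers_of_zero hU hc hc' h hx'
        (h𝒞.adheres_of_subset hc hc' subset_rfl hd (h𝒞.cell c hc).1 hne hA)
    rw [hz _ posPart_subset hx'.1 ((h𝒞.cell c' hc').vectorSpan_posPart hU hx'.1),
      hz _ posPart_subset hx'.2 ((h𝒞.cell c' hc').vectorSpan_posPart hU hx'.2),
      hz c' subset_rfl (h𝒞.cell c' hc').1 rfl, add_zero]

end IsDecomp

end Incidence

section Complex

variable {R : Type*} [CommRing R]

/-- The total differential of the cellular complex of a family of cells. -/
def cellD (𝒞 : Finset (Set V)) (f : Set V → R) (σ : Set V) : R :=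
  ∑ τ ∈ 𝒞, f τ * (incid τ σ : R)

omit [FiniteDimensional ℝ V] in
open Classical in
/-- The augmentation of the cellular complex: the sum of the coefficients of the open cells. -/
def cellAug (𝒞 : Finset (Set V)) (f : Set V → R) : R :=
  ∑ τ ∈ 𝒞, if vectorSpan ℝ τ = ⊤ then f τ else 0

variable (R) in
/-- Exactness of the augmented cellular complex. -/
def CellExact (𝒞 : Finset (Set V)) : Prop :=
  ∀ f : Set V → R, (∀ σ ∈ 𝒞, cellD 𝒞 f σ = 0) → cellAug 𝒞 f = 0 →
    ∃ g : Set V → R, ∀ σ ∈ 𝒞, f σ = cellD 𝒞 g σ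

lemma cellD_sub (𝒞 : Finset (Set V)) (f g : Set V → R) (σ : Set V) :
    cellD 𝒞 (fun c => f c - g c) σ = cellD 𝒞 f σ - cellD 𝒞 g σ := by
  simp only [cellD, sub_mul, Finset.sum_sub_distrib]

lemma cellD_congr {𝒞 : Finset (Set V)} {f g : Set V → R} (h : ∀ c ∈ 𝒞, f c = g c) (σ : Set V) :
    cellD 𝒞 f σ = cellD 𝒞 g σ :=
  Finset.sum_congr rfl fun c hc => by rw [h c hc]

omit [FiniteDimensional ℝ V] in
lemma cellAug_congr {𝒞 : Finset (Set V)} {f g : Set V → R} (h : ∀ c ∈ 𝒞, f c = g c) :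
    cellAug 𝒞 f = cellAug 𝒞 g :=
  Finset.sum_congr rfl fun c hc => by rw [h c hc]

omit [FiniteDimensional ℝ V] in
open Classical in
/-- The map of chains which sends the parts of a cell of the same dimension to the cell. -/
def collapse (u : Dual ℝ V) (f : Set V → R) (c : Set V) : R :=
  if Crosses u c then f (posPart u c) + f (posPart (-u) c) else f c

namespace IsDecomp

variable {U : Set V} {𝒞 : Finset (Set V)} (hU : IsOpenConvex U) (h𝒞 : IsDecomp U 𝒞)

include hU h𝒞

lemma cellD_cellD (f : Set V → R) {κ : Set V} (hκ : κ ∈ 𝒞) : cellD 𝒞 (cellD 𝒞 f) κ = 0 := by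
  simp only [cellD, Finset.sum_mul]
  rw [Finset.sum_comm]
  refine Finset.sum_eq_zero fun τ hτ => ?_
  have := h𝒞.sum_incid_mul_incid hU hτ hκ
  simp only [mul_assoc, ← Finset.mul_sum]
  rw [show ∑ ρ ∈ 𝒞, (incid τ ρ : R) * (incid ρ κ : R) = ((∑ ρ ∈ 𝒞, incid τ ρ * incid ρ κ : ℤ) : R) by
    push_cast; rfl, this, Int.cast_zero, mul_zero]

variable {u : Dual ℝ V}

omit [FiniteDimensional ℝ V] in
open Classical in
lemma sum_cut (F : Set V → R) :
    ∑ c ∈ cut u 𝒞, F c = ∑ c ∈ 𝒞, if Crosses u c then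
      F (posPart u c) + F (posPart (-u) c) + F (zeroPart u c) else F c := by
  unfold cut
  rw [Finset.sum_biUnion]
  · refine Finset.sum_congr rfl fun c hc => ?_
    split_ifs with h
    · have h0 := (h𝒞.cell c hc).zeroPart_nonempty hU h
      obtain ⟨x, hx⟩ := h.1
      obtain ⟨y, hy⟩ := h.2
      have hux : 0 < u x := hx.2
      have huy : 0 < (-u) y := hy.2
      rw [LinearMap.neg_apply] at huy
      rw [Finset.sum_insert, Finset.sum_insert, Finset.sum_singleton, add_assoc]
      · rw [Finset.mem_singleton]
        intro e
        have : u y = 0 := (e ▸ hy : y ∈ zeroPart u c).2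
        linarith
      · rw [Finset.mem_insert, Finset.mem_singleton]
        rintro (e | e)
        · have : 0 < (-u) x := (e ▸ hx : x ∈ posPart (-u) c).2
          rw [LinearMap.neg_apply] at this
          linarith
        · have : u x = 0 := (e ▸ hx : x ∈ zeroPart u c).2
          linarith
    · rw [Finset.sum_singleton]
  · intro c hc d hd hcd
    have key : ∀ c ∈ 𝒞, ∀ a ∈ (if Crosses u c then {posPart u c, posPart (-u) c, zeroPart u c}
        else {c} : Finset (Set V)), a.Nonempty ∧ a ⊆ c := by
      intro c hc a ha
      split_ifs at ha with h
      · simp only [Finset.mem_insert, Finset.mem_singleton] at ha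
        rcases ha with rfl | rfl | rfl
        · exact ⟨h.1, posPart_subset⟩
        · exact ⟨h.2, posPart_subset⟩
        · exact ⟨(h𝒞.cell c hc).zeroPart_nonempty hU h, zeroPart_subset⟩
      · rw [Finset.mem_singleton] at ha
        subst ha
        exact ⟨(h𝒞.cell _ hc).1, subset_rfl⟩
    refine Finset.disjoint_left.2 fun a ha ha' => hcd ?_
    obtain ⟨⟨x, hx⟩, h1⟩ := key c hc a ha
    exact h𝒞.disj c hc d hd x (h1 hx) ((key d hd a ha').2 hx)

/-- Both halves of a crossed cell have the span of the cell, while its zero part has smaller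
dimension and never counts. -/
lemma cellAug_cut (f : Set V → R) : cellAug (cut u 𝒞) f = cellAug 𝒞 (collapse u f) := by
  classical
  unfold cellAug
  rw [h𝒞.sum_cut hU]
  refine Finset.sum_congr rfl fun c hc => ?_
  by_cases hx : Crosses u c
  · have h0 : vectorSpan ℝ (zeroPart u c) ≠ ⊤ := by
      intro h
      have h8 := (h𝒞.covers_zeroPart hU hc hx).2
      have h9 := Submodule.finrank_le (vectorSpan ℝ c)
      rw [h, finrank_top] at h8
      omega
    rw [if_pos hx, collapse, if_pos hx, (h𝒞.cell c hc).vectorSpan_posPart hU hx.1,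
      (h𝒞.cell c hc).vectorSpan_posPart hU hx.2, if_neg h0]
    split_ifs <;> ring
  · rw [if_neg hx, collapse, if_neg hx]

/-- The collapse is a chain map: corresponding halves keep the old incidence number, opposite halves
are not incident, and a zero part contributes opposite amounts to the two halves of a crossed cell,
which cancel on merging. -/
lemma collapse_cellD (f : Set V → R) {σ : Set V} (hσ : σ ∈ 𝒞) :
    collapse u (cellD (cut u 𝒞) f) σ = cellD 𝒞 (collapse u f) σ := by
  classical
  unfold cellD
  by_cases hxσ : Crosses u σ
  · rw [collapse, if_pos hxσ, h𝒞.sum_cut hU, h𝒞.sum_cut hU, ← Finset.sum_add_distrib]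
    refine Finset.sum_congr rfl fun c hc => ?_
    split_ifs with hx
    · have e1 := h𝒞.incid_posPart_posPart hU hc hσ hx hxσ
      have e2 := h𝒞.incid_posPart_posPart hU hc hσ hx.neg hxσ.neg
      have e3 := incid_posPart_neg hx hxσ
      have e4 := incid_posPart_neg hx.neg hxσ.neg
      rw [neg_neg] at e4
      have e5 : incid (zeroPart u c) (posPart u σ) + incid (zeroPart u c) (posPart (-u) σ) = 0 := by
        by_cases hcσ : c = σ
        · subst hcσ
          exact h𝒞.incid_zeroPart_add hU hc hx
        · have e6 := h𝒞.incid_zeroPart_posPart_of_ne hU hc hσ hx hxσ hcσ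
          have e7 := h𝒞.incid_zeroPart_posPart_of_ne hU hc hσ hx.neg hxσ.neg hcσ
          rw [zeroPart_neg] at e7
          rw [e6, e7, add_zero]
      have e5' : (incid (zeroPart u c) (posPart u σ) : R) +
          (incid (zeroPart u c) (posPart (-u) σ) : R) = 0 := by exact_mod_cast congrArg (Int.cast : ℤ → R) e5
      rw [e1, e2, e3, e4, Int.cast_zero, collapse, if_pos hx]
      linear_combination f (zeroPart u c) * e5'
    · have e := h𝒞.incid_posPart_add hU hc hσ hx hxσ
      have e' : (incid c (posPart u σ) : R) + (incid c (posPart (-u) σ) : R) = (incid c σ : R) := by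
        exact_mod_cast congrArg (Int.cast : ℤ → R) e
      rw [collapse, if_neg hx]
      linear_combination f c * e'
  · rw [collapse, if_neg hxσ, h𝒞.sum_cut hU]
    refine Finset.sum_congr rfl fun c hc => ?_
    split_ifs with hx
    · have hz : ∀ d ⊆ c, d.Nonempty → incid d σ = 0 := fun d hd hne =>
        h𝒞.incid_eq_zero_of_crosses hc hσ hd subset_rfl hne (h𝒞.cell σ hσ).1 hx hxσ
      rw [hz _ posPart_subset hx.1, hz _ posPart_subset hx.2,
        hz _ zeroPart_subset ((h𝒞.cell c hc).zeroPart_nonempty hU hx),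
        hz c subset_rfl (h𝒞.cell c hc).1]
      simp
    · rw [collapse, if_neg hx]

-- A chain supported on zero parts can be recovered from its boundary: at the positive half of `c`
-- only the zero part of `c` itself contributes, and it does so with a sign. This triangularity
-- makes the kernel of the collapse acyclic.
open Classical in
lemma cellD_of_collapse_eq_zero (f : Set V → R) {c : Set V} (hc : c ∈ 𝒞) (hx : Crosses u c)
    (h : ∀ c ∈ 𝒞, ¬ Crosses u c → f c = 0)
    (h' : ∀ c ∈ 𝒞, Crosses u c → f (posPart u c) = 0 ∧ f (posPart (-u) c) = 0) :
    cellD (cut u 𝒞) f (posPart u c) = f (zeroPart u c) * (incid (zeroPart u c) (posPart u c) : R) := by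
  unfold cellD
  rw [h𝒞.sum_cut hU, Finset.sum_eq_single c]
  · rw [if_pos hx, (h' c hc hx).1, (h' c hc hx).2]
    ring
  · intro d hd hdc
    split_ifs with hxd
    · rw [(h' d hd hxd).1, (h' d hd hxd).2, h𝒞.incid_zeroPart_posPart_of_ne hU hd hc hxd hx hdc]
      simp
    · rw [h d hd hxd, zero_mul]
  · exact fun h => absurd hc h

/-- The kernel of the collapse is acyclic. -/
lemma exists_of_collapse_eq_zero (f : Set V → R) (h0 : ∀ c ∈ 𝒞, collapse u f c = 0)
    (hd : ∀ c ∈ cut u 𝒞, cellD (cut u 𝒞) f c = 0) :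
    ∃ g : Set V → R, (∀ c ∈ 𝒞, collapse u g c = 0) ∧
      ∀ c ∈ cut u 𝒞, f c = cellD (cut u 𝒞) g c := by
  classical
  have h𝒞' := h𝒞.cut hU u
  -- The kernel is spanned by the zero parts and by the differences of the two halves of a cell; up
  -- to further zero parts, the boundary of a zero part is plus or minus such a difference. So `g`
  -- moves the coefficient of each positive half to the zero part, the sign being its own inverse.
  let g : Set V → R := fun a => if ∃ c ∈ 𝒞, Crosses u c ∧ a = zeroPart u c then
    ∑ c ∈ 𝒞, if Crosses u c ∧ a = zeroPart u c then
      f (posPart u c) * (incid (zeroPart u c) (posPart u c) : R) else 0 else 0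
  have hzinj : ∀ c ∈ 𝒞, ∀ d ∈ 𝒞, Crosses u c → zeroPart u c = zeroPart u d → c = d := by
    intro c hc d hd hx e
    obtain ⟨z, hz⟩ := (h𝒞.cell c hc).zeroPart_nonempty hU hx
    exact h𝒞.disj c hc d hd z hz.1 (e ▸ hz : z ∈ zeroPart u d).1
  have hg : ∀ c ∈ 𝒞, Crosses u c → g (zeroPart u c) =
      f (posPart u c) * (incid (zeroPart u c) (posPart u c) : R) := by
    intro c hc hx
    simp only [g]
    rw [if_pos ⟨c, hc, hx, rfl⟩, Finset.sum_eq_single c, if_pos ⟨hx, rfl⟩]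
    · intro d hd hdc
      rw [if_neg]
      rintro ⟨hxd, e⟩
      exact hdc (hzinj c hc d hd hx e).symm
    · exact fun h => absurd hc h
  have hg0 : ∀ c ∈ 𝒞, ¬ Crosses u c → g c = 0 := by
    intro c hc hx
    simp only [g]
    rw [if_neg]
    rintro ⟨d, hd, hxd, rfl⟩
    obtain ⟨z, hz⟩ := (h𝒞.cell _ hc).1
    rw [h𝒞.disj _ hc d hd z hz hz.1] at hx
    exact hx hxd
  have hgp : ∀ u' : Dual ℝ V, (u' = u ∨ u' = -u) → ∀ c ∈ 𝒞, Crosses u c → g (posPart u' c) = 0 := by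
    intro u' hu' c hc hx
    simp only [g]
    rw [if_neg]
    rintro ⟨d, hd, hxd, e⟩
    obtain ⟨z, hz⟩ : (posPart u' c).Nonempty := by
      rcases hu' with rfl | rfl
      exacts [hx.1, hx.2]
    have h1 : 0 < u' z := hz.2
    have h2 : u z = 0 := (e ▸ hz : z ∈ zeroPart u d).2
    rcases hu' with rfl | rfl
    · linarith
    · rw [LinearMap.neg_apply] at h1; linarith
  have hgc : ∀ c ∈ 𝒞, collapse u g c = 0 := by
    intro c hc
    unfold collapse
    split_ifs with hx
    · rw [hgp u (Or.inl rfl) c hc hx, hgp (-u) (Or.inr rfl) c hc hx, add_zero]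
    · exact hg0 c hc hx
  have hDg : ∀ c ∈ 𝒞, collapse u (cellD (cut u 𝒞) g) c = 0 := by
    intro c hc
    rw [h𝒞.collapse_cellD hU g hc]
    exact Finset.sum_eq_zero fun d hd => by rw [hgc d hd, zero_mul]
  have hsq : ∀ c ∈ 𝒞, Crosses u c → (incid (zeroPart u c) (posPart u c) : R) *
      (incid (zeroPart u c) (posPart u c) : R) = 1 := by
    intro c hc hx
    exact_mod_cast congrArg (Int.cast : ℤ → R) (h𝒞.incid_zeroPart_mul_self hU hc hx)
  let f' : Set V → R := fun c => f c - cellD (cut u 𝒞) g c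
  have hf'c : ∀ c ∈ 𝒞, Crosses u c → f' (posPart u c) = 0 := by
    intro c hc hx
    simp only [f']
    rw [h𝒞.cellD_of_collapse_eq_zero hU g hc hx hg0 fun c hc hx =>
      ⟨hgp u (Or.inl rfl) c hc hx, hgp (-u) (Or.inr rfl) c hc hx⟩, hg c hc hx, mul_assoc,
      hsq c hc hx, mul_one, sub_self]
  have hf'n : ∀ c ∈ 𝒞, Crosses u c → f' (posPart (-u) c) = 0 := by
    intro c hc hx
    have h1 := h0 c hc
    have h2 := hDg c hc
    have h3 := hf'c c hc hx
    unfold collapse at h1 h2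
    rw [if_pos hx] at h1 h2
    simp only [f'] at h3 ⊢
    linear_combination h1 - h2 - h3
  have hf'0 : ∀ c ∈ 𝒞, ¬ Crosses u c → f' c = 0 := by
    intro c hc hx
    have h1 := h0 c hc
    have h2 := hDg c hc
    unfold collapse at h1 h2
    rw [if_neg hx] at h1 h2
    simp only [f']
    rw [h1, h2, sub_zero]
  have hDf' : ∀ c ∈ cut u 𝒞, cellD (cut u 𝒞) f' c = 0 := by
    intro c hc
    rw [cellD_sub, hd c hc, h𝒞'.cellD_cellD hU g hc, sub_zero]
  -- What remains is a cycle supported on zero parts, and its boundary at the positive half of `c`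
  -- is, up to sign, its coefficient at the zero part of `c`.
  have hf'z : ∀ c ∈ 𝒞, Crosses u c → f' (zeroPart u c) = 0 := by
    intro c hc hx
    have h1 := hDf' _ (mem_cut_of_crosses hc hx).1
    rw [h𝒞.cellD_of_collapse_eq_zero hU f' hc hx hf'0 fun c hc hx =>
      ⟨hf'c c hc hx, hf'n c hc hx⟩] at h1
    have h2 := congrArg (· * (incid (zeroPart u c) (posPart u c) : R)) h1
    simpa only [mul_assoc, hsq c hc hx, mul_one, zero_mul] using h2
  refine ⟨g, hgc, fun c' hc' => ?_⟩
  rw [← sub_eq_zero]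
  change f' c' = 0
  obtain ⟨c, hc, hcc⟩ := Finset.mem_biUnion.1 hc'
  split_ifs at hcc with hx
  · simp only [Finset.mem_insert, Finset.mem_singleton] at hcc
    rcases hcc with rfl | rfl | rfl
    exacts [hf'c c hc hx, hf'n c hc hx, hf'z c hc hx]
  · rw [Finset.mem_singleton] at hcc
    subst hcc
    exact hf'0 _ hc hx

-- A preimage under the collapse puts the whole coefficient of a crossed cell on its positive half.
omit [FiniteDimensional ℝ V] hU in
lemma exists_collapse_eq (f : Set V → R) : ∃ f' : Set V → R, ∀ c ∈ 𝒞, collapse u f' c = f c := by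
  classical
  refine ⟨fun a => ∑ c ∈ 𝒞, if (Crosses u c ∧ a = posPart u c) ∨ (¬ Crosses u c ∧ a = c)
    then f c else 0, fun c hc => ?_⟩
  unfold collapse
  beta_reduce
  split_ifs with hx
  · rw [Finset.sum_eq_single c, if_pos (Or.inl ⟨hx, rfl⟩), Finset.sum_eq_zero, add_zero]
    · intro d hd
      rw [if_neg]
      obtain ⟨z, hz⟩ := hx.2
      rintro (⟨hxd, e⟩ | ⟨hxd, e⟩)
      · have h1 : 0 < (-u) z := hz.2
        have h2 : 0 < u z := (e ▸ hz : z ∈ posPart u d).2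
        rw [LinearMap.neg_apply] at h1
        linarith
      · rw [h𝒞.disj c hc d hd z hz.1 (e ▸ hz)] at hx
        exact hxd hx
    · intro d hd hdc
      rw [if_neg]
      obtain ⟨z, hz⟩ := hx.1
      rintro (⟨hxd, e⟩ | ⟨hxd, e⟩)
      · exact hdc (h𝒞.disj c hc d hd z hz.1 (e ▸ hz : z ∈ posPart u d).1).symm
      · exact hdc (h𝒞.disj c hc d hd z hz.1 (e ▸ hz)).symm
    · exact fun h => absurd hc h
  · rw [Finset.sum_eq_single c, if_pos (Or.inr ⟨hx, rfl⟩)]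
    · intro d hd hdc
      rw [if_neg]
      obtain ⟨z, hz⟩ := (h𝒞.cell c hc).1
      rintro (⟨hxd, e⟩ | ⟨hxd, e⟩)
      · exact hdc (h𝒞.disj c hc d hd z hz (e ▸ hz : z ∈ posPart u d).1).symm
      · exact hdc e.symm
    · exact fun h => absurd hc h

/-- A surjective chain map with acyclic kernel, compatible with the augmentations, transfers
exactness in both directions. -/
lemma cellExact_cut_iff (u : Dual ℝ V) : CellExact R (cut u 𝒞) ↔ CellExact R 𝒞 := by
  have h𝒞' := h𝒞.cut hU u
  constructor
  · intro H f hf ha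
    obtain ⟨f', hf'⟩ := h𝒞.exists_collapse_eq (u := u) f
    -- The lift `f'` of the cycle `f` is a cycle only modulo the kernel of the collapse. Its
    -- boundary is a cycle in the kernel, hence the boundary of some `h` in the kernel, and `f' - h`
    -- is a cycle lifting `f`.
    obtain ⟨h, hh0, hh⟩ := h𝒞.exists_of_collapse_eq_zero hU (u := u) (cellD (cut u 𝒞) f')
      (fun c hc => by rw [h𝒞.collapse_cellD hU f' hc, cellD_congr hf', hf c hc])
      (fun c hc => h𝒞'.cellD_cellD hU f' hc)
    have hcs : ∀ c ∈ 𝒞, collapse u (fun c => f' c - h c) c = f c := by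
      intro c hc
      have h1 := hf' c hc
      have h2 := hh0 c hc
      unfold collapse at h1 h2 ⊢
      split_ifs at h1 h2 ⊢
      · linear_combination h1 - h2
      · linear_combination h1 - h2
    obtain ⟨g', hg'⟩ := H (fun c => f' c - h c)
      (fun c hc => by rw [cellD_sub, ← hh c hc, sub_self])
      (by rw [h𝒞.cellAug_cut hU, cellAug_congr hcs, ha])
    refine ⟨collapse u g', fun c hc => ?_⟩
    rw [← h𝒞.collapse_cellD hU g' hc, ← hcs c hc]
    unfold collapse
    split_ifs with hx
    · have hm := mem_cut_of_crosses hc hx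
      rw [← hg' _ hm.1, ← hg' _ hm.2.1]
    · rw [← hg' _ (mem_cut_of_not_crosses hc hx)]
  · intro H f hf ha
    obtain ⟨g, hg⟩ := H (collapse u f) (fun c hc => by
        rw [← h𝒞.collapse_cellD hU f hc]
        unfold collapse
        split_ifs with hx
        · have hm := mem_cut_of_crosses hc hx
          rw [hf _ hm.1, hf _ hm.2.1, add_zero]
        · exact hf _ (mem_cut_of_not_crosses hc hx)) (by rw [← h𝒞.cellAug_cut hU, ha])
    obtain ⟨g', hg'⟩ := h𝒞.exists_collapse_eq (u := u) g
    -- After subtracting the boundary of a lift of `g`, the cycle `f` lies in the kernel and is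
    -- therefore a boundary.
    obtain ⟨h, _, hh⟩ := h𝒞.exists_of_collapse_eq_zero hU (u := u)
      (fun c => f c - cellD (cut u 𝒞) g' c) (fun c hc => by
        have h1 := h𝒞.collapse_cellD hU g' (u := u) hc
        rw [cellD_congr hg', ← hg c hc] at h1
        unfold collapse at h1 ⊢
        split_ifs at h1 ⊢
        · linear_combination -h1
        · linear_combination -h1)
      (fun c hc => by rw [cellD_sub, hf c hc, h𝒞'.cellD_cellD hU g' hc, sub_zero])
    refine ⟨fun c => h c - (-g' c), fun c hc => ?_⟩
    have h1 := hh c hc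
    have h2 : cellD (cut u 𝒞) (fun c => -g' c) c = -cellD (cut u 𝒞) g' c := by
      simp [cellD]
    rw [cellD_sub, ← h1, h2]
    ring

end IsDecomp

end Complex

end CellComplex

end

end ToricRes

namespace ToricRes

noncomputable section

/-! ### Exactness for decompositions separated by finitely many functionals -/

section CellInduction

open Module

variable {V : Type*} [AddCommGroup V] [Module ℝ V] [FiniteDimensional ℝ V]
variable {R : Type*} [CommRing R]

variable (R) in
/-- The augmented cellular complex is a resolution. -/
structure IsCellResolution (𝒞 : Finset (Set V)) : Prop where
  exact : CellExact R 𝒞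
  aug_d : ∀ f : Set V → R, cellAug 𝒞 (cellD 𝒞 f) = 0
  exists_open : ∃ c ∈ 𝒞, vectorSpan ℝ c = ⊤

variable {U : Set V} (hU : IsOpenConvex U)

include hU

lemma IsDecomp.isCellResolution_cut_iff {𝒞 : Finset (Set V)} (h𝒞 : IsDecomp U 𝒞) (u : Dual ℝ V) :
    IsCellResolution R (cut u 𝒞) ↔ IsCellResolution R 𝒞 := by
  have key : ∀ f : Set V → R, cellAug (cut u 𝒞) (cellD (cut u 𝒞) f) =
      cellAug 𝒞 (cellD 𝒞 (collapse u f)) := fun f => by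
    rw [h𝒞.cellAug_cut hU]
    exact cellAug_congr fun c hc => h𝒞.collapse_cellD hU f hc
  constructor
  · rintro ⟨h1, h2, c', h3, h4⟩
    refine ⟨(h𝒞.cellExact_cut_iff hU u).1 h1, fun f => ?_, ?_⟩
    · obtain ⟨f', hf'⟩ := h𝒞.exists_collapse_eq (u := u) f
      rw [← h2 f', key]
      exact cellAug_congr fun c _ => (cellD_congr hf' c).symm
    · obtain ⟨_, c, hc, s, rfl⟩ := (h𝒞.mem_cut_iff hU).1 h3
      exact ⟨c, hc, top_le_iff.1 (h4 ▸ vectorSpan_mono ℝ Set.inter_subset_left)⟩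
  · rintro ⟨h1, h2, c, hc, h4⟩
    refine ⟨(h𝒞.cellExact_cut_iff hU u).2 h1, fun f => by rw [key, h2], ?_⟩
    by_cases hx : Crosses u c
    · exact ⟨_, (mem_cut_of_crosses hc hx).1, by rw [(h𝒞.cell c hc).vectorSpan_posPart hU hx.1, h4]⟩
    · exact ⟨c, mem_cut_of_not_crosses hc hx, h4⟩

omit [FiniteDimensional ℝ V] in
lemma IsDecomp.foldr_cut {𝒞 : Finset (Set V)} (h𝒞 : IsDecomp U 𝒞) (us : List (Dual ℝ V)) :
    IsDecomp U (us.foldr cut 𝒞) := by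
  induction us with
  | nil => exact h𝒞
  | cons u us ih => exact ih.cut hU u

lemma IsDecomp.isCellResolution_foldr_cut_iff {𝒞 : Finset (Set V)} (h𝒞 : IsDecomp U 𝒞)
    (us : List (Dual ℝ V)) : IsCellResolution R (us.foldr cut 𝒞) ↔ IsCellResolution R 𝒞 := by
  induction us with
  | nil => rfl
  | cons u us ih => exact ((h𝒞.foldr_cut hU us).isCellResolution_cut_iff hU u).trans ih

omit [FiniteDimensional ℝ V] in
lemma IsDecomp.exists_mem_foldr_cut_iff {𝒞 : Finset (Set V)} (h𝒞 : IsDecomp U 𝒞)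
    (us : List (Dual ℝ V)) {x y : V} : (∃ c ∈ us.foldr cut 𝒞, x ∈ c ∧ y ∈ c) ↔
      (∃ c ∈ 𝒞, x ∈ c ∧ y ∈ c) ∧ ∀ u ∈ us, SignType.sign (u x) = SignType.sign (u y) := by
  induction us with
  | nil => simp
  | cons u us ih =>
    rw [List.foldr_cons, (h𝒞.foldr_cut hU us).exists_mem_cut_iff hU, ih, List.forall_mem_cons]
    tauto

omit [FiniteDimensional ℝ V] hU in
lemma IsDecomp.eq_of_iff {𝒞 𝒟 : Finset (Set V)} (h𝒞 : IsDecomp U 𝒞) (h𝒟 : IsDecomp U 𝒟)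
    (h : ∀ x ∈ U, ∀ y ∈ U, (∃ c ∈ 𝒞, x ∈ c ∧ y ∈ c) ↔ ∃ c ∈ 𝒟, x ∈ c ∧ y ∈ c) : 𝒞 = 𝒟 := by
  have key : ∀ 𝒞 𝒟 : Finset (Set V), IsDecomp U 𝒞 → IsDecomp U 𝒟 →
      (∀ x ∈ U, ∀ y ∈ U, (∃ c ∈ 𝒞, x ∈ c ∧ y ∈ c) ↔ ∃ c ∈ 𝒟, x ∈ c ∧ y ∈ c) → 𝒞 ⊆ 𝒟 := by
    intro 𝒞 𝒟 h𝒞 h𝒟 h c hc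
    obtain ⟨x, hx⟩ := (h𝒞.cell c hc).1
    have hxU := (h𝒞.cell c hc).subset hx
    obtain ⟨d, hd, hxd⟩ := h𝒟.cover x hxU
    have : c = d := by
      ext y
      constructor
      · intro hy
        obtain ⟨d', hd', hx', hy'⟩ := (h x hxU y ((h𝒞.cell c hc).subset hy)).1 ⟨c, hc, hx, hy⟩
        rwa [h𝒟.disj d hd d' hd' x hxd hx']
      · intro hy
        obtain ⟨c', hc', hx', hy'⟩ := (h x hxU y ((h𝒟.cell d hd).subset hy)).2 ⟨d, hd, hxd, hy⟩
        rwa [h𝒞.disj c hc c' hc' x hx hx']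
    rwa [this]
  exact Finset.Subset.antisymm (key 𝒞 𝒟 h𝒞 h𝒟 h) (key 𝒟 𝒞 h𝒟 h𝒞 fun x hx y hy => (h x hx y hy).symm)

omit [FiniteDimensional ℝ V] in
lemma IsOpenConvex.vectorSpan_eq_top (hne : U.Nonempty) : vectorSpan ℝ U = ⊤ := by
  obtain ⟨x, hx⟩ := hne
  refine eq_top_iff.2 fun v _ => ?_
  obtain ⟨δ, hδ, H⟩ := hU.isOpen x hx v
  have := sub_mem_vectorSpan hx (H δ hδ.le le_rfl)
  rw [add_sub_cancel_left] at this
  exact (Submodule.smul_mem_iff _ hδ.ne').1 this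

omit [FiniteDimensional ℝ V] in
lemma IsOpenConvex.isDecomp_singleton (hne : U.Nonempty) : IsDecomp U {U} where
  cell := by
    intro c hc
    rw [Finset.mem_singleton] at hc
    subst hc
    exact ⟨hne, ⊤, ∅, by simp⟩
  disj := by
    intro c hc c' hc' _ _ _
    rw [Finset.mem_singleton] at hc hc'
    rw [hc, hc']
  cover := fun x hx => ⟨U, Finset.mem_singleton_self U, hx⟩
  frontier := by
    intro c hc c' hc' _ _ _ _ _ x hx y hy t h0 h1
    rw [Finset.mem_singleton] at hc hc'
    subst hc
    subst hc'
    exact hU.convex.add_smul_sub_mem hx hy ⟨h0.le, h1⟩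

lemma IsOpenConvex.isCellResolution_singleton (hne : U.Nonempty) :
    IsCellResolution R ({U} : Finset (Set V)) := by
  have h0 : incid U U = 0 := incid_eq_zero fun _ h => by have := h.2; omega
  have hD : ∀ f : Set V → R, cellD {U} f U = 0 := fun f => by simp [cellD, h0]
  have htop := hU.vectorSpan_eq_top hne
  refine ⟨fun f _ ha => ⟨0, fun c hc => ?_⟩, fun f => ?_, U, Finset.mem_singleton_self U, htop⟩
  · rw [Finset.mem_singleton] at hc
    subst hc
    rw [hD]
    simpa [cellAug, htop] using ha
  · simp [cellAug, hD]

/-- A decomposition whose cells are separated by finitely many linear functionals has an exact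
augmented cellular complex. -/
theorem IsDecomp.isCellResolution {𝒞 : Finset (Set V)} (h𝒞 : IsDecomp U 𝒞) (hne : U.Nonempty)
    (us : List (Dual ℝ V)) (hsep : ∀ c ∈ 𝒞, ∀ c' ∈ 𝒞, ∀ x ∈ c, ∀ y ∈ c',
      (∀ u ∈ us, SignType.sign (u x) = SignType.sign (u y)) → c = c') :
    IsCellResolution R 𝒞 := by
  have hs := hU.isDecomp_singleton hne
  rw [← h𝒞.isCellResolution_foldr_cut_iff hU us]
  -- After all the cuts, two points share a cell exactly when every functional has the same sign at
  -- both. For `{U}` there is no further condition, and for `𝒞` the further condition is implied by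
  -- `hsep`.
  have e : us.foldr cut 𝒞 = us.foldr cut {U} := by
    refine (h𝒞.foldr_cut hU us).eq_of_iff (hs.foldr_cut hU us) fun x hx y hy => ?_
    rw [h𝒞.exists_mem_foldr_cut_iff hU, hs.exists_mem_foldr_cut_iff hU]
    refine and_congr_left fun hus => ⟨fun _ => ⟨U, Finset.mem_singleton_self U, hx, hy⟩, fun _ => ?_⟩
    obtain ⟨c, hc, hxc⟩ := h𝒞.cover x hx
    obtain ⟨c', hc', hyc⟩ := h𝒞.cover y hy
    rw [← hsep c hc c' hc' x hxc y hyc hus] at hyc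
    exact ⟨c, hc, hxc, hyc⟩
  rw [e, hs.isCellResolution_foldr_cut_iff hU us]
  exact hU.isCellResolution_singleton hne

end CellInduction

end

end ToricRes

namespace ToricRes

noncomputable section

/-! ### Finitely generated cones, their inequalities and relative interiors -/

section Polyhedral

open Module

variable {V : Type*} [AddCommGroup V] [Module ℝ V]

/-- Fourier–Motzkin elimination of `t`. A functional with `α g > 0` bounds `t` above by `α x / α g`,
one with `α g < 0` bounds it below by the same quotient. A solution exists when 0 and every lower
bound are at most every upper bound, and the functionals with `α g = 0` hold at `x`; these
conditions are again linear in `x`. -/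
lemma exists_dual_of_insert (A : Finset (Dual ℝ V)) (g : V) :
    ∃ A' : Finset (Dual ℝ V), ∀ x, (∃ t : ℝ, 0 ≤ t ∧ ∀ α ∈ A, 0 ≤ α (x - t • g)) ↔
      ∀ α ∈ A', 0 ≤ α x := by
  classical
  refine ⟨(A.filter fun α => 0 ≤ α g) ∪
    ((A ×ˢ A).filter fun q => q.1 g < 0 ∧ 0 < q.2 g).image fun q => q.2 g • q.1 - q.1 g • q.2,
    fun x => ?_⟩
  simp only [Finset.mem_union, Finset.mem_image, Finset.mem_filter, Finset.mem_product, map_sub,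
    map_smul, smul_eq_mul]
  constructor
  · rintro ⟨t, ht, H⟩ α (⟨hα, hg⟩ | ⟨⟨β, γ⟩, ⟨⟨hβ, hγ⟩, hβg, hγg⟩, rfl⟩)
    · have := H α hα
      have := mul_nonneg ht hg
      linarith
    · have h1 := H β hβ
      have h2 := H γ hγ
      simp only at hβg hγg
      simp only [LinearMap.sub_apply, LinearMap.smul_apply, smul_eq_mul]
      nlinarith [mul_nonneg hγg.le h1, mul_nonneg (neg_nonneg.2 hβg.le) h2]
  · intro H
    -- The largest lower bound, including 0, is the smallest admissible value of `t`.
    let L : Finset ℝ := insert 0 ((A.filter fun α => α g < 0).image fun α => α x / α g)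
    have hL : L.Nonempty := ⟨0, Finset.mem_insert_self _ _⟩
    refine ⟨L.max' hL, Finset.le_max' _ _ (Finset.mem_insert_self _ _), fun α hα => ?_⟩
    rcases lt_trichotomy (α g) 0 with hg | hg | hg
    · have h1 : α x / α g ≤ L.max' hL := Finset.le_max' L _ (Finset.mem_insert_of_mem
        (Finset.mem_image.2 ⟨α, Finset.mem_filter.2 ⟨hα, hg⟩, rfl⟩))
      rw [div_le_iff_of_neg hg] at h1
      linarith
    · have := H α (Or.inl ⟨hα, hg.ge⟩)
      rw [hg]; linarith
    · have h2 : L.max' hL ≤ α x / α g := by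
        refine Finset.max'_le _ _ _ fun t ht => ?_
        rcases Finset.mem_insert.1 ht with rfl | ht
        · exact div_nonneg (H α (Or.inl ⟨hα, hg.le⟩)) hg.le
        · obtain ⟨β, hβ, rfl⟩ := Finset.mem_image.1 ht
          rw [Finset.mem_filter] at hβ
          have := H _ (Or.inr ⟨(β, α), ⟨⟨hβ.1, hα⟩, hβ.2, hg⟩, rfl⟩)
          simp only [LinearMap.sub_apply, LinearMap.smul_apply, smul_eq_mul] at this
          rw [le_div_iff₀ hg, div_mul_eq_mul_div, div_le_iff_of_neg hβ.2]
          linarith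
      rw [le_div_iff₀ hg] at h2
      linarith

/-- A finitely generated cone is the intersection of finitely many half-spaces. -/
lemma exists_dual_of_hull [FiniteDimensional ℝ V] (s : Finset V) :
    ∃ A : Finset (Dual ℝ V), ∀ x, x ∈ PointedCone.hull ℝ (s : Set V) ↔ ∀ α ∈ A, 0 ≤ α x := by
  classical
  induction s using Finset.induction_on with
  | empty =>
    let b := Module.finBasis ℝ V
    refine ⟨Finset.univ.image b.coord ∪ Finset.univ.image fun i => -b.coord i, fun x => ?_⟩
    rw [Finset.coe_empty, PointedCone.hull, Submodule.span_empty, Submodule.mem_bot]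
    constructor
    · rintro rfl α _
      rw [map_zero]
    · intro H
      refine b.ext_elem fun i => ?_
      have h1 := H (b.coord i) (by simp)
      have h2 := H (-b.coord i) (by simp)
      rw [LinearMap.neg_apply] at h2
      simp only [Basis.coord_apply] at h1 h2
      rw [map_zero, Finsupp.zero_apply]
      linarith
  | insert g s _ ih =>
    obtain ⟨A, hA⟩ := ih
    obtain ⟨A', hA'⟩ := exists_dual_of_insert A g
    refine ⟨A', fun x => ?_⟩
    rw [← hA', Finset.coe_insert, PointedCone.hull, Submodule.mem_span_insert]
    constructor
    · rintro ⟨t, z, hz, rfl⟩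
      refine ⟨t, t.2, (hA _).1 ?_⟩
      have : (t • g + z - (t : ℝ) • g) = z := add_sub_cancel_left _ _
      rw [this]
      exact hz
    · rintro ⟨t, ht, H⟩
      refine ⟨⟨t, ht⟩, x - t • g, (hA _).2 H, ?_⟩
      change x = t • g + (x - t • g)
      abel

/-- The relative interior of a cone: the points in no proper face. -/
def relInt (σ : PointedCone ℝ V) : Set V :=
  {x | x ∈ σ ∧ ∀ α : Dual ℝ V, (∀ y ∈ σ, 0 ≤ α y) → α x = 0 → ∀ y ∈ σ, α y = 0}

lemma smul_mem_cone {σ : PointedCone ℝ V} {t : ℝ} (ht : 0 ≤ t) {x : V} (hx : x ∈ σ) : t • x ∈ σ :=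
  σ.smul_mem ht hx

lemma add_mem_relInt {σ : PointedCone ℝ V} {x y : V} (hx : x ∈ σ) (hy : y ∈ relInt σ) {s t : ℝ}
    (hs : 0 ≤ s) (ht : 0 < t) : s • x + t • y ∈ relInt σ := by
  refine ⟨σ.add_mem (smul_mem_cone hs hx) (smul_mem_cone ht.le hy.1), fun α hα h => hy.2 α hα ?_⟩
  rw [map_add, map_smul, map_smul, smul_eq_mul, smul_eq_mul] at h
  have h1 := mul_nonneg hs (hα x hx)
  have h2 := mul_nonneg ht.le (hα y hy.1)
  exact (mul_eq_zero.1 (show t * α y = 0 by linarith)).resolve_left ht.ne'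

/-- Inequalities that vanish identically on `σ` are absorbed by the span, and the others become
strict. Conversely, where these are strict one can move a little in the direction `-y` without
leaving `σ`, so a functional nonnegative on `σ` and zero at `x` vanishes at `y`. -/
lemma relInt_eq {σ : PointedCone ℝ V} {A : Finset (Dual ℝ V)}
    (hA : ∀ x, x ∈ σ ↔ ∀ α ∈ A, 0 ≤ α x) : ∃ A' : Finset (Dual ℝ V),
      relInt σ = {x | x ∈ Submodule.span ℝ (σ : Set V) ∧ ∀ α ∈ A', 0 < α x} := by
  classical
  refine ⟨A.filter fun α => ∃ y ∈ σ, α y ≠ 0, ?_⟩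
  ext x
  simp only [Set.mem_ofPred_eq, Finset.mem_filter, relInt]
  constructor
  · rintro ⟨hx, H⟩
    refine ⟨Submodule.subset_span hx, ?_⟩
    rintro α ⟨hα, y, hy, hne⟩
    refine lt_of_le_of_ne ((hA x).1 hx α hα) fun h => hne (H α (fun z hz => (hA z).1 hz α hα) h.symm y hy)
  · rintro ⟨hx, H⟩
    have hspan : ∀ α ∈ A, ¬ (∃ y ∈ σ, α y ≠ 0) → ∀ z ∈ Submodule.span ℝ (σ : Set V), α z = 0 := by
      intro α hα hne z hz
      push Not at hne
      exact (Submodule.span_le (p := LinearMap.ker α)).2 hne hz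
    have hσ : ∀ z ∈ Submodule.span ℝ (σ : Set V),
        (∀ α ∈ A.filter (fun α => ∃ y ∈ σ, α y ≠ 0), 0 < α z) → z ∈ σ := by
      intro z hz hz'
      refine (hA z).2 fun α hα => ?_
      by_cases h : ∃ y ∈ σ, α y ≠ 0
      · exact (hz' α (Finset.mem_filter.2 ⟨hα, h⟩)).le
      · exact (hspan α hα h z hz).ge
    have H' : ∀ α ∈ A.filter (fun α => ∃ y ∈ σ, α y ≠ 0), 0 < α x := fun α hα =>
      H α (Finset.mem_filter.1 hα)
    refine ⟨hσ x hx H', fun β hβ hβx y hy => le_antisymm ?_ (hβ y hy)⟩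
    obtain ⟨δ, hδ, Hδ⟩ := exists_forall_pos _ H' (-y)
    have h1 := hβ _ (hσ (x + δ • -y) (Submodule.add_mem _ hx (Submodule.smul_mem _ _
      (Submodule.neg_mem _ (Submodule.subset_span hy)))) (Hδ δ hδ.le le_rfl))
    rw [map_add, hβx, map_smul, map_neg, smul_eq_mul, zero_add] at h1
    nlinarith

/-- For each defining inequality not identically zero on `σ`, a point where it is strict is added;
the sum makes all of them strict at once. -/
lemma relInt_nonempty {σ : PointedCone ℝ V} {A : Finset (Dual ℝ V)}
    (hA : ∀ x, x ∈ σ ↔ ∀ α ∈ A, 0 ≤ α x) : (relInt σ).Nonempty := by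
  classical
  have key : ∀ B : Finset (Dual ℝ V), B ⊆ A → ∃ x ∈ σ, ∀ α ∈ B, α x = 0 → ∀ y ∈ σ, α y = 0 := by
    intro B
    induction B using Finset.induction_on with
    | empty => exact fun _ => ⟨0, σ.zero_mem, by simp⟩
    | insert β B _ ih =>
      intro hB
      obtain ⟨x, hx, H⟩ := ih fun α hα => hB (Finset.mem_insert_of_mem hα)
      have hnn : ∀ α ∈ insert β B, ∀ y ∈ σ, 0 ≤ α y := fun α hα y hy => (hA y).1 hy α (hB hα)
      by_cases h : ∃ z ∈ σ, β z ≠ 0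
      · obtain ⟨z, hz, hne⟩ := h
        refine ⟨x + z, σ.add_mem hx hz, fun α hα h0 => ?_⟩
        have h1 := hnn α hα x hx
        have h2 := hnn α hα z hz
        rw [map_add] at h0
        rcases Finset.mem_insert.1 hα with rfl | hα
        · exact absurd (by linarith) hne
        · exact H α hα (by linarith)
      · push Not at h
        refine ⟨x, hx, fun α hα h0 => ?_⟩
        rcases Finset.mem_insert.1 hα with rfl | hα
        · exact h
        · exact H α hα h0
  obtain ⟨x, hx, H⟩ := key A subset_rfl
  refine ⟨x, hx, fun β hβ hβx y hy => le_antisymm ?_ (hβ y hy)⟩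
  have hpos : ∀ α ∈ A.filter (fun α => ∃ y ∈ σ, α y ≠ 0), 0 < α x := by
    intro α hα
    obtain ⟨hα, z, hz, hne⟩ := Finset.mem_filter.1 hα
    exact lt_of_le_of_ne ((hA x).1 hx α hα) fun h => hne (H α hα h.symm z hz)
  obtain ⟨δ, hδ, Hδ⟩ := exists_forall_pos _ hpos (-y)
  have hmem : x + δ • -y ∈ σ := by
    refine (hA _).2 fun α hα => ?_
    by_cases h : ∃ y ∈ σ, α y ≠ 0
    · exact (Hδ δ hδ.le le_rfl α (Finset.mem_filter.2 ⟨hα, h⟩)).le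
    · push Not at h
      rw [map_add, map_smul, map_neg, h x hx, h y hy]
      simp
  have h1 := hβ _ hmem
  rw [map_add, hβx, map_smul, map_neg, smul_eq_mul, zero_add] at h1
  nlinarith

end Polyhedral

/-! ### The cell decomposition induced by a complete fan around a cone -/

namespace Fan

open Module

variable {N : Type u} [AddCommGroup N] {Δ : Fan N}

/-- The intersection of the two cones is a face of `τ` that contains a point of its relative
interior, hence all of `τ`. -/
lemma le_of_mem_relInt {τ σ : Δ.Cone} {x : NReal N} (hx : x ∈ relInt τ.1) (hxσ : x ∈ σ.1) :
    τ ≤ σ := by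
  obtain ⟨u, hu, h⟩ := (Δ.inter_face τ.1 τ.2 σ.1 σ.2).1
  have h0 := hx.2 u hu ((h x).1 ⟨hx.1, hxσ⟩).2
  exact fun y hy => ((h y).2 ⟨hy, h0 y hy⟩).2

lemma eq_of_mem_relInt {τ σ : Δ.Cone} {x : NReal N} (hx : x ∈ relInt τ.1) (hxσ : x ∈ relInt σ.1) :
    τ = σ :=
  le_antisymm (le_of_mem_relInt hx hxσ.1) (le_of_mem_relInt hxσ hx.1)

/-- The cone is a minimal one among those containing `x`. A face of it through `x` is again a cone
of the fan, so by minimality it is not proper. -/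
lemma exists_mem_relInt (hΔ : Δ.IsComplete) (x : NReal N) : ∃ τ : Δ.Cone, x ∈ relInt τ.1 := by
  obtain ⟨σ, hσ, hx⟩ := hΔ x
  obtain ⟨τ, hτ⟩ := (Set.toFinite {τ : Δ.Cone | x ∈ τ.1}).exists_minimal ⟨⟨σ, hσ⟩, hx⟩
  refine ⟨τ, hτ.1, fun α hα h0 => ?_⟩
  let ρ : PointedCone ℝ (NReal N) :=
    { carrier := {y | y ∈ τ.1 ∧ α y = 0}
      add_mem' := fun ha hb => ⟨τ.1.add_mem ha.1 hb.1, by rw [map_add, ha.2, hb.2, add_zero]⟩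
      zero_mem' := ⟨τ.1.zero_mem, map_zero α⟩
      smul_mem' := fun c y hy => ⟨τ.1.smul_mem c.2 hy.1, by
        rw [← Nonneg.coe_smul, map_smul, hy.2, smul_zero]⟩ }
  have hρ : ρ ∈ Δ.cones := Δ.face_mem τ.1 τ.2 ρ ⟨α, hα, fun y => Iff.rfl⟩
  have hle : (⟨ρ, hρ⟩ : Δ.Cone) ≤ τ := fun y hy => hy.1
  have hge := hτ.2 (y := ⟨ρ, hρ⟩) ⟨hτ.1, h0⟩ hle
  exact fun y hy => (hge hy).2

instance : Fintype Δ.Cone := Fintype.ofFinite _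

open Classical in
/-- The cones containing `σ`. -/
def starFinset (σ : Δ.Cone) : Finset Δ.Cone := Finset.univ.filter fun τ => σ ≤ τ

@[simp] lemma mem_starFinset {σ τ : Δ.Cone} : τ ∈ starFinset σ ↔ σ ≤ τ := by
  simp [starFinset]

variable [Module.Finite ℤ N]

variable (Δ) in
lemma exists_dual (σ : Δ.Cone) : ∃ A : Finset (Dual ℝ (NReal N)), ∀ x, x ∈ σ.1 ↔ ∀ α ∈ A, 0 ≤ α x := by
  classical
  obtain ⟨s, hs⟩ := Δ.rational σ.1 σ.2
  obtain ⟨A, hA⟩ := exists_dual_of_hull (s.image fun v : N => (1 : ℝ) ⊗ₜ[ℤ] v)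
  refine ⟨A, fun x => ?_⟩
  rw [← hA, hs, Finset.coe_image]

/-- The inequalities defining a cone. -/
def ineqs (σ : Δ.Cone) : Finset (Dual ℝ (NReal N)) := (exists_dual Δ σ).choose

lemma mem_iff_ineqs (σ : Δ.Cone) (x : NReal N) : x ∈ σ.1 ↔ ∀ α ∈ ineqs σ, 0 ≤ α x :=
  (exists_dual Δ σ).choose_spec x

/-- A point in the relative interior of a cone. -/
def intPoint (σ : Δ.Cone) : NReal N := (relInt_nonempty (mem_iff_ineqs σ)).some

lemma intPoint_mem (σ : Δ.Cone) : intPoint σ ∈ relInt σ.1 :=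
  (relInt_nonempty (mem_iff_ineqs σ)).some_mem

/-- A cone not containing `σ` misses the chosen interior point of `σ`, so one of its defining
inequalities fails there; the negative of that functional belongs to `B`. -/
lemma exists_starNhd (σ : Δ.Cone) : ∃ B : Finset (Dual ℝ (NReal N)), (∀ β ∈ B, 0 < β (intPoint σ)) ∧
    ∀ τ : Δ.Cone, ¬ σ ≤ τ → ∃ β ∈ B, ∀ x ∈ τ.1, β x ≤ 0 := by
  classical
  have key : ∀ τ : Δ.Cone, ¬ σ ≤ τ → ∃ β : Dual ℝ (NReal N), 0 < β (intPoint σ) ∧ ∀ x ∈ τ.1, β x ≤ 0 := by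
    intro τ h
    have h1 : intPoint σ ∉ τ.1 := fun h' => h (le_of_mem_relInt (intPoint_mem σ) h')
    rw [mem_iff_ineqs] at h1
    push Not at h1
    obtain ⟨α, hα, h2⟩ := h1
    exact ⟨-α, by simpa using h2, fun x hx => by simpa using (mem_iff_ineqs τ x).1 hx α hα⟩
  choose! β h1 h2 using key
  refine ⟨(Finset.univ.filter fun τ : Δ.Cone => ¬ σ ≤ τ).image β, ?_, fun τ hτ =>
    ⟨β τ, Finset.mem_image_of_mem _ (by simpa using hτ), h2 τ hτ⟩⟩
  intro γ hγ
  obtain ⟨τ, hτ, rfl⟩ := Finset.mem_image.1 hγ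
  exact h1 τ (by simpa using hτ)

/-- An open convex neighbourhood of a point in the relative interior of `σ` which meets only the
cones containing `σ`. -/
def starNhd (σ : Δ.Cone) : Set (NReal N) := {x | ∀ β ∈ (exists_starNhd σ).choose, 0 < β x}

lemma isOpenConvex_starNhd (σ : Δ.Cone) : IsOpenConvex (starNhd σ) where
  convex := by
    intro x hx y hy a b ha hb hab β hβ
    have h1 := hx β hβ
    have h2 := hy β hβ
    rw [map_add, map_smul, map_smul, smul_eq_mul, smul_eq_mul]
    rcases ha.eq_or_lt with rfl | ha
    · rw [zero_add] at hab; subst hab; simpa using h2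
    · have := mul_pos ha h1
      have := mul_nonneg hb h2.le
      linarith
  isOpen := fun x hx v => exists_forall_pos _ hx v

lemma intPoint_mem_starNhd (σ : Δ.Cone) : intPoint σ ∈ starNhd σ :=
  (exists_starNhd σ).choose_spec.1

lemma le_of_mem_starNhd {σ τ : Δ.Cone} {x : NReal N} (hx : x ∈ starNhd σ) (hxτ : x ∈ τ.1) : σ ≤ τ := by
  by_contra h
  obtain ⟨β, hβ, H⟩ := (exists_starNhd σ).choose_spec.2 τ h
  exact absurd (hx β hβ) (H x hxτ).not_gt

/-- The part of the relative interior of `τ` close to the relative interior of `σ`. -/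
def starCell (σ τ : Δ.Cone) : Set (NReal N) := relInt τ.1 ∩ starNhd σ

lemma exists_add_smul_mem_starCell {σ τ : Δ.Cone} {x z : NReal N} (hx : x ∈ starNhd σ)
    (hxτ : x ∈ τ.1) (hz : z ∈ relInt τ.1) : ∃ δ > (0 : ℝ), x + δ • z ∈ starCell σ τ := by
  obtain ⟨δ, hδ, H⟩ := (isOpenConvex_starNhd σ).isOpen x hx z
  refine ⟨δ, hδ, ?_, H δ hδ.le le_rfl⟩
  simpa using add_mem_relInt hxτ hz zero_le_one hδ

lemma starCell_nonempty {σ τ : Δ.Cone} (h : σ ≤ τ) : (starCell σ τ).Nonempty := by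
  obtain ⟨δ, _, h1⟩ := exists_add_smul_mem_starCell (intPoint_mem_starNhd σ)
    (h (intPoint_mem σ).1) (intPoint_mem τ)
  exact ⟨_, h1⟩

lemma vectorSpan_starCell {σ τ : Δ.Cone} (h : σ ≤ τ) :
    vectorSpan ℝ (starCell σ τ) = coneSpan τ.1 := by
  refine le_antisymm (vectorSpan_le fun x hx y hy => Submodule.sub_mem _
    (Submodule.subset_span hy.1.1) (Submodule.subset_span hx.1.1)) (Submodule.span_le.2 fun z hz => ?_)
  obtain ⟨y, hy⟩ := starCell_nonempty h
  obtain ⟨δ, hδ, H⟩ := (isOpenConvex_starNhd σ).isOpen y hy.2 z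
  have h1 : y + δ • z ∈ starCell σ τ := by
    refine ⟨?_, H δ hδ.le le_rfl⟩
    have := add_mem_relInt hz hy.1 hδ.le one_pos
    rwa [one_smul, add_comm] at this
  have := sub_mem_vectorSpan hy h1
  rw [add_sub_cancel_left] at this
  exact (Submodule.smul_mem_iff _ hδ.ne').1 this

lemma adheres_starCell {σ τ τ' : Δ.Cone} (h : τ ≤ τ') : Adheres (starCell σ τ) (starCell σ τ') := by
  intro x hx y hy t h0 h1
  refine ⟨?_, (isOpenConvex_starNhd σ).convex.add_smul_sub_mem hx.2 hy.2 ⟨h0.le, h1⟩⟩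
  have e : x + t • (y - x) = (1 - t) • x + t • y := by module
  rw [e]
  exact add_mem_relInt (h hx.1.1) hy.1 (by linarith) h0

lemma le_of_segment {τ τ' : Δ.Cone} {x y : NReal N} (hx : x ∈ relInt τ.1)
    (H : ∀ t : ℝ, 0 < t → t ≤ 1 → x + t • (y - x) ∈ τ'.1) : τ ≤ τ' := by
  refine le_of_mem_relInt hx ((mem_iff_ineqs τ' x).2 fun α hα => ?_)
  by_contra! hneg
  obtain ⟨δ, hδ, h⟩ := exists_forall_pos {-α} (x := x) (by simpa using hneg) (y - x)
  have h1 := (mem_iff_ineqs τ' _).1 (H (min δ 1) (lt_min hδ one_pos) (min_le_right _ _)) α hα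
  have h2 := h (min δ 1) (le_min hδ.le zero_le_one) (min_le_left _ _) (-α) (by simp)
  rw [LinearMap.neg_apply] at h2
  linarith

lemma le_of_adheres_starCell {σ τ τ' : Δ.Cone} (hτ : σ ≤ τ) (hτ' : σ ≤ τ')
    (h : Adheres (starCell σ τ) (starCell σ τ')) : τ ≤ τ' := by
  obtain ⟨x, hx⟩ := starCell_nonempty hτ
  obtain ⟨y, hy⟩ := starCell_nonempty hτ'
  exact le_of_segment hx.1 fun t h0 h1 => (h x hx y hy t h0 h1).1.1

lemma starCell_injective {σ τ τ' : Δ.Cone} (hτ : σ ≤ τ) (h : starCell σ τ = starCell σ τ') :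
    τ = τ' := by
  obtain ⟨x, hx⟩ := starCell_nonempty hτ
  exact eq_of_mem_relInt hx.1 (h ▸ hx : x ∈ starCell σ τ').1

open Classical in
/-- The decomposition of the neighbourhood of a point of `σ` induced by the fan. -/
def starDecomp (σ : Δ.Cone) : Finset (Set (NReal N)) := (starFinset σ).image (starCell σ)

lemma mem_starDecomp {σ : Δ.Cone} {c : Set (NReal N)} :
    c ∈ starDecomp σ ↔ ∃ τ, σ ≤ τ ∧ starCell σ τ = c := by
  simp [starDecomp]

lemma isDecomp_starDecomp (hΔ : Δ.IsComplete) (σ : Δ.Cone) : IsDecomp (starNhd σ) (starDecomp σ) where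
  cell := by
    intro c hc
    obtain ⟨τ, hτ, rfl⟩ := mem_starDecomp.1 hc
    obtain ⟨A, hA⟩ := relInt_eq (mem_iff_ineqs τ)
    refine ⟨starCell_nonempty hτ, coneSpan τ.1, A, ?_⟩
    unfold starCell
    rw [hA]
    ext x
    simp only [Set.mem_inter_iff, Set.mem_ofPred_eq]
    tauto
  disj := by
    intro c hc c' hc' x hx hx'
    obtain ⟨τ, hτ, rfl⟩ := mem_starDecomp.1 hc
    obtain ⟨τ', hτ', rfl⟩ := mem_starDecomp.1 hc'
    rw [eq_of_mem_relInt hx.1 hx'.1]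
  cover := by
    intro x hx
    obtain ⟨τ, hτ⟩ := exists_mem_relInt hΔ x
    exact ⟨_, mem_starDecomp.2 ⟨τ, le_of_mem_starNhd hx hτ.1, rfl⟩, hτ, hx⟩
  frontier := by
    intro c hc c' hc' x hx y hy H
    obtain ⟨τ, hτ, rfl⟩ := mem_starDecomp.1 hc
    obtain ⟨τ', hτ', rfl⟩ := mem_starDecomp.1 hc'
    exact adheres_starCell (le_of_segment hx.1 fun t h0 h1 => (H t h0 h1).1.1)

/-- The signs of all defining inequalities decide which cones contain a point, and hence which cone
has the point in its relative interior. So these functionals separate the cells. -/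
theorem isCellResolution_starDecomp (R : Type*) [CommRing R] (hΔ : Δ.IsComplete) (σ : Δ.Cone) :
    IsCellResolution R (starDecomp σ) := by
  refine (isDecomp_starDecomp hΔ σ).isCellResolution (isOpenConvex_starNhd σ)
    ⟨_, intPoint_mem_starNhd σ⟩ (Finset.univ.toList.flatMap fun τ : Δ.Cone => (ineqs τ).toList)
    fun c hc c' hc' x hx y hy H => ?_
  obtain ⟨τ, hτ, rfl⟩ := mem_starDecomp.1 hc
  obtain ⟨τ', hτ', rfl⟩ := mem_starDecomp.1 hc'
  have key : ∀ ρ : Δ.Cone, x ∈ ρ.1 ↔ y ∈ ρ.1 := by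
    intro ρ
    rw [mem_iff_ineqs, mem_iff_ineqs]
    refine forall₂_congr fun α hα => ?_
    have := H α (by simpa using ⟨_, _, hα⟩)
    rw [← sign_nonneg_iff, this, sign_nonneg_iff]
  rw [le_antisymm (le_of_mem_relInt hx.1 ((key τ').2 hy.1.1))
    (le_of_mem_relInt hy.1 ((key τ).1 hx.1.1))]

end Fan

end

end ToricRes

namespace ToricRes

noncomputable section

/-! ### Incidence signs of oriented cones and incidence numbers of cells -/

section OrientationSign

open Module

variable {E : Type*} [AddCommGroup E] [Module ℝ E] {ι : Type*} [Fintype ι] [DecidableEq ι]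

/-- The sign of an orientation relative to a basis. -/
def oriSign (b : Basis ι ℝ E) (x : Orientation ℝ E ι) : ℤ :=
  open Classical in if x = b.orientation then 1 else -1

lemma oriSign_mul_self (b : Basis ι ℝ E) (x : Orientation ℝ E ι) : oriSign b x * oriSign b x = 1 := by
  unfold oriSign; split_ifs <;> rfl

lemma oriSign_injective (b : Basis ι ℝ E) : Function.Injective (oriSign b) := by
  intro x y h
  unfold oriSign at h
  rcases b.orientation_eq_or_eq_neg x with rfl | rfl <;>
    rcases b.orientation_eq_or_eq_neg y with rfl | rfl
  all_goals simp_all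

lemma oriSign_rayOfNeZero (b : Basis ι ℝ E) (ω : E [⋀^ι]→ₗ[ℝ] ℝ) (hω : ω ≠ 0) :
    oriSign b (rayOfNeZero ℝ ω hω) = SignType.sign (ω b) := by
  have h1 : ω = ω b • b.det := AlternatingMap.eq_smul_basis_det b ω
  have h0 : ω b ≠ 0 := fun h => hω (by rw [h1, h, zero_smul])
  have key : rayOfNeZero ℝ ω hω = b.orientation ↔ 0 < ω b := by
    rw [Basis.orientation, ray_eq_iff]
    nth_rewrite 1 [h1]
    exact sameRay_smul_left_iff_of_ne b.det_ne_zero h0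
  unfold oriSign
  rcases lt_or_gt_of_ne h0 with h | h
  · rw [if_neg (fun h' => absurd (key.1 h') h.not_gt), sign_neg h]; rfl
  · rw [if_pos (key.2 h), sign_pos h]; rfl

lemma oriSign_reindex {ι' : Type*} [Fintype ι'] [DecidableEq ι'] (b : Basis ι ℝ E) (e : ι ≃ ι')
    (x : Orientation ℝ E ι) : oriSign (b.reindex e) (Orientation.reindex ℝ E e x) = oriSign b x := by
  unfold oriSign
  rw [b.orientation_reindex e, (Orientation.reindex ℝ E e).injective.eq_iff]

end OrientationSign

namespace Fan

open Module

variable {N : Type u} [AddCommGroup N] {Δ : Fan N}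

lemma covers_coneSpan {τ ρ : Δ.Cone} (h : τ ≤ ρ) (hdim : coneDim ρ.1 = coneDim τ.1 + 1) :
    Covers (coneSpan τ.1) (coneSpan ρ.1) :=
  ⟨Submodule.span_mono h, hdim⟩

lemma eq_of_mem_relInt_of_mem_coneSpan {τ ρ : Δ.Cone} (h : τ ≤ ρ) {z : NReal N} (hz : z ∈ relInt ρ.1)
    (hzτ : z ∈ coneSpan τ.1) : τ = ρ := by
  obtain ⟨u, hu, hτ⟩ := isFace_of_le h
  have h0 : u z = 0 := (Submodule.span_le (p := LinearMap.ker u)).2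
    (fun y hy => ((hτ y).1 hy).2) hzτ
  exact le_antisymm h fun y hy => (hτ y).2 ⟨hy, hz.2 u hu h0 y hy⟩

variable [Module.Finite ℤ N]

/-- A cone lies on one side of the span of its facet. Were the two coefficients of opposite signs,
`|b| • w + |a| • y` would be a relative interior point of `ρ` with coefficient zero, hence in the
span of `τ`, which forces `τ = ρ`. -/
lemma volCoeff_pos_of_mem_relInt {τ ρ : Δ.Cone} (h : τ ≤ ρ) (hdim : coneDim ρ.1 = coneDim τ.1 + 1)
    {w y : NReal N} (hw : w ∈ ρ.1) (hy : y ∈ relInt ρ.1) :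
    0 ≤ volCoeff (coneSpan τ.1) (coneSpan ρ.1) w * volCoeff (coneSpan τ.1) (coneSpan ρ.1) y := by
  have hcov := covers_coneSpan h hdim
  have hwM : w ∈ coneSpan ρ.1 := Submodule.subset_span hw
  have hyM : y ∈ coneSpan ρ.1 := Submodule.subset_span hy.1
  by_contra! hneg
  set a := volCoeff (coneSpan τ.1) (coneSpan ρ.1) w with ha
  set b := volCoeff (coneSpan τ.1) (coneSpan ρ.1) y with hb
  have hz : |b| • w + |a| • y ∈ relInt ρ.1 :=
    add_mem_relInt hw hy (abs_nonneg _) (abs_pos.2 fun h0 => by simp [h0] at hneg)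
  have hvz : volCoeff (coneSpan τ.1) (coneSpan ρ.1) (|b| • w + |a| • y) = 0 := by
    rw [volCoeff_add hcov (Submodule.smul_mem _ _ hwM) (Submodule.smul_mem _ _ hyM),
      volCoeff_smul hcov hwM, volCoeff_smul hcov hyM, ← ha, ← hb]
    rcases mul_neg_iff.1 hneg with ⟨h1, h2⟩ | ⟨h1, h2⟩
    · rw [abs_of_pos h1, abs_of_neg h2]; ring
    · rw [abs_of_neg h1, abs_of_pos h2]; ring
  have hmem : |b| • w + |a| • y ∈ coneSpan τ.1 := by
    by_contra h0
    exact volCoeff_ne_zero hcov (Submodule.subset_span hz.1) h0 hvz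
  rw [eq_of_mem_relInt_of_mem_coneSpan h hz hmem] at hdim
  omega

/-- The incidence number uses a difference `y - x` of points of the cells, but `x` lies in the span
of `τ` and does not affect the coefficient. Any vector of `ρ` with nonzero coefficient gives the
same sign as `y`. -/
lemma incid_starCell (hΔ : Δ.IsComplete) {σ τ ρ : Δ.Cone} (hτ : σ ≤ τ) (h : τ ≤ ρ)
    (hdim : coneDim ρ.1 = coneDim τ.1 + 1) {w : NReal N} (hw : w ∈ ρ.1)
    (hne : volCoeff (coneSpan τ.1) (coneSpan ρ.1) w ≠ 0) :
    incid (starCell σ τ) (starCell σ ρ) =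
      SignType.sign (volCoeff (coneSpan τ.1) (coneSpan ρ.1) w) := by
  have hcov := covers_coneSpan h hdim
  obtain ⟨x, hx⟩ := starCell_nonempty hτ
  obtain ⟨y, hy⟩ := starCell_nonempty (hτ.trans h)
  have hxL : x ∈ coneSpan τ.1 := Submodule.subset_span hx.1.1
  have hyM : y ∈ coneSpan ρ.1 := Submodule.subset_span hy.1.1
  have hvy : volCoeff (coneSpan τ.1) (coneSpan ρ.1) (y - x) =
      volCoeff (coneSpan τ.1) (coneSpan ρ.1) y := by
    rw [sub_eq_add_neg, volCoeff_add hcov hyM (Submodule.neg_mem _ (hcov.1 hxL)),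
      volCoeff_eq_zero_of_mem (Submodule.neg_mem _ hxL), add_zero]
  rw [(isDecomp_starDecomp hΔ σ).incid_eq (isOpenConvex_starNhd σ) (mem_starDecomp.2 ⟨τ, hτ, rfl⟩)
    (mem_starDecomp.2 ⟨ρ, hτ.trans h, rfl⟩) (adheres_starCell h)
    (by rwa [vectorSpan_starCell hτ, vectorSpan_starCell (hτ.trans h)]) hx hy,
    vectorSpan_starCell hτ, vectorSpan_starCell (hτ.trans h), hvy]
  have h1 := volCoeff_pos_of_mem_relInt h hdim hw hy.1
  have h2 : volCoeff (coneSpan τ.1) (coneSpan ρ.1) y ≠ 0 := by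
    refine volCoeff_ne_zero hcov hyM fun hyL => ?_
    rw [eq_of_mem_relInt_of_mem_coneSpan h hy.1 hyL] at hdim
    omega
  have h3 := lt_of_le_of_ne h1 (mul_ne_zero hne h2).symm
  rcases mul_pos_iff.1 h3 with ⟨h4, h5⟩ | ⟨h4, h5⟩
  · rw [sign_pos h4, sign_pos h5]
  · rw [sign_neg h4, sign_neg h5]

/-- The sign comparing the orientation of a cone to the basis of `ℝτ` used for the volume
element. -/
def oSign (o : Δ.Orientation) (τ : Δ.Cone) : ℤ := oriSign (finBasis ℝ (coneSpan τ.1)) (o τ)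

lemma curryLeft_apply_finBasis {L M : Submodule ℝ (NReal N)} (hcov : Covers L M)
    (ω : M [⋀^Fin (finrank ℝ L + 1)]→ₗ[ℝ] ℝ) (w : M) :
    (ω.curryLeft w).compLinearMap (Submodule.inclusion hcov.1) (finBasis ℝ L) =
      ω ((finBasis ℝ M).reindex (finCongr hcov.2)) * volCoeff L M w.1 := by
  rw [volCoeff_eq_det hcov w.2]
  have := congrArg (fun φ => φ (Fin.cons w fun i => Submodule.inclusion hcov.1 (finBasis ℝ L i)))
    (AlternatingMap.eq_smul_basis_det ((finBasis ℝ M).reindex (finCongr hcov.2)) ω)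
  exact this

lemma oriSign_curryLeft {L M : Submodule ℝ (NReal N)} (hcov : Covers L M)
    (ω : M [⋀^Fin (finrank ℝ L + 1)]→ₗ[ℝ] ℝ) (hω : ω ≠ 0) (w : M)
    (hη : (ω.curryLeft w).compLinearMap (Submodule.inclusion hcov.1) ≠ 0) :
    volCoeff L M w.1 ≠ 0 ∧ oriSign (finBasis ℝ L) (rayOfNeZero ℝ _ hη) =
      oriSign ((finBasis ℝ M).reindex (finCongr hcov.2)) (rayOfNeZero ℝ ω hω) *
        SignType.sign (volCoeff L M w.1) := by
  have h1 := curryLeft_apply_finBasis hcov ω w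
  constructor
  · intro h0
    rw [h0, mul_zero] at h1
    refine hη ?_
    rw [AlternatingMap.eq_smul_basis_det (finBasis ℝ L)
      ((ω.curryLeft w).compLinearMap (Submodule.inclusion hcov.1)), h1, zero_smul]
  · rw [oriSign_rayOfNeZero, oriSign_rayOfNeZero, h1, sign_mul]
    push_cast
    rfl

lemma exists_rayOfNeZero {L M : Submodule ℝ (NReal N)} (hcov : Covers L M)
    (x : _root_.Orientation ℝ M (Fin (finrank ℝ L + 1))) (w : M) (hw : volCoeff L M w.1 ≠ 0) :
    ∃ (ω : M [⋀^Fin (finrank ℝ L + 1)]→ₗ[ℝ] ℝ) (hω : ω ≠ 0), x = rayOfNeZero ℝ ω hω ∧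
      (ω.curryLeft w).compLinearMap (Submodule.inclusion hcov.1) ≠ 0 := by
  let b := (finBasis ℝ M).reindex (finCongr hcov.2)
  obtain ⟨ω, hω, hω'⟩ : ∃ ω, ∃ hω : ω ≠ 0, x = rayOfNeZero ℝ ω hω := by
    rcases b.orientation_eq_or_eq_neg x with h1 | h1
    · exact ⟨b.det, b.det_ne_zero, h1⟩
    · exact ⟨-b.det, neg_ne_zero.2 b.det_ne_zero, h1⟩
  refine ⟨ω, hω, hω', fun h1 => ?_⟩
  have hωb : ω b ≠ 0 := fun h1 => hω (by
    rw [AlternatingMap.eq_smul_basis_det b ω, h1, zero_smul])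
  have h2 := curryLeft_apply_finBasis hcov ω w
  have h3 := congrArg (fun φ => φ (finBasis ℝ L)) h1
  exact mul_ne_zero hωb hw (h2.symm.trans h3)

/-- Contracting a form with `w` multiplies its sign, measured in the fixed bases, by the sign of
`volCoeff` at `w`. For `w ∈ ρ` this is the incidence number, whichever admissible `w` is chosen. -/
lemma coincide_iff (hΔ : Δ.IsComplete) (o : Δ.Orientation) {σ τ ρ : Δ.Cone} (hτ : σ ≤ τ) (h : τ ≤ ρ)
    (hdim : coneDim ρ.1 = coneDim τ.1 + 1) :
    o.Coincide τ ρ ↔ oSign o τ = oSign o ρ * incid (starCell σ τ) (starCell σ ρ) := by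
  have hcov := covers_coneSpan h hdim
  have hs : oSign o ρ = oriSign ((finBasis ℝ (coneSpan ρ.1)).reindex (finCongr hcov.2))
      (Orientation.reindex ℝ _ (finCongr hdim) (o ρ)) := (oriSign_reindex _ _ _).symm
  constructor
  · rintro ⟨hle, hdim', ω, hω, w, hη, hw, h1, h2⟩
    obtain ⟨h3, h4⟩ := oriSign_curryLeft hcov ω hω w hη
    rw [incid_starCell hΔ hτ h hdim hw h3, hs, h1]
    exact (congrArg (oriSign _) h2).trans h4
  · intro H
    obtain ⟨w, hw⟩ := starCell_nonempty (hτ.trans h)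
    have hwM : w ∈ coneSpan ρ.1 := Submodule.subset_span hw.1.1
    have h0 : volCoeff (coneSpan τ.1) (coneSpan ρ.1) w ≠ 0 := by
      refine volCoeff_ne_zero hcov hwM fun hyL => ?_
      rw [eq_of_mem_relInt_of_mem_coneSpan h hw.1 hyL] at hdim
      omega
    obtain ⟨ω, hω, hω', hη⟩ := exists_rayOfNeZero hcov
      (Orientation.reindex ℝ _ (finCongr hdim) (o ρ)) ⟨w, hwM⟩ h0
    refine ⟨hcov.1, hdim, ω, hω, ⟨w, hwM⟩, hη, hw.1.1, hω',
      oriSign_injective (finBasis ℝ (coneSpan τ.1)) ?_⟩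
    refine Eq.trans ?_ (oriSign_curryLeft hcov ω hω ⟨w, hwM⟩ hη).2.symm
    rw [incid_starCell hΔ hτ h hdim hw.1.1 h0, hs] at H
    exact H.trans (congrArg (fun x => oriSign _ x * _) hω')

/-- The sign of an incidence in terms of the incidence numbers of the cells around `σ`. -/
lemma sign_eq (hΔ : Δ.IsComplete) (o : Δ.Orientation) {σ τ ρ : Δ.Cone} (hτ : σ ≤ τ) (hρ : σ ≤ ρ) :
    o.sign τ ρ = oSign o τ * oSign o ρ * incid (starCell σ τ) (starCell σ ρ) := by
  unfold Orientation.sign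
  split_ifs with h1 h2
  · rw [(coincide_iff hΔ o hτ h1.1 h1.2).1 h2]
    have h3 := oriSign_mul_self (finBasis ℝ (coneSpan ρ.1)) (o ρ)
    have h4 := (isDecomp_starDecomp hΔ σ).incid_mul_self (isOpenConvex_starNhd σ)
      (mem_starDecomp.2 ⟨τ, hτ, rfl⟩) (mem_starDecomp.2 ⟨ρ, hρ, rfl⟩) (adheres_starCell h1.1)
      (by rw [vectorSpan_starCell hτ, vectorSpan_starCell hρ]; exact covers_coneSpan h1.1 h1.2)
    change oSign o ρ * oSign o ρ = 1 at h3
    linear_combination (-(incid (starCell σ τ) (starCell σ ρ) *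
      incid (starCell σ τ) (starCell σ ρ))) * h3 - h4
  · rw [coincide_iff hΔ o hτ h1.1 h1.2] at h2
    have h3 : oSign o ρ * oSign o ρ = 1 := oriSign_mul_self (finBasis ℝ (coneSpan ρ.1)) (o ρ)
    have h5 : oSign o τ * oSign o τ = 1 := oriSign_mul_self (finBasis ℝ (coneSpan τ.1)) (o τ)
    have h4 := (isDecomp_starDecomp hΔ σ).incid_mul_self (isOpenConvex_starNhd σ)
      (mem_starDecomp.2 ⟨τ, hτ, rfl⟩) (mem_starDecomp.2 ⟨ρ, hρ, rfl⟩) (adheres_starCell h1.1)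
      (by rw [vectorSpan_starCell hτ, vectorSpan_starCell hρ]; exact covers_coneSpan h1.1 h1.2)
    have h6 := Int.isUnit_iff.1 (IsUnit.of_mul_eq_one _ h3)
    have h7 := Int.isUnit_iff.1 (IsUnit.of_mul_eq_one _ h5)
    have h8 := Int.isUnit_iff.1 (IsUnit.of_mul_eq_one _ h4)
    rcases h6 with h6 | h6 <;> rcases h7 with h7 | h7 <;> rcases h8 with h8 | h8 <;>
      simp_all
  · rw [incid_eq_zero, mul_zero]
    intro h2 h3
    rw [vectorSpan_starCell hτ, vectorSpan_starCell hρ] at h3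
    exact h1 ⟨le_of_adheres_starCell hτ hρ h2, h3.2⟩

end Fan

end

end ToricRes

namespace ToricRes

noncomputable section

/-! ### Exactness of the combinatorial complex on the cones containing a given cone -/

namespace Fan

open Module

variable {N : Type u} [AddCommGroup N] {Δ : Fan N}

lemma sign_ne_zero {o : Δ.Orientation} {τ ρ : Δ.Cone} (h : o.sign τ ρ ≠ 0) :
    τ ≤ ρ ∧ coneDim ρ.1 = coneDim τ.1 + 1 := by
  by_contra h'
  exact h (if_neg h')

lemma sign_mul_self {o : Δ.Orientation} {τ ρ : Δ.Cone} (h : o.sign τ ρ ≠ 0) :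
    o.sign τ ρ * o.sign τ ρ = 1 := by
  unfold Orientation.sign at h ⊢
  rw [if_pos (not_not.1 fun h' => h (if_neg h'))]
  split_ifs <;> rfl

lemma HasCodim.eq {τ : Δ.Cone} {p q : ℕ} (h : HasCodim τ p) (h' : HasCodim τ q) : p = q := by
  unfold HasCodim at h h'; omega

lemma hasCodim_left {o : Δ.Orientation} {τ ρ : Δ.Cone} {p : ℕ} (h : o.sign τ ρ ≠ 0)
    (hρ : HasCodim ρ p) : HasCodim τ (p + 1) := by
  have := (sign_ne_zero h).2
  unfold HasCodim at hρ ⊢; omega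

lemma hasCodim_right {o : Δ.Orientation} {τ ρ : Δ.Cone} {p : ℕ} (h : o.sign τ ρ ≠ 0)
    (hτ : HasCodim τ (p + 1)) : HasCodim ρ p := by
  have := (sign_ne_zero h).2
  unfold HasCodim at hτ ⊢; omega

instance (σ : Δ.Cone) (p : ℕ) : Fintype (StarOfCodim σ p) := Fintype.ofFinite _

lemma sum_starFinset {R : Type*} [AddCommMonoid R] (σ : Δ.Cone) (p : ℕ) {F : Δ.Cone → R}
    (hF : ∀ τ, σ ≤ τ → ¬ HasCodim τ p → F τ = 0) :
    ∑ τ ∈ starFinset σ, F τ = ∑ τ : StarOfCodim σ p, F τ.1 := by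
  classical
  rw [← Finset.sum_filter_of_ne (p := fun τ => HasCodim τ p)
    fun τ hτ hne => not_not.1 fun h => hne (hF τ (mem_starFinset.1 hτ) h)]
  exact Finset.sum_subtype _ (fun τ => by simp) _

section Resolution

variable [Module.Finite ℤ N] {R : Type*} [CommRing R]

/-- Rescaling every cell by its sign `oSign` turns the cellular differential into the one given by
the signs `ε`. -/
lemma cellD_extend (hΔ : Δ.IsComplete) (o : Δ.Orientation) (σ : Δ.Cone) (f : Set (NReal N) → R)
    {ρ : Δ.Cone} (hρ : σ ≤ ρ) : cellD (starDecomp σ) f (starCell σ ρ) =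
      oSign o ρ * ∑ τ ∈ starFinset σ, oSign o τ * f (starCell σ τ) * (o.sign τ ρ : R) := by
  unfold cellD starDecomp
  rw [Finset.sum_image fun τ hτ τ' _ h => starCell_injective (mem_starFinset.1 hτ) h, Finset.mul_sum]
  refine Finset.sum_congr rfl fun τ hτ => ?_
  rw [sign_eq hΔ o (mem_starFinset.1 hτ) hρ]
  have h1 : (oSign o τ * oSign o τ : R) = 1 := by
    exact_mod_cast congrArg (Int.cast : ℤ → R) (oriSign_mul_self (finBasis ℝ (coneSpan τ.1)) (o τ))
  have h2 : (oSign o ρ * oSign o ρ : R) = 1 := by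
    exact_mod_cast congrArg (Int.cast : ℤ → R) (oriSign_mul_self (finBasis ℝ (coneSpan ρ.1)) (o ρ))
  push_cast
  linear_combination (-f (starCell σ τ) * (incid (starCell σ τ) (starCell σ ρ) : R)) *
    (h1 * (oSign o ρ * oSign o ρ : R) + h2)

lemma exists_cell_function (σ : Δ.Cone) (g : Δ.Cone → R) :
    ∃ f : Set (NReal N) → R, ∀ τ, σ ≤ τ → f (starCell σ τ) = g τ := by
  refine ⟨Function.extend (fun τ : {τ : Δ.Cone // σ ≤ τ} => starCell σ τ.1) (fun τ => g τ.1) 0,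
    fun τ hτ => ?_⟩
  have hinj : Function.Injective fun τ : {τ : Δ.Cone // σ ≤ τ} => starCell σ τ.1 := fun τ τ' h =>
    Subtype.ext (starCell_injective τ.2 h)
  exact hinj.extend_apply _ _ (⟨τ, hτ⟩ : {τ : Δ.Cone // σ ≤ τ})

lemma sum_sign_mul_sign (hΔ : Δ.IsComplete) (o : Δ.Orientation) {σ τ κ : Δ.Cone} (hτ : σ ≤ τ)
    (hκ : σ ≤ κ) : ∑ ρ ∈ starFinset σ, o.sign τ ρ * o.sign ρ κ = 0 := by
  have h := (isDecomp_starDecomp hΔ σ).sum_incid_mul_incid (isOpenConvex_starNhd σ)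
    (mem_starDecomp.2 ⟨τ, hτ, rfl⟩) (mem_starDecomp.2 ⟨κ, hκ, rfl⟩)
  unfold starDecomp at h
  rw [Finset.sum_image fun τ hτ τ' _ h => starCell_injective (mem_starFinset.1 hτ) h] at h
  rw [← mul_zero (oSign o τ * oSign o κ), ← h, Finset.mul_sum]
  refine Finset.sum_congr rfl fun ρ hρ => ?_
  rw [sign_eq hΔ o hτ (mem_starFinset.1 hρ), sign_eq hΔ o (mem_starFinset.1 hρ) hκ]
  have h1 : oSign o ρ * oSign o ρ = 1 := oriSign_mul_self (finBasis ℝ (coneSpan ρ.1)) (o ρ)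
  linear_combination (oSign o τ * oSign o κ * incid (starCell σ τ) (starCell σ ρ) *
    incid (starCell σ ρ) (starCell σ κ)) * h1

variable [Module.Free ℤ N]

omit [Module.Finite ℤ N] in
lemma finrank_nReal : finrank ℝ (NReal N) = finrank ℤ N := Module.finrank_baseChange

lemma hasCodim_zero_iff {τ : Δ.Cone} : HasCodim τ 0 ↔ coneSpan τ.1 = ⊤ := by
  unfold HasCodim coneDim
  rw [add_zero, ← finrank_nReal]
  exact ⟨Submodule.eq_top_of_finrank_eq, fun h => by rw [h, finrank_top]⟩

/-- All cones of full dimension have the same span, hence the same chosen basis, and by coherence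
one form `ω` represents all their orientations. -/
lemma oSign_eq_of_hasCodim_zero {o : Δ.Orientation} (ho : o.IsCoherent) {τ τ' : Δ.Cone}
    (hτ : HasCodim τ 0) (hτ' : HasCodim τ' 0) : oSign o τ = oSign o τ' := by
  obtain ⟨ω, H⟩ := ho
  have key : ∀ (τ : Δ.Cone) (h : finrank ℝ (coneSpan τ.1) = finrank ℤ N), oSign o τ =
      SignType.sign (ω fun i => (finBasis ℝ (coneSpan τ.1) (finCongr h.symm i)).1) := by
    intro τ h
    obtain ⟨hω, h1⟩ := H τ h
    unfold oSign
    rw [h1]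
    exact oriSign_rayOfNeZero (finBasis ℝ (coneSpan τ.1)) _ hω
  -- The two spans are only provably equal, so the dependence of the basis on the subspace is
  -- removed by substituting one for the other.
  have key' : ∀ (L L' : Submodule ℝ (NReal N)) (h : finrank ℝ L = finrank ℤ N)
      (h' : finrank ℝ L' = finrank ℤ N), L = L' →
      (ω fun i => (finBasis ℝ L (finCongr h.symm i)).1) =
        ω fun i => (finBasis ℝ L' (finCongr h'.symm i)).1 := by
    rintro L _ h h' rfl; rfl
  rw [key τ hτ, key τ' hτ', key' _ _ hτ hτ'
    ((hasCodim_zero_iff.1 hτ).trans (hasCodim_zero_iff.1 hτ').symm)]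

variable (hΔ : Δ.IsComplete) {o : Δ.Orientation} (ho : o.IsCoherent)

include hΔ

lemma exists_hasCodim_zero (σ : Δ.Cone) : ∃ τ, σ ≤ τ ∧ HasCodim τ 0 := by
  obtain ⟨c, hc, h⟩ := (isCellResolution_starDecomp ℤ hΔ σ).exists_open
  obtain ⟨τ, hτ, rfl⟩ := mem_starDecomp.1 hc
  rw [vectorSpan_starCell hτ] at h
  exact ⟨τ, hτ, hasCodim_zero_iff.2 h⟩

include ho

-- The sign `oSign` is the same on all maximal cones, so summing the rescaled coefficients gives the
-- cellular augmentation up to this common sign.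
omit hΔ in
lemma cellAug_starDecomp (σ : Δ.Cone) (f : Set (NReal N) → R) {τ₀ : Δ.Cone} (hτ₀ : HasCodim τ₀ 0) :
    cellAug (starDecomp σ) f =
      oSign o τ₀ * ∑ τ : StarOfCodim σ 0, oSign o τ.1 * f (starCell σ τ.1) := by
  classical
  unfold cellAug starDecomp
  rw [Finset.sum_image fun τ hτ τ' _ h => starCell_injective (mem_starFinset.1 hτ) h,
    sum_starFinset σ 0 fun τ hτ h => by
      rw [vectorSpan_starCell hτ, if_neg fun h' => h (hasCodim_zero_iff.2 h')], Finset.mul_sum]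
  refine Finset.sum_congr rfl fun τ _ => ?_
  rw [vectorSpan_starCell τ.2.1, if_pos (hasCodim_zero_iff.1 τ.2.2),
    oSign_eq_of_hasCodim_zero ho τ.2.2 hτ₀, ← mul_assoc]
  have h1 : (oSign o τ₀ * oSign o τ₀ : R) = 1 := by
    exact_mod_cast congrArg (Int.cast : ℤ → R) (oriSign_mul_self (finBasis ℝ (coneSpan τ₀.1)) (o τ₀))
  rw [h1, one_mul]

/-- Exactness for all codimensions at once, carried over from `isCellResolution_starDecomp` by the
rescaling. -/
lemma exists_sum_sign (σ : Δ.Cone) (g : Δ.Cone → R)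
    (h : ∀ ρ, σ ≤ ρ → ∑ τ ∈ starFinset σ, g τ * (o.sign τ ρ : R) = 0)
    (h0 : ∑ τ : StarOfCodim σ 0, g τ.1 = 0) :
    ∃ y : Δ.Cone → R, ∀ ρ, σ ≤ ρ → g ρ = ∑ τ ∈ starFinset σ, y τ * (o.sign τ ρ : R) := by
  have hs : ∀ τ : Δ.Cone, (oSign o τ * oSign o τ : R) = 1 := fun τ => by
    exact_mod_cast congrArg (Int.cast : ℤ → R) (oriSign_mul_self (finBasis ℝ (coneSpan τ.1)) (o τ))
  obtain ⟨f, hf⟩ := exists_cell_function σ fun τ => (oSign o τ : R) * g τ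
  have hg : ∀ τ, σ ≤ τ → (oSign o τ : R) * f (starCell σ τ) = g τ := fun τ hτ => by
    rw [hf τ hτ, ← mul_assoc, hs, one_mul]
  obtain ⟨τ₀, _, hτ₀⟩ := exists_hasCodim_zero hΔ σ
  obtain ⟨y, hy⟩ := (isCellResolution_starDecomp R hΔ σ).exact f (by
    intro c hc
    obtain ⟨ρ, hρ, rfl⟩ := mem_starDecomp.1 hc
    rw [cellD_extend hΔ o σ f hρ, ← mul_zero (oSign o ρ : R), ← h ρ hρ]
    congr 1
    exact Finset.sum_congr rfl fun τ hτ => by rw [hg τ (mem_starFinset.1 hτ)]) (by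
    rw [cellAug_starDecomp ho σ f hτ₀, ← mul_zero (oSign o τ₀ : R), ← h0]
    congr 1
    exact Finset.sum_congr rfl fun τ _ => hg τ.1 τ.2.1)
  refine ⟨fun τ => oSign o τ * y (starCell σ τ), fun ρ hρ => ?_⟩
  rw [← hg ρ hρ, hy _ (mem_starDecomp.2 ⟨ρ, hρ, rfl⟩), cellD_extend hΔ o σ y hρ, ← mul_assoc, hs,
    one_mul]

lemma sum_sum_sign (σ : Δ.Cone) (g : Δ.Cone → R) :
    ∑ ρ : StarOfCodim σ 0, ∑ τ ∈ starFinset σ, g τ * (o.sign τ ρ.1 : R) = 0 := by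
  have hs : ∀ τ : Δ.Cone, (oSign o τ * oSign o τ : R) = 1 := fun τ => by
    exact_mod_cast congrArg (Int.cast : ℤ → R) (oriSign_mul_self (finBasis ℝ (coneSpan τ.1)) (o τ))
  obtain ⟨f, hf⟩ := exists_cell_function σ fun τ => (oSign o τ : R) * g τ
  have hg : ∀ τ, σ ≤ τ → (oSign o τ : R) * f (starCell σ τ) = g τ := fun τ hτ => by
    rw [hf τ hτ, ← mul_assoc, hs, one_mul]
  obtain ⟨τ₀, _, hτ₀⟩ := exists_hasCodim_zero hΔ σ
  have h := (isCellResolution_starDecomp R hΔ σ).aug_d f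
  rw [cellAug_starDecomp ho σ _ hτ₀] at h
  have h' := congrArg (fun x => (oSign o τ₀ : R) * x) h
  simp only [mul_zero, ← mul_assoc, hs, one_mul] at h'
  rw [← h']
  refine Finset.sum_congr rfl fun ρ _ => ?_
  rw [cellD_extend hΔ o σ f ρ.2.1, ← mul_assoc, hs, one_mul]
  exact Finset.sum_congr rfl fun τ hτ => by rw [hg τ (mem_starFinset.1 hτ)]

/-- Every cone of positive codimension is a facet of another cone. -/
lemma exists_sign_ne_zero {τ : Δ.Cone} {p : ℕ} (hτ : HasCodim τ (p + 1)) :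
    ∃ ρ, o.sign τ ρ ≠ 0 := by
  classical
  by_contra! H
  -- If `τ` were a facet of no cone, its indicator would be a cycle of augmentation zero around `τ`,
  -- hence a boundary of a chain on cones `ρ ≥ τ`. No such cone has `τ` as a cone of larger
  -- dimension containing it.
  obtain ⟨y, hy⟩ := exists_sum_sign (R := ℤ) hΔ ho τ (fun ρ => if ρ = τ then 1 else 0)
    (fun ρ _ => Finset.sum_eq_zero fun ρ' _ => by
      split_ifs with h
      · rw [h, H]; simp
      · rw [zero_mul])
    (Finset.sum_eq_zero fun ρ _ => if_neg fun h => by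
      have := HasCodim.eq hτ (h ▸ ρ.2.2)
      omega)
  have h := hy τ le_rfl
  rw [if_pos rfl, Finset.sum_eq_zero] at h
  · exact one_ne_zero h
  · intro ρ hρ
    by_contra hne
    have h0 : o.sign ρ τ ≠ 0 := fun h0 => hne (by rw [h0]; simp)
    obtain ⟨h1, h2⟩ := sign_ne_zero h0
    rw [le_antisymm h1 (mem_starFinset.1 hρ)] at h2
    omega

end Resolution

section Graded

variable {R : Type u} [CommRing R] {o : Δ.Orientation}

lemma starD_apply (σ : Δ.Cone) (p : ℕ) (x : StarChains R σ (p + 1)) (ρ : StarOfCodim σ p) :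
    starD R o σ p x ρ = ∑ τ, x τ * (o.sign τ.1 ρ.1 : R) := by
  unfold starD
  rw [Finsupp.linearCombination_apply, Finsupp.sum_fintype _ _ (by simp), Finsupp.finsetSum_apply]
  rfl

lemma starAug_apply (σ : Δ.Cone) (x : StarChains R σ 0) : starAug R σ x = ∑ τ, x τ := by
  unfold starAug
  rw [Finsupp.linearCombination_apply, Finsupp.sum_fintype _ _ (by simp)]
  simp

open Classical in
/-- A chain as a function on all cones. -/
def extendChain {σ : Δ.Cone} {p : ℕ} (x : StarChains R σ p) (τ : Δ.Cone) : R :=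
  if h : σ ≤ τ ∧ HasCodim τ p then x ⟨τ, h⟩ else 0

lemma extendChain_coe {σ : Δ.Cone} {p : ℕ} (x : StarChains R σ p) (τ : StarOfCodim σ p) :
    extendChain x τ.1 = x τ := dif_pos τ.2

lemma extendChain_eq_zero {σ : Δ.Cone} {p : ℕ} (x : StarChains R σ p) {τ : Δ.Cone}
    (h : ¬ HasCodim τ p) : extendChain x τ = 0 := dif_neg fun h' => h h'.2

lemma sum_extendChain (σ : Δ.Cone) (p : ℕ) (x : StarChains R σ (p + 1)) (ρ : StarOfCodim σ p) :
    ∑ τ ∈ starFinset σ, extendChain x τ * (o.sign τ ρ.1 : R) = starD R o σ p x ρ := by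
  rw [sum_starFinset σ (p + 1) fun τ _ h => by rw [extendChain_eq_zero x h, zero_mul], starD_apply]
  simp only [extendChain_coe]

lemma sum_extendChain_eq_zero {σ : Δ.Cone} {p : ℕ} (x : StarChains R σ (p + 1)) {ρ : Δ.Cone}
    (hρ : ¬ HasCodim ρ p) :
    ∑ τ ∈ starFinset σ, extendChain x τ * (o.sign τ ρ : R) = 0 := by
  refine Finset.sum_eq_zero fun τ _ => ?_
  by_contra hne
  refine hρ (hasCodim_right (o := o) (τ := τ) (fun h => hne (by rw [h]; simp)) ?_)
  by_contra h
  exact hne (by rw [extendChain_eq_zero x h, zero_mul])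

/-- The function `y` need not be concentrated in one codimension: at cones of codimension `p` only
its values in codimension `p + 1` contribute. -/
lemma exists_starD_eq {σ : Δ.Cone} {p : ℕ} {x : StarChains R σ p} {y : Δ.Cone → R}
    (hy : ∀ ρ, σ ≤ ρ → extendChain x ρ = ∑ τ ∈ starFinset σ, y τ * (o.sign τ ρ : R)) :
    ∃ z, starD R o σ p z = x := by
  refine ⟨Finsupp.equivFunOnFinite.symm fun τ => y τ.1, Finsupp.ext fun ρ => ?_⟩
  rw [starD_apply, ← extendChain_coe, hy _ ρ.2.1, sum_starFinset σ (p + 1)]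
  · rfl
  · intro τ _ h
    by_contra hne
    exact h (hasCodim_left (o := o) (fun h' => hne (by rw [h']; simp)) ρ.2.2)

variable [Module.Finite ℤ N] (hΔ : Δ.IsComplete)

include hΔ

lemma starD_starD (σ : Δ.Cone) (p : ℕ) (x : StarChains R σ (p + 2)) :
    starD R o σ p (starD R o σ (p + 1) x) = 0 := by
  refine Finsupp.ext fun κ => ?_
  rw [starD_apply, Finsupp.zero_apply]
  simp only [starD_apply, Finset.sum_mul]
  rw [Finset.sum_comm]
  refine Finset.sum_eq_zero fun τ _ => ?_
  have h := congrArg (Int.cast : ℤ → R) (sum_sign_mul_sign hΔ o τ.2.1 κ.2.1)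
  rw [sum_starFinset σ (p + 1) fun ρ _ h => by
    by_contra hne
    exact h (hasCodim_left (o := o) (fun h' => hne (by rw [h']; simp)) κ.2.2)] at h
  push_cast at h
  simp only [mul_assoc]
  rw [← Finset.mul_sum, h, mul_zero]

variable [Module.Free ℤ N] (ho : o.IsCoherent)

lemma starAug_surjective (σ : Δ.Cone) : Function.Surjective (starAug R σ) := by
  intro r
  obtain ⟨τ, h⟩ := exists_hasCodim_zero hΔ σ
  exact ⟨Finsupp.single ⟨τ, h⟩ r, by simp [starAug]⟩

include ho

lemma starAug_starD (σ : Δ.Cone) (x : StarChains R σ 1) : starAug R σ (starD R o σ 0 x) = 0 := by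
  rw [starAug_apply, ← sum_sum_sign hΔ ho σ (extendChain x)]
  exact Finset.sum_congr rfl fun ρ _ => (sum_extendChain σ 0 x ρ).symm

lemma exists_starD_eq_of_starD_eq_zero (σ : Δ.Cone) (p : ℕ) (x : StarChains R σ (p + 1))
    (hx : starD R o σ p x = 0) : ∃ y, starD R o σ (p + 1) y = x := by
  obtain ⟨y, hy⟩ := exists_sum_sign hΔ ho σ (extendChain x) (fun ρ hρ => by
    by_cases h : HasCodim ρ p
    · rw [sum_extendChain σ p x ⟨ρ, hρ, h⟩, hx, Finsupp.zero_apply]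
    · exact sum_extendChain_eq_zero x h)
    (Finset.sum_eq_zero fun τ _ => extendChain_eq_zero x fun h => by
      have := HasCodim.eq h τ.2.2
      omega)
  exact exists_starD_eq hy

lemma exists_starD_eq_of_starAug_eq_zero (σ : Δ.Cone) (x : StarChains R σ 0)
    (hx : starAug R σ x = 0) : ∃ y, starD R o σ 0 y = x := by
  obtain ⟨y, hy⟩ := exists_sum_sign hΔ ho σ (extendChain x) (fun ρ _ => by
      -- A cone of full dimension is a facet of no cone, so in degree zero the cycle condition is
      -- automatic.
      refine Finset.sum_eq_zero fun τ _ => ?_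
      by_contra hne
      have h1 : HasCodim τ 0 := not_not.1 fun h => hne (by rw [extendChain_eq_zero x h, zero_mul])
      have h2 := (sign_ne_zero (o := o) (τ := τ) (ρ := ρ) fun h => hne (by rw [h]; simp)).2
      have h3 := Submodule.finrank_le (coneSpan ρ.1)
      rw [finrank_nReal] at h3
      unfold HasCodim at h1
      unfold coneDim at h1 h2
      omega) (by
    rw [← hx, starAug_apply]
    exact Finset.sum_congr rfl fun τ _ => extendChain_coe x τ)
  exact exists_starD_eq hy

end Graded

end Fan

end

end ToricRes

namespace ToricRes

noncomputable section

/-! ### Dual cells as signed sums of maximal flags -/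

namespace Fan

open Module

variable {N : Type u} [AddCommGroup N] {Δ : Fan N}

section Tuples

/-- The cones containing `σ`. -/
abbrev Star (σ : Δ.Cone) : Type u := {τ : Δ.Cone // σ ≤ τ}

instance (σ : Δ.Cone) : Fintype (Star σ) := Fintype.ofFinite _

variable {σ : Δ.Cone}

/-- The tuple obtained by inserting a cone. -/
def insertCone {q : ℕ} (i : Fin (q + 1)) (ρ : Star σ) (g : Fin q → Star σ) : Fin (q + 1) → Star σ :=
  Fin.insertNth (α := fun _ => Star σ) i ρ g

/-- The tuple obtained by adding a cone at the beginning. -/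
def consCone {q : ℕ} (τ : Star σ) (g : Fin q → Star σ) : Fin (q + 1) → Star σ :=
  Fin.cons (α := fun _ => Star σ) τ g

@[simp] lemma consCone_zero {q : ℕ} (τ : Star σ) (g : Fin q → Star σ) : consCone τ g 0 = τ := rfl

lemma consCone_self_tail {q : ℕ} (g : Fin (q + 1) → Star σ) :
    consCone (g 0) (fun i => g i.succ) = g := Fin.cons_self_tail g

lemma insertCone_zero {q : ℕ} (ρ : Star σ) (g : Fin q → Star σ) :
    insertCone 0 ρ g = consCone ρ g := Fin.insertNth_zero' ρ g

lemma insertCone_succ {q : ℕ} (i : Fin (q + 1)) (ρ τ : Star σ) (g : Fin q → Star σ) :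
    insertCone i.succ ρ (consCone τ g) = consCone τ (insertCone i ρ g) :=
  Fin.insertNth_succ_cons i ρ τ g

lemma insertCone_comp {q : ℕ} (i : Fin (q + 1)) (ρ : Star σ) (g : Fin q → Star σ) :
    insertCone i ρ g ∘ i.succAbove = g := Fin.insertNth_comp_succAbove i ρ g

lemma insertCone_apply_zero {q : ℕ} {i : Fin (q + 2)} (hi : i ≠ 0) (ρ : Star σ)
    (g : Fin (q + 1) → Star σ) : insertCone i ρ g 0 = g 0 := by
  obtain ⟨j, rfl⟩ := Fin.exists_succ_eq.2 hi
  rw [← consCone_self_tail g, insertCone_succ]; rfl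

lemma strictMono_of_insertCone {q : ℕ} {i : Fin (q + 1)} {ρ : Star σ} {g : Fin q → Star σ}
    (h : StrictMono (insertCone i ρ g)) : StrictMono g := by
  rw [← insertCone_comp i ρ g]
  exact h.comp (Fin.strictMono_succAbove i)

lemma strictMono_of_consCone {q : ℕ} {τ : Star σ} {g : Fin q → Star σ}
    (h : StrictMono (consCone τ g)) : StrictMono g :=
  fun _ _ hij => h (Fin.succ_lt_succ_iff.2 hij)

lemma lt_of_consCone {q : ℕ} {τ : Star σ} {g : Fin (q + 1) → Star σ}
    (h : StrictMono (consCone τ g)) : τ < g 0 := h (Fin.succ_pos 0)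

/-- The product of the signs along a tuple of cones. -/
def flagSign (o : Δ.Orientation) {q : ℕ} (v : Fin (q + 1) → Star σ) : ℤ :=
  ∏ i : Fin q, o.sign (v i.castSucc).1 (v i.succ).1

variable {o : Δ.Orientation}

lemma flagSign_consCone {q : ℕ} (τ : Star σ) (g : Fin (q + 1) → Star σ) :
    flagSign o (consCone τ g) = o.sign τ.1 (g 0).1 * flagSign o g := by
  unfold flagSign
  rw [Fin.prod_univ_succ]
  rfl

lemma flagSign_fin_one (v : Fin 1 → Star σ) : flagSign o v = 1 := rfl

lemma strictMono_of_flagSign_ne_zero {q : ℕ} {v : Fin (q + 1) → Star σ} (h : flagSign o v ≠ 0) :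
    StrictMono v := by
  refine Fin.strictMono_iff_lt_succ.2 fun i => ?_
  obtain ⟨h1, h2⟩ := sign_ne_zero (Finset.prod_ne_zero_iff.1 h i (Finset.mem_univ i))
  refine lt_of_le_of_ne h1 fun h3 => ?_
  rw [h3] at h2
  omega

lemma flagSign_mul_self {q : ℕ} {v : Fin (q + 1) → Star σ} (h : flagSign o v ≠ 0) :
    flagSign o v * flagSign o v = 1 := by
  unfold flagSign
  rw [← Finset.prod_mul_distrib]
  exact Finset.prod_eq_one fun i _ =>
    sign_mul_self (Finset.prod_ne_zero_iff.1 h i (Finset.mem_univ i))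

variable {R : Type*} [CommRing R]

/-- The simplicial boundary in terms of functions on tuples. -/
def tupleD {q : ℕ} (c : (Fin (q + 1) → Star σ) → R) (g : Fin q → Star σ) : R :=
  ∑ i : Fin (q + 1), (-1) ^ (i : ℕ) * ∑ ρ : Star σ, c (insertCone i ρ g)

/-- Inserting at position 0 puts a cone before `τ`; every other insertion takes place in the tail
with its position lowered by one, whence the minus sign. -/
lemma tupleD_consCone {q : ℕ} (c : (Fin (q + 2) → Star σ) → R) (τ : Star σ) (g : Fin q → Star σ) :
    tupleD c (consCone τ g) = ∑ ρ : Star σ, c (consCone ρ (consCone τ g)) -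
      tupleD (fun w => c (consCone τ w)) g := by
  unfold tupleD
  rw [Fin.sum_univ_succ, sub_eq_add_neg, ← Finset.sum_neg_distrib]
  simp only [insertCone_zero, insertCone_succ, Fin.val_succ, pow_succ, Fin.val_zero, pow_zero,
    one_mul, mul_neg, mul_one, neg_mul]

/-- The value on flags of a function on tuples supported on flags determines its boundary. -/
lemma sum_flagFace {q : ℕ} (c : (Fin (q + 2) → Star σ) → R) (hc : ∀ v, ¬ StrictMono v → c v = 0)
    (i : Fin (q + 2)) (g : Flag σ q) [DecidableEq (Flag σ q)] [Fintype (Flag σ (q + 1))] :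
    ∑ f : Flag σ (q + 1), (if flagFace f i = g then c f else 0) =
      ∑ ρ : Star σ, c (insertCone i ρ g) := by
  classical
  rw [← Finset.sum_filter]
  refine Finset.sum_bij_ne_zero (fun f _ _ => f i) (fun _ _ _ => Finset.mem_univ _) ?_ ?_ ?_
  · intro f hf _ f' hf' _ h
    rw [Finset.mem_filter] at hf hf'
    refine DFunLike.ext _ _ fun j => ?_
    refine Fin.succAboveCases i (α := fun j => f j = f' j) h (fun j => ?_) j
    exact congrArg (fun φ : Flag σ q => φ j) (hf.2.trans hf'.2.symm)
  · intro ρ _ hne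
    have h := not_not.1 fun h => hne (hc _ h)
    refine ⟨OrderEmbedding.ofStrictMono _ h, ?_, hne, ?_⟩
    · rw [Finset.mem_filter]
      exact ⟨Finset.mem_univ _, DFunLike.ext _ _ fun j => congrFun (insertCone_comp i ρ g) j⟩
    · exact Fin.insertNth_apply_same (α := fun _ => Star σ) i ρ g
  · intro f hf _
    rw [Finset.mem_filter] at hf
    congr 1
    refine ((Fin.insertNth_eq_iff (α := fun _ => Star σ)).2 ⟨rfl, ?_⟩).symm
    rw [← hf.2]
    rfl

end Tuples

section Boundary

variable {R : Type u} [CommRing R]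

instance (σ : Δ.Cone) (q : ℕ) : Finite (Flag σ q) :=
  Finite.of_injective (fun f => (f : Fin (q + 1) → Star σ)) DFunLike.coe_injective

instance (σ : Δ.Cone) (q : ℕ) : Fintype (Flag σ q) := Fintype.ofFinite _

lemma flagD_apply {σ : Δ.Cone} {q : ℕ} (x : Flag σ (q + 1) →₀ R)
    (c : (Fin (q + 2) → Star σ) → R) (hc : ∀ v, ¬ StrictMono v → c v = 0) (hx : ∀ f, x f = c f)
    (g : Flag σ q) : flagD R σ q x g = tupleD c g := by
  classical
  unfold flagD tupleD
  rw [Finsupp.linearCombination_apply, Finsupp.sum_fintype _ _ (by simp), Finsupp.finsetSum_apply]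
  simp only [Finsupp.smul_apply, Finsupp.finsetSum_apply, Finset.smul_sum, smul_eq_mul]
  rw [Finset.sum_comm]
  refine Finset.sum_congr rfl fun i _ => ?_
  rw [← sum_flagFace c hc i g, Finset.mul_sum]
  refine Finset.sum_congr rfl fun f _ => ?_
  rw [hx, Finsupp.single_apply]
  split_ifs <;> ring

variable (o : Δ.Orientation)

/-- The dual cell chain: `[τ]` is sent to the signed sum of the maximal flags starting at `τ`. -/
def dualCell (σ : Δ.Cone) (p : ℕ) : StarChains R σ p →ₗ[R] (Flag σ p →₀ R) where
  toFun x := Finsupp.equivFunOnFinite.symm fun f => extendChain x (f 0).1 * (flagSign o f : R)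
  map_add' x y := by
    ext f
    simp only [Finsupp.equivFunOnFinite_symm_apply_apply, Finsupp.add_apply, extendChain]
    split_ifs <;> ring
  map_smul' r x := by
    ext f
    simp only [Finsupp.equivFunOnFinite_symm_apply_apply, Finsupp.smul_apply, extendChain,
      smul_eq_mul, RingHom.id_apply]
    split_ifs <;> ring

lemma dualCell_apply {σ : Δ.Cone} {p : ℕ} (x : StarChains R σ p) (f : Flag σ p) :
    dualCell o σ p x f = extendChain x (f 0).1 * (flagSign o f : R) := rfl

lemma sum_star {R : Type*} [AddCommMonoid R] (σ : Δ.Cone) (F : Δ.Cone → R) :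
    ∑ ρ : Star σ, F ρ.1 = ∑ ρ ∈ starFinset σ, F ρ :=
  (Finset.sum_subtype _ (fun τ => by simp) _).symm

variable {o}

variable [Module.Finite ℤ N] [Module.Free ℤ N] (hΔ : Δ.IsComplete) (ho : o.IsCoherent)

include hΔ ho

/-- Inserting a cone between two neighbours gives a sum of products of two consecutive signs, which
vanishes by the diamond property. Inserting at the end, after a cone of codimension one, gives the
augmentation of its differential, which vanishes by coherence. -/
lemma sum_flagSign_insertCone {σ : Δ.Cone} (p : ℕ) (g : Fin (p + 1) → Star σ)
    (hg : HasCodim (g 0).1 (p + 1)) {i : Fin (p + 2)} (hi : i ≠ 0) :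
    ∑ ρ : Star σ, flagSign o (insertCone i ρ g) = 0 := by
  induction p with
  | zero =>
    classical
    obtain ⟨j, rfl⟩ := Fin.exists_succ_eq.2 hi
    obtain rfl : j = 0 := Subsingleton.elim _ _
    have h := sum_sum_sign (R := ℤ) hΔ ho σ (fun τ => if τ = (g 0).1 then 1 else 0)
    simp only [ite_mul, one_mul, zero_mul, Finset.sum_ite_eq', mem_starFinset, (g 0).2, if_true] at h
    rw [← consCone_self_tail g]
    simp only [insertCone_succ, flagSign_consCone, insertCone_zero, consCone_zero]
    rw [← h]
    simp only [flagSign_fin_one, mul_one]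
    rw [sum_star σ fun ρ => o.sign (g 0).1 ρ]
    exact sum_starFinset σ 0 fun ρ _ h0 => by
      by_contra hne
      exact h0 (hasCodim_right hne hg)
  | succ p ih =>
    obtain ⟨j, rfl⟩ := Fin.exists_succ_eq.2 hi
    obtain ⟨τ, w, rfl⟩ : ∃ τ w, g = consCone τ w := ⟨_, _, (consCone_self_tail g).symm⟩
    simp only [insertCone_succ, flagSign_consCone]
    by_cases hj : j = 0
    · subst hj
      simp only [insertCone_zero, consCone_zero, flagSign_consCone, ← mul_assoc]
      rw [← Finset.sum_mul, sum_star σ fun ρ => o.sign τ.1 ρ * o.sign ρ (w 0).1,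
        sum_sign_mul_sign hΔ o τ.2 (w 0).2, zero_mul]
    · simp only [insertCone_apply_zero hj]
      rw [← Finset.mul_sum]
      by_cases h0 : o.sign τ.1 (w 0).1 = 0
      · rw [h0, zero_mul]
      · rw [ih w (hasCodim_right h0 hg) hj, mul_zero]

omit hΔ ho [Module.Finite ℤ N] [Module.Free ℤ N] in
lemma extendChain_starD {σ : Δ.Cone} {p : ℕ} (x : StarChains R σ (p + 1)) {ρ : Δ.Cone} (hρ : σ ≤ ρ) :
    extendChain (starD R o σ p x) ρ = ∑ τ ∈ starFinset σ, extendChain x τ * (o.sign τ ρ : R) := by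
  by_cases h : HasCodim ρ p
  · rw [sum_extendChain σ p x ⟨ρ, hρ, h⟩, ← extendChain_coe]
  · rw [sum_extendChain_eq_zero x h, extendChain_eq_zero _ h]

/-- Among the faces only those omitting the first cone survive, by `sum_flagSign_insertCone`. Since
`flagSign` is multiplicative, summing over the omitted first cone reproduces the differential. -/
lemma dualCell_starD {σ : Δ.Cone} (p : ℕ) (x : StarChains R σ (p + 1)) :
    dualCell o σ p (starD R o σ p x) = flagD R σ p (dualCell o σ (p + 1) x) := by
  ext g
  rw [flagD_apply _ (fun v => extendChain x (v 0).1 * (flagSign o v : R)) (fun v hv => by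
    rw [not_not.1 fun h => hv (strictMono_of_flagSign_ne_zero h), Int.cast_zero, mul_zero])
    (fun f => rfl), tupleD, Fin.sum_univ_succ, dualCell_apply, extendChain_starD x (g 0).2, eq_comm]
  refine (add_eq_left.2 (Finset.sum_eq_zero fun i _ => ?_)).trans ?_
  rotate_left
  · simp only [Fin.val_zero, pow_zero, one_mul, insertCone_zero, consCone_zero, flagSign_consCone,
      Int.cast_mul, ← mul_assoc]
    rw [← Finset.sum_mul, sum_star σ fun τ => extendChain x τ * (o.sign τ (g 0).1 : R)]
  · simp only [insertCone_apply_zero (Fin.succ_ne_zero i)]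
    rw [← Finset.mul_sum]
    by_cases h : HasCodim (g 0).1 (p + 1)
    · have := congrArg (Int.cast : ℤ → R)
        (sum_flagSign_insertCone hΔ ho p g h (Fin.succ_ne_zero i))
      push_cast at this
      rw [this, mul_zero, mul_zero]
    · rw [extendChain_eq_zero x h, zero_mul, mul_zero]

omit hΔ ho [Module.Finite ℤ N] [Module.Free ℤ N] in
lemma dualCell_mem_skeletonChains {σ : Δ.Cone} (p : ℕ) (x : StarChains R σ p) :
    dualCell o σ p x ∈ skeletonChains R σ p p := by
  unfold skeletonChains
  rw [Finsupp.mem_supported']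
  intro f hf
  rw [dualCell_apply, extendChain_eq_zero, zero_mul]
  intro h
  exact hf (by rw [Set.mem_ofPred_eq]; exact (show _ = _ from h).ge)

lemma dualCell_mem_cellularChains {σ : Δ.Cone} (p : ℕ) (x : StarChains R σ p) :
    dualCell o σ p x ∈ cellularChains R σ p := by
  cases p with
  | zero => exact dualCell_mem_skeletonChains 0 x
  | succ p =>
    refine ⟨dualCell_mem_skeletonChains _ x, ?_⟩
    rw [SetLike.mem_coe, Submodule.mem_comap, ← dualCell_starD hΔ ho]
    exact dualCell_mem_skeletonChains _ _

/-- Every cone of positive codimension is a facet of a larger one, so one can climb to a maximal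
cone in steps of dimension one. -/
lemma exists_flagSign_ne_zero {σ : Δ.Cone} (p : ℕ) (τ : Star σ) (hτ : HasCodim τ.1 p) :
    ∃ v : Fin (p + 1) → Star σ, v 0 = τ ∧ flagSign o v ≠ 0 := by
  induction p generalizing τ with
  | zero => exact ⟨fun _ => τ, rfl, one_ne_zero⟩
  | succ p ih =>
    obtain ⟨ρ, hρ⟩ := exists_sign_ne_zero hΔ ho hτ
    obtain ⟨v, hv, h⟩ := ih ⟨ρ, τ.2.trans (sign_ne_zero hρ).1⟩ (hasCodim_right hρ hτ)
    exact ⟨consCone τ v, rfl, by rw [flagSign_consCone, hv]; exact mul_ne_zero hρ h⟩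

/-- The coefficient at `τ` is recovered, up to the sign `flagSign`, from the coefficient of any
single maximal flag starting at `τ`. -/
lemma dualCell_injective (σ : Δ.Cone) (p : ℕ) :
    Function.Injective (dualCell (R := R) o σ p) := by
  refine (injective_iff_map_eq_zero _).2 fun x hx => Finsupp.ext fun τ => ?_
  obtain ⟨v, hv, h⟩ := exists_flagSign_ne_zero hΔ ho p ⟨τ.1, τ.2.1⟩ τ.2.2
  have h1 := DFunLike.congr_fun hx (OrderEmbedding.ofStrictMono v (strictMono_of_flagSign_ne_zero h))
  rw [dualCell_apply, Finsupp.zero_apply] at h1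
  change extendChain x (v 0).1 * (flagSign o v : R) = 0 at h1
  have h2 := congrArg (Int.cast : ℤ → R) (flagSign_mul_self h)
  push_cast at h2
  rw [hv] at h1
  change extendChain x τ.1 * (flagSign o v : R) = 0 at h1
  rw [extendChain_coe] at h1
  rw [Finsupp.zero_apply, ← mul_one (x τ), ← h2, ← mul_assoc, h1, zero_mul]

omit hΔ ho [Module.Finite ℤ N] [Module.Free ℤ N] in
lemma linearCombination_dualCell {σ : Δ.Cone} (x : StarChains R σ 0) :
    Finsupp.linearCombination R (fun _ : Flag σ 0 => (1 : R)) (dualCell o σ 0 x) =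
      starAug R σ x := by
  rw [starAug_apply, Finsupp.linearCombination_apply, Finsupp.sum_fintype _ _ (by simp)]
  simp only [dualCell_apply, flagSign_fin_one, Int.cast_one, mul_one, smul_eq_mul]
  simp only [← extendChain_coe x]
  rw [← sum_starFinset σ 0 fun τ _ h => extendChain_eq_zero x h, ← sum_star]
  have : Subsingleton (Fin (0 + 1)) := inferInstanceAs (Subsingleton (Fin 1))
  refine Finset.sum_bij (fun f _ => f 0) (fun _ _ => Finset.mem_univ _) (fun f _ f' _ h => ?_)
    (fun τ _ => ⟨OrderEmbedding.ofStrictMono (fun _ => τ) (Subsingleton.strictMono _),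
      Finset.mem_univ _, rfl⟩) fun _ _ => rfl
  refine DFunLike.ext _ _ fun j => ?_
  rw [Subsingleton.elim j 0]
  exact h

end Boundary

end Fan

end

end ToricRes

namespace ToricRes

noncomputable section

/-! ### Every cellular chain is a combination of dual cells -/

namespace Fan

open Module

variable {N : Type u} [AddCommGroup N] [Module.Finite ℤ N] {Δ : Fan N}

lemma coneDim_lt {τ ρ : Δ.Cone} (h : τ < ρ) : coneDim τ.1 < coneDim ρ.1 := by
  have hle : coneSpan τ.1 ≤ coneSpan ρ.1 := Submodule.span_mono h.le
  refine lt_of_le_of_ne (Submodule.finrank_mono hle) fun h1 => h.ne ?_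
  have h2 := Submodule.eq_of_le_of_finrank_eq hle h1
  exact eq_of_mem_relInt_of_mem_coneSpan h.le (intPoint_mem ρ)
    (h2 ▸ Submodule.subset_span (intPoint_mem ρ).1)

variable [Module.Free ℤ N]

lemma coneDim_le (τ : Δ.Cone) : coneDim τ.1 ≤ finrank ℤ N := by
  rw [← finrank_nReal]; exact Submodule.finrank_le _

lemma coneDim_add_le {σ : Δ.Cone} {p : ℕ} {v : Fin (p + 1) → Star σ} (hv : StrictMono v) :
    coneDim (v 0).1.1 + p ≤ finrank ℤ N := by
  induction p with
  | zero => exact coneDim_le _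
  | succ p ih =>
    have h1 := ih (v := fun i => v i.succ) fun i j hij => hv (Fin.succ_lt_succ_iff.2 hij)
    have h2 := coneDim_lt (show (v 0).1 < (v (Fin.succ 0)).1 from hv (Fin.succ_pos 0))
    omega

variable {R : Type u} [CommRing R] {o : Δ.Orientation} (hΔ : Δ.IsComplete) (ho : o.IsCoherent)

/-- The function on tuples is supported on the flags of length `p` starting in codimension `p`. -/
structure IsCellularTuple {σ : Δ.Cone} {p : ℕ} (c : (Fin (p + 1) → Star σ) → R) : Prop where
  strictMono : ∀ v, c v ≠ 0 → StrictMono v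
  hasCodim : ∀ v, c v ≠ 0 → HasCodim (v 0).1 p

/-- The tail consists of `p + 1` cones of strictly increasing dimension above a cone of codimension
`p + 1`, so its first cone has codimension exactly `p`. -/
lemma IsCellularTuple.link {σ : Δ.Cone} {p : ℕ} {c : (Fin (p + 2) → Star σ) → R}
    (hc : IsCellularTuple c) (τ : Star σ) :
    IsCellularTuple fun w : Fin (p + 1) → Star σ => c (consCone τ w) := by
  refine ⟨fun w hw => strictMono_of_consCone (hc.strictMono _ hw), fun w hw => ?_⟩
  have h1 := hc.strictMono _ hw
  have h2 := hc.hasCodim _ hw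
  have h3 := coneDim_add_le (strictMono_of_consCone h1)
  have h4 := coneDim_lt (show τ.1 < (w 0).1 from lt_of_consCone h1)
  rw [consCone_zero] at h2
  have key : ∀ a b n : ℕ, a + (p + 1) = n → b + p ≤ n → a < b → b + p = n := by omega
  exact key _ _ _ h2 h3 h4

-- A cone inserted before `τ` would have to be strictly smaller than `τ` and yet of the same
-- codimension.
omit [Module.Free ℤ N] in
lemma IsCellularTuple.tupleD_eq_neg {σ : Δ.Cone} {p : ℕ} {c : (Fin (p + 2) → Star σ) → R}
    (hc : IsCellularTuple c) {τ : Star σ} (hτ : HasCodim τ.1 (p + 1)) (g : Fin p → Star σ) :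
    tupleD c (consCone τ g) = - tupleD (fun w => c (consCone τ w)) g := by
  rw [tupleD_consCone, Finset.sum_eq_zero, zero_sub]
  intro ρ _
  by_contra hne
  have h1 := hc.hasCodim _ hne
  rw [consCone_zero] at h1
  have h2 := coneDim_lt (show ρ.1 < τ.1 from lt_of_consCone (hc.strictMono _ hne))
  exact h2.ne (Nat.add_right_cancel (h1.trans hτ.symm))

include hΔ ho

/-- A chain on the cones containing `τ` which is a cycle is a multiple of the boundary of `τ`. -/
lemma exists_eq_mul_sign {τ : Δ.Cone} {p : ℕ} (hτ : HasCodim τ (p + 1)) (y : Δ.Cone → R)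
    (hy : ∀ ρ, y ρ ≠ 0 → τ ≤ ρ ∧ HasCodim ρ p)
    (h0 : p = 0 → ∑ ρ ∈ starFinset τ, y ρ = 0)
    (h1 : ∀ q κ, p = q + 1 → τ ≤ κ → HasCodim κ q →
      ∑ ρ ∈ starFinset τ, y ρ * (o.sign ρ κ : R) = 0) :
    ∃ r : R, ∀ ρ, y ρ = r * (o.sign τ ρ : R) := by
  classical
  let x : StarChains R τ p := Finsupp.equivFunOnFinite.symm fun ρ => y ρ.1
  have hx : ∀ ρ, extendChain x ρ = y ρ := by
    intro ρ
    by_cases h : τ ≤ ρ ∧ HasCodim ρ p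
    · exact dif_pos h
    · rw [extendChain, dif_neg h]
      by_contra hne
      exact h (hy ρ (Ne.symm hne))
  -- By exactness around `τ` the chain is the boundary of a chain on cones of codimension `p + 1`
  -- containing `τ`, and `τ` is the only such cone.
  obtain ⟨z, hz⟩ : ∃ z, starD R o τ p z = x := by
    cases p with
    | zero =>
      refine exists_starD_eq_of_starAug_eq_zero hΔ ho τ x ?_
      rw [starAug_apply, ← h0 rfl, sum_starFinset τ 0 fun ρ _ h => by
        by_contra hne; exact h (hy ρ hne).2]
      rfl
    | succ q =>
      refine exists_starD_eq_of_starD_eq_zero hΔ ho τ q x (Finsupp.ext fun κ => ?_)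
      rw [← sum_extendChain, Finsupp.zero_apply, ← h1 q κ.1 rfl κ.2.1 κ.2.2]
      simp only [hx]
  refine ⟨z ⟨τ, le_rfl, hτ⟩, fun ρ => ?_⟩
  by_cases hρ : τ ≤ ρ
  · rw [← hx, ← hz, extendChain_starD z hρ, Finset.sum_eq_single τ]
    · rw [← extendChain_coe z ⟨τ, le_rfl, hτ⟩]
    · intro κ hκ hne
      rw [extendChain_eq_zero, zero_mul]
      intro h
      have := coneDim_lt (lt_of_le_of_ne (mem_starFinset.1 hκ) hne.symm)
      unfold HasCodim at h hτ
      omega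
    · exact fun h => absurd (mem_starFinset.2 le_rfl) h
  · rw [not_not.1 fun h => hρ (hy ρ h).1, not_not.1 fun h => hρ (sign_ne_zero h).1, Int.cast_zero,
      mul_zero]

/-- Induction on `p`. With its first cone `τ` fixed, the chain becomes a cycle on the tails, and by
induction its values are `y' ρ` times the sign of the tail, where `ρ` is the first cone of the tail.
The cycle condition makes `y'` a cycle around `τ`, hence a multiple of the boundary of `[τ]`, and
the factor `ε(τ, ρ)` completes the sign of the whole flag. -/
lemma IsCellularTuple.exists_eq {σ : Δ.Cone} {p : ℕ} {c : (Fin (p + 1) → Star σ) → R}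
    (hc : IsCellularTuple c) (hd : ∀ (q : ℕ) (h : p = q + 1) (g : Fin p → Star σ),
      HasCodim (g (Fin.cast h.symm 0)).1 p → tupleD c g = 0) :
    ∃ y : Δ.Cone → R, ∀ v, HasCodim (v 0).1 p → c v = y (v 0).1 * (flagSign o v : R) := by
  classical
  induction p with
  | zero =>
    refine ⟨fun τ => if h : σ ≤ τ then c fun _ => ⟨τ, h⟩ else 0, fun v _ => ?_⟩
    dsimp only
    rw [dif_pos (v 0).2, flagSign_fin_one, Int.cast_one, mul_one]
    congr 1
    funext i
    rw [Fin.fin_one_eq_zero i]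
  | succ p ih =>
    have hτD : ∀ (τ : Star σ), HasCodim τ.1 (p + 1) → ∀ g : Fin p → Star σ,
        tupleD (fun w => c (consCone τ w)) g = 0 := by
      intro τ hτ g
      rw [← neg_eq_zero, ← hc.tupleD_eq_neg hτ]
      exact hd p rfl _ hτ
    have key : ∀ τ : Star σ, HasCodim τ.1 (p + 1) → ∃ r : R, ∀ w : Fin (p + 1) → Star σ,
        c (consCone τ w) = r * (flagSign o (consCone τ w) : R) := by
      intro τ hτ
      obtain ⟨y, hy⟩ := ih (hc.link τ) fun q h g _ => hτD τ hτ g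
      let y' : Δ.Cone → R := fun ρ => if τ.1 ≤ ρ ∧ HasCodim ρ p then y ρ else 0
      have hy' : ∀ w : Fin (p + 1) → Star σ,
          c (consCone τ w) = y' (w 0).1 * (flagSign o w : R) := by
        intro w
        by_cases h : τ.1 ≤ (w 0).1 ∧ HasCodim (w 0).1 p
        · rw [hy w h.2]; simp only [y', if_pos h]
        · simp only [y', if_neg h, zero_mul]
          by_contra hne
          exact h ⟨(lt_of_consCone (hc.strictMono _ hne)).le, (hc.link τ).hasCodim _ hne⟩
      have hsum : ∀ F : Δ.Cone → R, (∀ ρ, ¬ τ.1 ≤ ρ → F ρ = 0) →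
          ∑ ρ ∈ starFinset τ.1, F ρ = ∑ ρ : Star σ, F ρ.1 := by
        intro F hF
        rw [sum_star σ]
        refine Finset.sum_subset (fun ρ hρ => mem_starFinset.2
          (τ.2.trans (mem_starFinset.1 hρ))) fun ρ _ hρ => hF ρ fun h => hρ (mem_starFinset.2 h)
      have hy0 : p = 0 → ∑ ρ ∈ starFinset τ.1, y' ρ = 0 := by
        rintro rfl
        have h := hτD τ hτ Fin.elim0
        rw [tupleD, Fin.sum_univ_one] at h
        rw [hsum y' fun ρ h => if_neg fun h' => h h'.1, ← h]
        simp only [Fin.val_zero, pow_zero, one_mul, hy', flagSign_fin_one, Int.cast_one, mul_one,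
          insertCone_zero, consCone_zero]
      have hy1 : ∀ q κ, p = q + 1 → τ.1 ≤ κ → HasCodim κ q →
          ∑ ρ ∈ starFinset τ.1, y' ρ * (o.sign ρ κ : R) = 0 := by
        rintro q κ rfl hκ hκq
        -- The boundary is evaluated at one flag `w` of nonzero sign starting at `κ`. Insertions
        -- after the first position keep `κ` as first cone, where `y'` vanishes because its
        -- codimension is `q` and not `q + 1`. The insertion at the beginning gives the differential
        -- of `y'` at `κ`, times an invertible sign.
        obtain ⟨w, hw, hne⟩ := exists_flagSign_ne_zero hΔ ho q
          (⟨κ, τ.2.trans hκ⟩ : Star σ) hκq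
        have h := hτD τ hτ w
        rw [tupleD, Fin.sum_univ_succ, Finset.sum_eq_zero (s := Finset.univ) (ι := Fin (q + 1)),
          add_zero] at h
        · simp only [Fin.val_zero, pow_zero, one_mul, hy', insertCone_zero, consCone_zero,
            flagSign_consCone, Int.cast_mul, ← mul_assoc, hw] at h
          rw [← Finset.sum_mul] at h
          have h2 := congrArg (Int.cast : ℤ → R) (flagSign_mul_self hne)
          push_cast at h2
          rw [hsum _ fun ρ h' => by
            simp only [y']; rw [if_neg fun h'' => h' h''.1, zero_mul], ← mul_one (∑ ρ : Star σ, _),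
            ← h2, ← mul_assoc, h, zero_mul]
        · intro i _
          rw [Finset.sum_eq_zero, mul_zero]
          intro ρ _
          simp only [hy', insertCone_apply_zero (Fin.succ_ne_zero i), hw]
          simp only [y']
          rw [if_neg, zero_mul]
          intro h'
          have := HasCodim.eq h'.2 hκq
          omega
      obtain ⟨r, hr⟩ := exists_eq_mul_sign hΔ ho hτ y' (fun ρ h => by
        by_contra h'; exact h (if_neg h')) hy0 hy1
      refine ⟨r, fun w => ?_⟩
      rw [hy', hr, flagSign_consCone]
      push_cast
      ring
    choose! r hr using key
    refine ⟨fun τ => if h : σ ≤ τ then r ⟨τ, h⟩ else 0, fun v hv => ?_⟩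
    obtain ⟨τ, w, rfl⟩ : ∃ τ w, v = consCone τ w := ⟨_, _, (consCone_self_tail v).symm⟩
    dsimp only [consCone_zero]
    rw [dif_pos τ.2]
    exact hr τ hv w

lemma exists_dualCell_eq {σ : Δ.Cone} (p : ℕ) (x : Flag σ p →₀ R)
    (hx : x ∈ cellularChains R σ p) : ∃ y, dualCell o σ p y = x := by
  classical
  let c : (Fin (p + 1) → Star σ) → R := fun v =>
    if h : StrictMono v then x (OrderEmbedding.ofStrictMono v h) else 0
  have hcx : ∀ f : Flag σ p, x f = c f := fun f => by
    simp only [c]; rw [dif_pos f.strictMono]; rfl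
  have hcm : ∀ v, ¬ StrictMono v → c v = 0 := fun v h => dif_neg h
  have hs : x ∈ skeletonChains R σ p p := by
    cases p with
    | zero => exact hx
    | succ p => exact hx.1
  have hc : IsCellularTuple c :=
    { strictMono := fun v hv => not_not.1 fun h => hv (hcm v h)
      hasCodim := fun v hv => by
        have hm : StrictMono v := not_not.1 fun h => hv (hcm v h)
        have h1 := coneDim_add_le hm
        have h2 : finrank ℤ N ≤ coneDim (v 0).1.1 + p := by
          by_contra h2
          refine hv ?_
          simp only [c]
          rw [dif_pos hm]
          exact (Finsupp.mem_supported' R x).1 hs _ h2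
        exact le_antisymm h1 h2 }
  obtain ⟨y, hy⟩ := hc.exists_eq hΔ ho (by
    rintro q rfl g hg
    by_cases hm : StrictMono g
    -- A flag starting in codimension `q + 1` is not in the `q`-skeleton, where the boundary of a
    -- cellular chain is supported.
    · refine (flagD_apply x c hcm hcx (OrderEmbedding.ofStrictMono g hm)).symm.trans ?_
      refine (Finsupp.mem_supported' R _).1 hx.2 _ fun h => ?_
      change finrank ℤ N ≤ coneDim (g 0).1.1 + q at h
      change coneDim (g 0).1.1 + (q + 1) = _ at hg
      omega
    · refine Finset.sum_eq_zero fun i _ => ?_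
      rw [Finset.sum_eq_zero fun ρ _ => hcm _ fun h => hm (strictMono_of_insertCone h), mul_zero])
  refine ⟨Finsupp.equivFunOnFinite.symm fun τ => y τ.1, Finsupp.ext fun f => ?_⟩
  rw [dualCell_apply, hcx]
  by_cases h : HasCodim (f 0).1 p
  · rw [hy _ h]
    congr 1
    exact dif_pos ⟨(f 0).2, h⟩
  · rw [extendChain_eq_zero _ h, zero_mul]
    by_contra hne
    exact h (hc.hasCodim _ (Ne.symm hne))

/-- The chains on the cones containing `σ` are the cellular chains of the dual cells. -/
def dualCellEquiv (σ : Δ.Cone) (p : ℕ) : StarChains R σ p ≃ₗ[R] cellularChains R σ p :=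
  LinearEquiv.ofBijective ((dualCell o σ p).codRestrict _ (dualCell_mem_cellularChains hΔ ho p))
    ⟨fun _ _ h => dualCell_injective hΔ ho σ p (congrArg Subtype.val h), fun x => by
      obtain ⟨y, hy⟩ := exists_dualCell_eq hΔ ho p x.1 x.2
      exact ⟨y, Subtype.ext hy⟩⟩

end Fan

end

end ToricRes

namespace ToricRes

noncomputable section

/-! ### Stalks of extensions by zero and of their direct sums -/

section Stalks

variable {X : TopCat.{u}} {R : Type u} [CommRing R]

/-- The stalk of a sheaf of modules. -/
abbrev sheafStalk (R : Type u) [CommRing R] (x : X) :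
    TopCat.Sheaf (ModuleCat.{u} R) X ⥤ ModuleCat.{u} R :=
  TopCat.Sheaf.forget (ModuleCat.{u} R) X ⋙ TopCat.Presheaf.stalkFunctor (ModuleCat.{u} R) x

lemma sheafStalk_map_comp_apply {F G H : TopCat.Sheaf (ModuleCat.{u} R) X} (f : F ⟶ G) (g : G ⟶ H)
    (x : X) (z : (sheafStalk R x).obj F) : ((sheafStalk R x).map (f ≫ g)).hom z =
      ((sheafStalk R x).map g).hom (((sheafStalk R x).map f).hom z) :=
  congrArg (fun φ => φ.hom z) ((sheafStalk R x).map_comp f g)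

lemma sheafStalk_map_id_apply {F : TopCat.Sheaf (ModuleCat.{u} R) X} (x : X)
    (z : (sheafStalk R x).obj F) : ((sheafStalk R x).map (𝟙 F)).hom z = z :=
  congrArg (fun φ => φ.hom z) ((sheafStalk R x).map_id F)

lemma sheafStalk_map_zero_apply (F G : TopCat.Sheaf (ModuleCat.{u} R) X) (x : X)
    (z : (sheafStalk R x).obj F) : ((sheafStalk R x).map (0 : F ⟶ G)).hom z = 0 :=
  congrArg (fun φ => φ.hom z) ((sheafStalk R x).map_zero F G)

lemma sheafStalk_map_sum_apply {ι : Type*} (s : Finset ι) {F G : TopCat.Sheaf (ModuleCat.{u} R) X}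
    (f : ι → (F ⟶ G)) (x : X) (z : (sheafStalk R x).obj F) :
    ((sheafStalk R x).map (∑ i ∈ s, f i)).hom z = ∑ i ∈ s, ((sheafStalk R x).map (f i)).hom z := by
  rw [Functor.map_sum, ModuleCat.hom_sum, LinearMap.sum_apply]

lemma sheafStalk_map_zsmul_apply {F G : TopCat.Sheaf (ModuleCat.{u} R) X} (n : ℤ) (f : F ⟶ G)
    (x : X) (z : (sheafStalk R x).obj F) :
    ((sheafStalk R x).map (n • f)).hom z = n • ((sheafStalk R x).map f).hom z := by
  rw [Functor.map_zsmul]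
  rfl

lemma eq_zero_of_sheafStalk_map {F G : TopCat.Sheaf (ModuleCat.{u} R) X} (f : F ⟶ G)
    (h : ∀ x : X, (sheafStalk R x).map f = 0) : f = 0 := by
  refine (TopCat.Sheaf.forget (ModuleCat.{u} R) X).map_injective ?_
  refine NatTrans.ext (funext fun V => ModuleCat.hom_ext (LinearMap.ext fun s => ?_))
  refine TopCat.Presheaf.section_ext G V.unop _ _ fun x hx => ?_
  have h1 := TopCat.Presheaf.stalkFunctor_map_germ_apply V.unop x hx
    ((TopCat.Sheaf.forget (ModuleCat.{u} R) X).map f) s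
  have h2 : (TopCat.Presheaf.stalkFunctor (ModuleCat.{u} R) x).map
    ((TopCat.Sheaf.forget (ModuleCat.{u} R) X).map f) = 0 := h x
  rw [h2] at h1
  refine h1.symm.trans ?_
  exact (map_zero (G.presheaf.germ V.unop x hx).hom).symm

/-- The constant presheaf. -/
def constPresheaf (R : Type u) [CommRing R] (X : TopCat.{u}) :
    TopCat.Presheaf (ModuleCat.{u} R) X := (Functor.const (Opens X)ᵒᵖ).obj (ModuleCat.of R R)

lemma germ_constPresheaf_bijective (x : X) : Function.Bijective
    ((constPresheaf R X).germ ⊤ x trivial) := by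
  constructor
  · intro a b h
    obtain ⟨_, _, _, _, h⟩ := TopCat.Presheaf.germ_eq _ x _ _ a b h
    exact h
  · intro t
    obtain ⟨V, hxV, s, rfl⟩ := TopCat.Presheaf.exists_germ_eq _ t
    refine ⟨s, ?_⟩
    exact ((constPresheaf R X).germ_res_apply (homOfLE (le_top : V ≤ ⊤)) x hxV s).symm

/-- The stalk of the constant presheaf. -/
def constPresheafStalkIso (R : Type u) [CommRing R] (x : X) :
    ModuleCat.of R R ≅ (constPresheaf R X).stalk x :=
  (LinearEquiv.ofBijective ((constPresheaf R X).germ ⊤ x trivial).hom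
    (germ_constPresheaf_bijective x)).toModuleIso

/-- The stalk of the sheafification of a presheaf. -/
def sheafifyStalkIso (P : TopCat.Presheaf (ModuleCat.{u} R) X) (x : X) :
    (TopCat.Presheaf.stalkFunctor (ModuleCat.{u} R) x).obj P ≅
      (sheafStalk R x).obj ((presheafToSheaf (Opens.grothendieckTopology X) (ModuleCat.{u} R)).obj P) :=
  have := TopCat.Presheaf.stalkFunctor_map_unit_toSheafify_isIso x (ModuleCat.{u} R) P
  @asIso _ _ _ _ ((TopCat.Presheaf.stalkFunctor (ModuleCat.{u} R) x).map
      (CategoryTheory.toSheafify (Opens.grothendieckTopology X) P)) this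

/-- The stalk of the constant sheaf. -/
def constStalkIso (R : Type u) [CommRing R] (x : X) :
    (sheafStalk R x).obj (constSheaf R X) ≅ ModuleCat.of R R :=
  (constPresheafStalkIso R x ≪≫ sheafifyStalkIso (constPresheaf R X) x).symm

variable (F : TopCat.Sheaf (ModuleCat.{u} R) X)

lemma extZeroMap_comp_extZeroι {U U' : Opens X} (h : U ≤ U') :
    extZeroMap F h ≫ extZeroι F U' = extZeroι F U := by
  exact (Adjunction.homEquiv_naturality_left_symm
    (sheafificationAdjunction (Opens.grothendieckTopology X) (ModuleCat.{u} R))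
    (extPresheafMap F.presheaf h) (extPresheafι F.presheaf U')).symm

lemma toSheafify_comp_extZeroι (U : Opens X) :
    CategoryTheory.toSheafify (Opens.grothendieckTopology X) (extPresheaf F.presheaf U) ≫
      (TopCat.Sheaf.forget (ModuleCat.{u} R) X).map (extZeroι F U) = extPresheafι F.presheaf U :=
  ((sheafificationAdjunction (Opens.grothendieckTopology X) (ModuleCat.{u} R)).homEquiv
    (extPresheaf F.presheaf U) F).apply_symm_apply (extPresheafι F.presheaf U)

lemma extPresheafι_stalk_injective (U : Opens X) (x : X) : Function.Injective
    ((TopCat.Presheaf.stalkFunctor (ModuleCat.{u} R) x).map (extPresheafι F.presheaf U)) :=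
  TopCat.Presheaf.stalkFunctor_map_injective_of_app_injective
    (fun _ _ _ h => Subtype.ext h) x

lemma extPresheafι_stalk_surjective {U : Opens X} {x : X} (hx : x ∈ U) : Function.Surjective
    ((TopCat.Presheaf.stalkFunctor (ModuleCat.{u} R) x).map (extPresheafι F.presheaf U)) := by
  intro t
  obtain ⟨V, hV, hxV, s, rfl⟩ := F.presheaf.exists_le_germ_eq t hx
  refine ⟨TopCat.Presheaf.germ (extPresheaf F.presheaf U) V x hxV ⟨s, fun h => absurd hV h⟩, ?_⟩
  exact TopCat.Presheaf.stalkFunctor_map_germ_apply V x hxV (extPresheafι F.presheaf U)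
    (⟨s, fun h => absurd hV h⟩ : (extPresheaf F.presheaf U).obj (op V))

lemma extPresheaf_stalk_eq_zero {U : Opens X} {x : X} (hx : x ∉ U)
    (t : (TopCat.Presheaf.stalkFunctor (ModuleCat.{u} R) x).obj (extPresheaf F.presheaf U)) :
    t = 0 := by
  obtain ⟨V, hxV, s, rfl⟩ := TopCat.Presheaf.exists_germ_eq _ t
  have : s = 0 := Subtype.ext (s.2 fun h => hx (h hxV))
  rw [this]
  exact map_zero _

lemma sheafStalk_map_extZeroι (U : Opens X) (x : X) :
    (sheafifyStalkIso (extPresheaf F.presheaf U) x).hom ≫ (sheafStalk R x).map (extZeroι F U) =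
      (TopCat.Presheaf.stalkFunctor (ModuleCat.{u} R) x).map (extPresheafι F.presheaf U) :=
  ((TopCat.Presheaf.stalkFunctor (ModuleCat.{u} R) x).map_comp
    (CategoryTheory.toSheafify (Opens.grothendieckTopology X) (extPresheaf F.presheaf U))
    ((TopCat.Sheaf.forget (ModuleCat.{u} R) X).map (extZeroι F U))).symm.trans
      (congrArg _ (toSheafify_comp_extZeroι F U))

lemma sheafStalk_map_extZeroι_apply (U : Opens X) (x : X)
    (t : (TopCat.Presheaf.stalkFunctor (ModuleCat.{u} R) x).obj (extPresheaf F.presheaf U)) :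
    ((sheafStalk R x).map (extZeroι F U)).hom
        ((sheafifyStalkIso (extPresheaf F.presheaf U) x).hom.hom t) =
      ((TopCat.Presheaf.stalkFunctor (ModuleCat.{u} R) x).map (extPresheafι F.presheaf U)).hom t :=
  congrArg (fun φ => φ.hom t) (sheafStalk_map_extZeroι F U x)

lemma exists_sheafifyStalkIso_eq (P : TopCat.Presheaf (ModuleCat.{u} R) X) (x : X)
    (z : (sheafStalk R x).obj
      ((presheafToSheaf (Opens.grothendieckTopology X) (ModuleCat.{u} R)).obj P)) :
    ∃ t, (sheafifyStalkIso P x).hom.hom t = z :=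
  ⟨(sheafifyStalkIso P x).inv.hom z, (sheafifyStalkIso P x).toLinearEquiv.apply_symm_apply z⟩

/-- Sheafification does not change stalks, so this is inherited from the inclusion of presheaves. -/
lemma extZeroι_stalk_injective (U : Opens X) (x : X) :
    Function.Injective ((sheafStalk R x).map (extZeroι F U)).hom := by
  intro a b h
  obtain ⟨a, rfl⟩ := exists_sheafifyStalkIso_eq _ x a
  obtain ⟨b, rfl⟩ := exists_sheafifyStalkIso_eq _ x b
  rw [sheafStalk_map_extZeroι_apply, sheafStalk_map_extZeroι_apply] at h
  rw [extPresheafι_stalk_injective F U x h]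

lemma extZeroι_stalk_surjective {U : Opens X} {x : X} (hx : x ∈ U) :
    Function.Surjective ((sheafStalk R x).map (extZeroι F U)).hom := by
  intro t
  obtain ⟨s, hs⟩ := extPresheafι_stalk_surjective F hx t
  exact ⟨_, (sheafStalk_map_extZeroι_apply F U x s).trans hs⟩

lemma extZero_stalk_eq_zero {U : Opens X} {x : X} (hx : x ∉ U)
    (z : (sheafStalk R x).obj (extZero F U)) : z = 0 := by
  obtain ⟨t, rfl⟩ := exists_sheafifyStalkIso_eq _ x z
  rw [extPresheaf_stalk_eq_zero F hx t]
  exact map_zero _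

section Biproduct

variable {ι : Type u} [Finite ι] (U : ι → Opens X) (x : X)

/-- The component, in the stalk of `F`, of an element of the stalk of a direct sum of extensions by
zero. -/
def stalkComponent (i : ι) :
    (sheafStalk R x).obj (⨁ fun i => extZero F (U i)) →ₗ[R] (sheafStalk R x).obj F :=
  ((sheafStalk R x).map (biproduct.π (fun i => extZero F (U i)) i ≫ extZeroι F (U i))).hom

lemma stalkComponent_eq (i : ι) (z : (sheafStalk R x).obj (⨁ fun i => extZero F (U i))) :
    stalkComponent F U x i z = ((sheafStalk R x).map (extZeroι F (U i))).hom
      (((sheafStalk R x).map (biproduct.π (fun i => extZero F (U i)) i)).hom z) :=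
  sheafStalk_map_comp_apply _ _ x z

variable {x} in
lemma stalkComponent_eq_zero {i : ι} (hi : x ∉ U i)
    (z : (sheafStalk R x).obj (⨁ fun i => extZero F (U i))) : stalkComponent F U x i z = 0 := by
  rw [stalkComponent_eq, extZero_stalk_eq_zero F hi
    (((sheafStalk R x).map (biproduct.π (fun i => extZero F (U i)) i)).hom z), map_zero]

/-- Together with `stalkComponent_eq_zero` and `exists_stalkComponent_eq`, this identifies the stalk
of the direct sum with the families in the stalk of `F` that vanish at the indices `i` with `x ∉ U
i`. -/
lemma eq_zero_of_stalkComponent (z : (sheafStalk R x).obj (⨁ fun i => extZero F (U i)))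
    (h : ∀ i, stalkComponent F U x i z = 0) : z = 0 := by
  have := Fintype.ofFinite ι
  have h1 : ∀ i, ((sheafStalk R x).map (biproduct.π (fun i => extZero F (U i)) i)).hom z = 0 := by
    intro i
    apply extZeroι_stalk_injective F (U i) x
    rw [← stalkComponent_eq, h, map_zero]
  have h2 : 𝟙 (⨁ fun i => extZero F (U i)) = ∑ i, biproduct.π (fun i => extZero F (U i)) i ≫
      biproduct.ι (fun i => extZero F (U i)) i := by
    classical
    refine biproduct.hom_ext _ _ fun j => ?_
    rw [Preadditive.sum_comp, Finset.sum_eq_single j, Category.assoc, biproduct.ι_π_self,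
      Category.comp_id, Category.id_comp]
    · intro i _ hij
      rw [Category.assoc, biproduct.ι_π_ne _ hij, comp_zero]
    · exact fun h => absurd (Finset.mem_univ j) h
  rw [← sheafStalk_map_id_apply x z, h2, sheafStalk_map_sum_apply]
  refine Finset.sum_eq_zero fun i _ => ?_
  rw [sheafStalk_map_comp_apply, h1, map_zero]

variable {x} in
lemma exists_stalkComponent_eq (r : ι → (sheafStalk R x).obj F) (hr : ∀ i, x ∉ U i → r i = 0) :
    ∃ z, ∀ i, stalkComponent F U x i z = r i := by
  classical
  have := Fintype.ofFinite ι
  have h1 : ∀ i, ∃ y, ((sheafStalk R x).map (extZeroι F (U i))).hom y = r i := by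
    intro i
    by_cases hi : x ∈ U i
    · exact extZeroι_stalk_surjective F hi (r i)
    · exact ⟨0, by rw [map_zero, hr i hi]⟩
  choose y hy using h1
  refine ⟨∑ i, ((sheafStalk R x).map (biproduct.ι (fun i => extZero F (U i)) i)).hom (y i),
    fun j => ?_⟩
  simp only [stalkComponent_eq]
  rw [map_sum, map_sum, Finset.sum_eq_single j]
  · rw [← sheafStalk_map_comp_apply (biproduct.ι (fun i => extZero F (U i)) j),
      biproduct.ι_π_self, sheafStalk_map_id_apply, hy]
  · intro i _ hij
    rw [← sheafStalk_map_comp_apply (biproduct.ι (fun i => extZero F (U i)) i),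
      biproduct.ι_π_ne _ hij, sheafStalk_map_zero_apply, map_zero]
  · exact fun h => absurd (Finset.mem_univ j) h

end Biproduct

end Stalks

end

end ToricRes

namespace ToricRes

noncomputable section

/-! ### The stalks of the Čech complex and its exactness -/

section Biproducts

variable {C : Type*} [Category C] [Preadditive C] {ι κ : Type*} [Fintype ι]
  {f : ι → C} {g : κ → C} [HasBiproduct f] [HasBiproduct g] {T : C}

lemma biproduct_desc_eq_sum (a : ∀ i, f i ⟶ T) :
    biproduct.desc a = ∑ i, biproduct.π f i ≫ a i := by
  classical
  refine biproduct.hom_ext' _ _ fun i => ?_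
  rw [Preadditive.comp_sum, Finset.sum_eq_single i, biproduct.ι_desc, biproduct.ι_π_self_assoc]
  · intro j _ hne
    rw [biproduct.ι_π_ne_assoc _ hne.symm, zero_comp]
  · exact fun h => absurd (Finset.mem_univ i) h

lemma biproduct_desc_lift_comp (a : ∀ i, f i ⟶ T) (b : ∀ j, g j ⟶ T) (e : ∀ i j, f i ⟶ g j)
    (n : ι → κ → ℤ) (h : ∀ i j, e i j ≫ b j = n i j • a i) (j : κ) :
    biproduct.desc (fun i => biproduct.lift (e i)) ≫ biproduct.π g j ≫ b j =
      ∑ i, n i j • (biproduct.π f i ≫ a i) := by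
  classical
  rw [biproduct_desc_eq_sum, Preadditive.sum_comp]
  refine Finset.sum_congr rfl fun i _ => ?_
  rw [Category.assoc, biproduct.lift_π_assoc, h, Preadditive.comp_zsmul]

end Biproducts

namespace Fan

variable {N : Type u} [AddCommGroup N] [Module.Finite ℤ N] {Δ : Fan N} {k : Type u} [Field k]
  {R : Type u} [CommRing R]

instance (p : ℕ) : Fintype (Δ.OfCodim p) := Fintype.ofFinite _

variable (Δ k R) in
/-- The natural morphism of a direct summand of the Čech complex to the constant sheaf. -/
def cechComponent {p : ℕ} (τ : Δ.OfCodim p) : Δ.cechSheaf k R p ⟶ Δ.toricConst k R :=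
  biproduct.π (fun τ : Δ.OfCodim p => Δ.cechSummand k R τ.1) τ ≫
    extZeroι (Δ.toricConst k R) (Δ.affineOpen k τ.1)

/-- The natural inclusions between summands commute with the morphisms to `R_X`, so after
composition with the latter the differential is just the integer matrix of signs. Since these
morphisms are injective on stalks, nothing is lost. -/
lemma cechD_comp_component (o : Δ.Orientation) (p : ℕ) (ρ : Δ.OfCodim p) :
    Δ.cechD k R o p ≫ cechComponent Δ k R ρ =
      ∑ τ : Δ.OfCodim (p + 1), o.sign τ.1 ρ.1 • cechComponent Δ k R τ := by
  classical
  refine biproduct_desc_lift_comp (f := fun τ : Δ.OfCodim (p + 1) => Δ.cechSummand k R τ.1)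
    (g := fun τ : Δ.OfCodim p => Δ.cechSummand k R τ.1)
    (fun τ => extZeroι (Δ.toricConst k R) (Δ.affineOpen k τ.1))
    (fun τ => extZeroι (Δ.toricConst k R) (Δ.affineOpen k τ.1)) _
    (fun τ ρ => o.sign τ.1 ρ.1) (fun τ ρ => ?_) ρ
  by_cases h : τ.1 ≤ ρ.1
  · refine (congrArg (fun φ => φ ≫ extZeroι (Δ.toricConst k R) (Δ.affineOpen k ρ.1))
      (dif_pos h)).trans ((Preadditive.zsmul_comp _ _ _).trans ?_)
    exact congrArg (fun φ => o.sign τ.1 ρ.1 • φ)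
      (extZeroMap_comp_extZeroι (Δ.toricConst k R) (Δ.affineOpen_mono k h))
  · refine (congrArg (fun φ => φ ≫ extZeroι (Δ.toricConst k R) (Δ.affineOpen k ρ.1))
      (dif_neg h)).trans (zero_comp.trans ?_)
    rw [not_not.1 fun h' => h (sign_ne_zero h').1]
    exact (zero_smul ℤ _).symm

lemma cechAug_eq : Δ.cechAug k R = ∑ τ : Δ.OfCodim 0, cechComponent Δ k R τ :=
  biproduct_desc_eq_sum (f := fun τ : Δ.OfCodim 0 => Δ.cechSummand k R τ.1) _

variable {x : Δ.toricVariety k} {σ : Δ.Cone} (hσ : ∀ τ : Δ.Cone, x ∈ Δ.affineOpen k τ ↔ σ ≤ τ)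

variable (R x) in
/-- The stalk of the constant sheaf on the toric variety. -/
def toricConstStalkIso : (Δ.stalkAt k R x).obj (Δ.toricConst k R) ≅ ModuleCat.of R R :=
  constStalkIso R x

variable (R σ x) in
/-- The map from the stalk of the Čech complex to the chains on the star of a cone. -/
def cechStalkMap (p : ℕ) : (Δ.stalkAt k R x).obj (Δ.cechSheaf k R p) →ₗ[R] StarChains R σ p :=
  (Finsupp.linearEquivFunOnFinite R R (StarOfCodim σ p)).symm.toLinearMap ∘ₗ
    LinearMap.pi fun τ => (toricConstStalkIso R x).hom.hom ∘ₗ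
      ((Δ.stalkAt k R x).map (cechComponent Δ k R (⟨τ.1, τ.2.2⟩ : Δ.OfCodim p))).hom

lemma cechStalkMap_apply {p : ℕ} (z : (Δ.stalkAt k R x).obj (Δ.cechSheaf k R p))
    (τ : StarOfCodim σ p) : cechStalkMap R x σ p z τ = (toricConstStalkIso R x).hom.hom
      (((Δ.stalkAt k R x).map (cechComponent Δ k R (⟨τ.1, τ.2.2⟩ : Δ.OfCodim p))).hom z) := rfl

omit [Module.Finite ℤ N] in
lemma sum_ofCodim {M : Type*} [AddCommMonoid M] {p : ℕ} (F : Δ.OfCodim p → M)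
    (hF : ∀ τ, ¬ σ ≤ τ.1 → F τ = 0) :
    ∑ τ, F τ = ∑ τ : StarOfCodim σ p, F ⟨τ.1, τ.2.2⟩ := by
  classical
  symm
  refine Finset.sum_bij_ne_zero (fun τ _ _ => ⟨τ.1, τ.2.2⟩) (fun _ _ _ => Finset.mem_univ _)
    (fun a _ _ b _ _ h => Subtype.ext (congrArg (fun τ : Δ.OfCodim p => τ.1) h)) (fun τ _ h => ?_) fun _ _ _ => rfl
  have h1 : σ ≤ τ.1 := not_not.1 fun h' => h (hF τ h')
  exact ⟨⟨τ.1, h1, τ.2⟩, Finset.mem_univ _, h, rfl⟩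

include hσ

lemma cechComponent_stalk_eq_zero {p : ℕ} {τ : Δ.OfCodim p} (hτ : ¬ σ ≤ τ.1)
    (z : (Δ.stalkAt k R x).obj (Δ.cechSheaf k R p)) :
    ((Δ.stalkAt k R x).map (cechComponent Δ k R τ)).hom z = 0 :=
  stalkComponent_eq_zero (Δ.toricConst k R) (fun τ : Δ.OfCodim p => Δ.affineOpen k τ.1)
    (fun h => hτ ((hσ τ.1).1 h)) z

/-- The summand of `τ` has stalk `R` if `x ∈ X_τ`, which by `hσ` means `σ ≤ τ`, and zero stalk
otherwise. -/
lemma cechStalkMap_bijective (p : ℕ) : Function.Bijective (cechStalkMap (k := k) R x σ p) := by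
  classical
  constructor
  · refine (injective_iff_map_eq_zero _).2 fun z hz => ?_
    refine eq_zero_of_stalkComponent (Δ.toricConst k R)
      (fun τ : Δ.OfCodim p => Δ.affineOpen k τ.1) x z fun τ => ?_
    by_cases h : σ ≤ τ.1
    · have h1 := DFunLike.congr_fun hz (⟨τ.1, h, τ.2⟩ : StarOfCodim σ p)
      rw [cechStalkMap_apply] at h1
      exact (toricConstStalkIso R x).toLinearEquiv.map_eq_zero_iff.1 h1
    · exact cechComponent_stalk_eq_zero hσ h z
  · intro r
    obtain ⟨z, hz⟩ := exists_stalkComponent_eq (x := x) (Δ.toricConst k R)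
      (fun τ : Δ.OfCodim p => Δ.affineOpen k τ.1)
      (fun τ => (toricConstStalkIso R x).inv.hom (extendChain r τ.1)) (fun τ hτ => by
        rw [extendChain, dif_neg fun h => hτ ((hσ τ.1).2 h.1)]
        exact map_zero _)
    refine ⟨z, Finsupp.ext fun τ => ?_⟩
    refine (cechStalkMap_apply _ τ).trans ?_
    refine (congrArg (toricConstStalkIso R x).hom.hom (hz ⟨τ.1, τ.2.2⟩)).trans ?_
    refine ((toricConstStalkIso R x).toLinearEquiv.apply_symm_apply _).trans ?_
    exact extendChain_coe r τ

/-- The stalk of the Čech complex at a point of the orbit of `σ`. -/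
def cechStalkIso (p : ℕ) :
    (Δ.stalkAt k R x).obj (Δ.cechSheaf k R p) ≅ ModuleCat.of R (StarChains R σ p) :=
  (LinearEquiv.ofBijective _ (cechStalkMap_bijective hσ p)).toModuleIso

lemma cechStalkMap_cechD (o : Δ.Orientation) (p : ℕ)
    (z : (Δ.stalkAt k R x).obj (Δ.cechSheaf k R (p + 1))) :
    cechStalkMap R x σ p (((Δ.stalkAt k R x).map (Δ.cechD k R o p)).hom z) =
      starD R o σ p (cechStalkMap R x σ (p + 1) z) := by
  refine Finsupp.ext fun ρ => ?_
  rw [cechStalkMap_apply, starD_apply]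
  have h1 : ((Δ.stalkAt k R x).map (cechComponent Δ k R (⟨ρ.1, ρ.2.2⟩ : Δ.OfCodim p))).hom
      (((Δ.stalkAt k R x).map (Δ.cechD k R o p)).hom z) = ∑ τ : Δ.OfCodim (p + 1),
        o.sign τ.1 ρ.1 • ((Δ.stalkAt k R x).map (cechComponent Δ k R τ)).hom z := by
    refine (sheafStalk_map_comp_apply (Δ.cechD k R o p)
      (cechComponent Δ k R (⟨ρ.1, ρ.2.2⟩ : Δ.OfCodim p)) x z).symm.trans ?_
    refine (congrArg (fun f => ((sheafStalk R x).map f).hom z)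
      (cechD_comp_component o p ⟨ρ.1, ρ.2.2⟩)).trans ?_
    exact (sheafStalk_map_sum_apply _ _ x z).trans
      (Finset.sum_congr rfl fun τ _ => sheafStalk_map_zsmul_apply _ _ x z)
  rw [h1]
  rw [sum_ofCodim _ fun τ hτ => ?_, map_sum]
  · refine Finset.sum_congr rfl fun τ _ => ?_
    rw [map_zsmul, zsmul_eq_mul, mul_comm]
    rfl
  · refine (congrArg _ (cechComponent_stalk_eq_zero hσ hτ z)).trans (smul_zero _)

lemma starAug_cechStalkMap (z : (Δ.stalkAt k R x).obj (Δ.cechSheaf k R 0)) :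
    (toricConstStalkIso R x).hom.hom (((Δ.stalkAt k R x).map (Δ.cechAug k R)).hom z) =
      starAug R σ (cechStalkMap R x σ 0 z) := by
  rw [starAug_apply]
  have h1 : ((Δ.stalkAt k R x).map (Δ.cechAug k R)).hom z = ∑ τ : Δ.OfCodim 0,
      ((Δ.stalkAt k R x).map (cechComponent Δ k R τ)).hom z :=
    (congrArg (fun f => ((sheafStalk R x).map f).hom z) cechAug_eq).trans
      (sheafStalk_map_sum_apply _ _ x z)
  rw [h1]
  rw [sum_ofCodim _ fun τ hτ => cechComponent_stalk_eq_zero hσ hτ z, map_sum]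
  rfl

omit hσ

variable (hX : ∀ x : Δ.toricVariety k, ∃ σ : Δ.Cone, ∀ τ : Δ.Cone, x ∈ Δ.affineOpen k τ ↔ σ ≤ τ)
  (hΔ : Δ.IsComplete) {o : Δ.Orientation} (ho : o.IsCoherent)

include hX hΔ

lemma cechD_comp_cechD (p : ℕ) : Δ.cechD k R o (p + 1) ≫ Δ.cechD k R o p = 0 := by
  refine eq_zero_of_sheafStalk_map _ fun x => ModuleCat.hom_ext (LinearMap.ext fun z => ?_)
  obtain ⟨σ, hσ⟩ := hX x
  refine (sheafStalk_map_comp_apply _ _ x z).trans ((cechStalkMap_bijective (R := R) hσ p).1 ?_)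
  refine (cechStalkMap_cechD hσ o p _).trans ?_
  refine (congrArg (starD R o σ p) (cechStalkMap_cechD hσ o (p + 1) z)).trans ?_
  exact (starD_starD hΔ σ p _).trans (map_zero _).symm

/-- On stalks the complex is the one on the cones containing the minimal cone `σ` of the point,
where exactness is combinatorial. -/
lemma cechD_exact [Module.Free ℤ N] (ho : o.IsCoherent) (p : ℕ)
    (hd : Δ.cechD k R o (p + 1) ≫ Δ.cechD k R o p = 0) : (ShortComplex.mk _ _ hd).Exact := by
  rw [TopCat.Sheaf.exact_iff_stalkFunctor_map_exact]
  intro x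
  obtain ⟨σ, hσ⟩ := hX x
  rw [ShortComplex.moduleCat_exact_iff]
  intro z hz
  obtain ⟨y, hy⟩ := exists_starD_eq_of_starD_eq_zero hΔ ho σ p (cechStalkMap R x σ (p + 1) z)
    ((cechStalkMap_cechD hσ o p z).symm.trans ((congrArg (cechStalkMap R x σ p) hz).trans
      (map_zero _)))
  obtain ⟨w, rfl⟩ := (cechStalkMap_bijective (k := k) hσ (p + 2)).2 y
  exact ⟨w, (cechStalkMap_bijective hσ (p + 1)).1 ((cechStalkMap_cechD hσ o (p + 1) w).trans hy)⟩

variable [Module.Free ℤ N]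

lemma epi_cechAug : Epi (Δ.cechAug k R) := by
  rw [← TopCat.Sheaf.isLocallySurjective_iff_epi,
    TopCat.Presheaf.locally_surjective_iff_surjective_on_stalks]
  intro x t
  obtain ⟨σ, hσ⟩ := hX x
  obtain ⟨y, hy⟩ := starAug_surjective (R := R) hΔ σ ((toricConstStalkIso R x).hom.hom t)
  obtain ⟨z, rfl⟩ := (cechStalkMap_bijective (k := k) hσ 0).2 y
  exact ⟨z, (toricConstStalkIso R x).toLinearEquiv.injective
    ((starAug_cechStalkMap hσ z).trans hy)⟩

include ho

lemma cechD_comp_cechAug : Δ.cechD k R o 0 ≫ Δ.cechAug k R = 0 := by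
  refine eq_zero_of_sheafStalk_map _ fun x => ModuleCat.hom_ext (LinearMap.ext fun z => ?_)
  obtain ⟨σ, hσ⟩ := hX x
  refine (sheafStalk_map_comp_apply _ _ x z).trans
    ((toricConstStalkIso R x).toLinearEquiv.injective ?_)
  refine (starAug_cechStalkMap hσ _).trans ?_
  refine (congrArg (starAug R σ) (cechStalkMap_cechD hσ o 0 z)).trans ?_
  exact (starAug_starD hΔ ho σ _).trans (map_zero _).symm

lemma cechAug_exact (ha : Δ.cechD k R o 0 ≫ Δ.cechAug k R = 0) :
    (ShortComplex.mk _ _ ha).Exact := by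
  rw [TopCat.Sheaf.exact_iff_stalkFunctor_map_exact]
  intro x
  obtain ⟨σ, hσ⟩ := hX x
  rw [ShortComplex.moduleCat_exact_iff]
  intro z hz
  obtain ⟨y, hy⟩ := exists_starD_eq_of_starAug_eq_zero hΔ ho σ (cechStalkMap R x σ 0 z)
    ((starAug_cechStalkMap hσ z).symm.trans
      ((congrArg (toricConstStalkIso R x).hom.hom hz).trans (map_zero _)))
  obtain ⟨w, rfl⟩ := (cechStalkMap_bijective (k := k) hσ 1).2 y
  exact ⟨w, (cechStalkMap_bijective hσ 0).1 ((cechStalkMap_cechD hσ o 0 w).trans hy)⟩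

end Fan

end

end ToricRes

namespace ToricRes

noncomputable section

/-! ### Points of the toric variety, minimal affine pieces and orbits -/

section OrbitRing

variable {N : Type u} [AddCommGroup N] (k : Type u) [Field k]

lemma orthMonoid_le_dualMonoid (σ : PointedCone ℝ (NReal N)) :
    (orthMonoid σ).toAddSubmonoid ≤ dualMonoid σ := fun _ hm x hx => (hm x hx).ge

open Classical in
lemma orbitRingHom_single (σ : PointedCone ℝ (NReal N)) (m : dualMonoid σ) (c : k) :
    orbitRingHom k σ (AddMonoidAlgebra.single m c) =
      if h : m.1 ∈ orthMonoid σ then AddMonoidAlgebra.single (⟨m.1, h⟩ : orthMonoid σ) c else 0 := by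
  unfold orbitRingHom
  refine (AddMonoidAlgebra.lift_single _ _ _).trans ?_
  change c • (if h : m.1 ∈ orthMonoid σ then
    AddMonoidAlgebra.single (⟨m.1, h⟩ : orthMonoid σ) (1 : k) else 0) = _
  split_ifs
  · rw [AddMonoidAlgebra.smul_single, smul_eq_mul, mul_one]
  · rw [smul_zero]

/-- The inclusion `k[σ^⊥ ∩ M] → k[σ^∨ ∩ M]`. -/
def orbitRingSection (σ : PointedCone ℝ (NReal N)) : orbitRing k σ →+* coordRing k σ :=
  AddMonoidAlgebra.mapDomainRingHom k (AddSubmonoid.inclusion (orthMonoid_le_dualMonoid σ))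

lemma orbitRingSection_single (σ : PointedCone ℝ (NReal N)) (m : orthMonoid σ) (c : k) :
    orbitRingSection k σ (AddMonoidAlgebra.single m c) =
      AddMonoidAlgebra.single ⟨m.1, orthMonoid_le_dualMonoid σ m.2⟩ c :=
  AddMonoidAlgebra.mapDomain_single

lemma orbitRingHom_surjective (σ : PointedCone ℝ (NReal N)) :
    Function.Surjective (orbitRingHom k σ) := by
  intro g
  refine ⟨orbitRingSection k σ g, ?_⟩
  induction g using AddMonoidAlgebra.induction_linear with
  | zero => simp
  | add f g hf hg => rw [map_add, map_add, hf, hg]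
  | single m c => rw [orbitRingSection_single, orbitRingHom_single, dif_pos m.2]

/-- Removing from `f` its part on `σ^⊥` leaves a combination of monomials outside `σ^⊥`, which lies
in `P`; for `f` in the kernel nothing was removed. -/
lemma ker_orbitRingHom_le (σ : PointedCone ℝ (NReal N)) (P : Ideal (coordRing k σ))
    (hP : ∀ m : dualMonoid σ, m.1 ∉ orthMonoid σ → AddMonoidAlgebra.single m (1 : k) ∈ P) :
    RingHom.ker (orbitRingHom k σ) ≤ P := by
  have key : ∀ f, f - orbitRingSection k σ (orbitRingHom k σ f) ∈ P := by
    intro f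
    induction f using AddMonoidAlgebra.induction_linear with
    | zero => simp
    | add f g hf hg =>
      rw [map_add, map_add, add_sub_add_comm]
      exact P.add_mem hf hg
    | single m c =>
      rw [orbitRingHom_single]
      split_ifs with h
      · rw [orbitRingSection_single, sub_self]
        exact P.zero_mem
      · rw [map_zero, sub_zero]
        have : AddMonoidAlgebra.single m c =
            AddMonoidAlgebra.single 0 c * AddMonoidAlgebra.single m (1 : k) := by
          rw [AddMonoidAlgebra.single_mul_single, zero_add, mul_one]
        rw [this]
        exact P.mul_mem_left _ (hP m h)
  intro f hf
  have := key f
  rwa [(RingHom.mem_ker).1 hf, map_zero, sub_zero] at this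

end OrbitRing

namespace Fan

variable {N : Type u} [AddCommGroup N] [Module.Finite ℤ N] {Δ : Fan N} {k : Type u} [Field k]

lemma exists_mem_affineOpen (x : Δ.toricVariety k) : ∃ σ, x ∈ Δ.affineOpen k σ := by
  obtain ⟨σ, y, h⟩ := Scheme.IsLocallyDirected.ι_jointly_surjective (Δ.diagram k) x
  exact ⟨σ, y, h⟩

/-- In the colimit of a locally directed diagram of open immersions, points of two pieces are
identified only if both come from a point of a common smaller piece. -/
lemma exists_le_mem_affineOpen {x : Δ.toricVariety k} {σ τ : Δ.Cone} (hσ : x ∈ Δ.affineOpen k σ)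
    (hτ : x ∈ Δ.affineOpen k τ) : ∃ ρ, ρ ≤ σ ∧ ρ ≤ τ ∧ x ∈ Δ.affineOpen k ρ := by
  obtain ⟨y, rfl⟩ := hσ
  obtain ⟨z, hz⟩ := hτ
  obtain ⟨ρ, f, g, w, hw, -⟩ := (Scheme.IsLocallyDirected.ι_eq_ι_iff (Δ.diagram k)).1 hz.symm
  refine ⟨ρ, leOfHom f, leOfHom g, w, ?_⟩
  rw [← hw]
  have : (Δ.diagram k).map f ≫ Δ.inclusion k σ = Δ.inclusion k ρ := colimit.w (Δ.diagram k) f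
  rw [← this]
  rfl

/-- Every point has a smallest affine piece containing it. -/
lemma exists_forall_mem_affineOpen_iff (x : Δ.toricVariety k) :
    ∃ σ : Δ.Cone, ∀ τ : Δ.Cone, x ∈ Δ.affineOpen k τ ↔ σ ≤ τ := by
  obtain ⟨σ, hσ⟩ := (Set.toFinite {τ : Δ.Cone | x ∈ Δ.affineOpen k τ}).exists_minimal
    (exists_mem_affineOpen x)
  refine ⟨σ, fun τ => ⟨fun h => ?_, fun h => Δ.affineOpen_mono k h hσ.1⟩⟩
  obtain ⟨ρ, h1, h2, h3⟩ := exists_le_mem_affineOpen hσ.1 h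
  exact (hσ.2 h3 h1).trans h2

/-- A character `m ∉ σ^⊥` must vanish at the point: otherwise the point would lie in `X_τ` for the
face `τ = σ ∩ m^⊥`, and minimality would give `σ ≤ τ`, hence `m ∈ σ^⊥`. So the prime ideal contains
the kernel of the surjection defining the closed subscheme `T_σ` of `X_σ`. -/
lemma mem_orbit {x : Δ.toricVariety k} {σ : Δ.Cone}
    (hσ : ∀ τ : Δ.Cone, x ∈ Δ.affineOpen k τ ↔ σ ≤ τ) : x ∈ Δ.orbit k σ := by
  obtain ⟨y, hy⟩ := (hσ σ).2 le_rfl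
  have hker : RingHom.ker (orbitRingHom k σ.1) ≤ PrimeSpectrum.asIdeal y := by
    refine ker_orbitRingHom_le k σ.1 _ fun m hm => ?_
    by_contra hmem
    let τ : PointedCone ℝ (NReal N) :=
      { carrier := {z | z ∈ σ.1 ∧ pairing m.1 z = 0}
        add_mem' := fun ha hb => ⟨σ.1.add_mem ha.1 hb.1, by rw [map_add, ha.2, hb.2, add_zero]⟩
        zero_mem' := ⟨σ.1.zero_mem, map_zero _⟩
        smul_mem' := fun c z hz => ⟨σ.1.smul_mem c.2 hz.1, by
          rw [← Nonneg.coe_smul, map_smul, hz.2, smul_zero]⟩ }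
    have hτ : τ ∈ Δ.cones := Δ.face_mem σ.1 σ.2 τ ⟨pairing m.1, m.2, fun z => Iff.rfl⟩
    have hle : (⟨τ, hτ⟩ : Δ.Cone) ≤ σ := fun z hz => hz.1
    have h1 : y ∈ Set.range (affineMap k (show τ ≤ σ.1 from hle)) := by
      rw [range_affineMap k (Δ.rational _ σ.2) hle m fun z => Iff.rfl]
      exact hmem
    obtain ⟨w, rfl⟩ := h1
    have h2 : affineMap k (show τ ≤ σ.1 from hle) ≫ Δ.inclusion k σ = Δ.inclusion k ⟨τ, hτ⟩ :=
      colimit.w (Δ.diagram k) (homOfLE hle)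
    have h3 : x ∈ Δ.affineOpen k ⟨τ, hτ⟩ := by
      refine ⟨w, ?_⟩
      rw [← h2]
      exact hy
    exact hm fun z hz => ((hσ _).1 h3 hz).2
  have h1 : y ∈ Set.range (PrimeSpectrum.comap (orbitRingHom k σ.1)) := by
    rw [range_comap_of_surjective _ _ (orbitRingHom_surjective k σ.1)]
    exact hker
  obtain ⟨q, rfl⟩ := h1
  exact ⟨q, hy⟩

end Fan

end

end ToricRes

theorem mainTheorem6 {N : Type u} [AddCommGroup N] [Module.Free ℤ N] [Module.Finite ℤ N]
    (Δ : ToricRes.Fan N) (hΔ : Δ.IsComplete) (o : Δ.Orientation) (ho : o.IsCoherent)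
    (k : Type u) [Field k] (R : Type u) [CommRing R] :
    (∃ (hd : ∀ p : ℕ, Δ.cechD k R o (p + 1) ≫ Δ.cechD k R o p = 0)
        (ha : Δ.cechD k R o 0 ≫ Δ.cechAug k R = 0),
      (∀ p : ℕ, (ShortComplex.mk _ _ (hd p)).Exact) ∧
      (ShortComplex.mk _ _ ha).Exact ∧
      Epi (Δ.cechAug k R)) ∧
    (∀ x : Δ.toricVariety k, ∃ σ : Δ.Cone, x ∈ Δ.orbit k σ ∧
      (∃ (φ : ∀ p : ℕ, (Δ.stalkAt k R x).obj (Δ.cechSheaf k R p) ≅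
            ModuleCat.of R (ToricRes.Fan.StarChains R σ p))
          (φ' : (Δ.stalkAt k R x).obj (Δ.toricConst k R) ≅ ModuleCat.of R R),
        (∀ p : ℕ, (Δ.stalkAt k R x).map (Δ.cechD k R o p) ≫ (φ p).hom =
          (φ (p + 1)).hom ≫ ModuleCat.ofHom (ToricRes.Fan.starD R o σ p)) ∧
        (Δ.stalkAt k R x).map (Δ.cechAug k R) ≫ φ'.hom =
          (φ 0).hom ≫ ModuleCat.ofHom (ToricRes.Fan.starAug R σ)) ∧
      (∃ ψ : ∀ p : ℕ, ToricRes.Fan.StarChains R σ p ≃ₗ[R] ToricRes.Fan.cellularChains R σ p,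
        (∀ (p : ℕ) (c : ToricRes.Fan.StarChains R σ (p + 1)),
          (ψ p (ToricRes.Fan.starD R o σ p c) : ToricRes.Fan.Flag σ p →₀ R) =
            ToricRes.Fan.flagD R σ p (ψ (p + 1) c)) ∧
        ∀ c : ToricRes.Fan.StarChains R σ 0,
          Finsupp.linearCombination R (fun _ : ToricRes.Fan.Flag σ 0 => (1 : R)) (ψ 0 c) =
            ToricRes.Fan.starAug R σ c)) := by
  -- The existence of a minimal cone at each point is the only geometric input for the sheaf
  -- statements; the same cone serves for the orbit, the stalk and the dual cells.
  have hX := ToricRes.Fan.exists_forall_mem_affineOpen_iff (Δ := Δ) (k := k)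
  refine ⟨⟨fun p => ToricRes.Fan.cechD_comp_cechD hX hΔ p,
    ToricRes.Fan.cechD_comp_cechAug hX hΔ ho, fun p => ToricRes.Fan.cechD_exact hX hΔ ho p _,
    ToricRes.Fan.cechAug_exact hX hΔ ho _, ToricRes.Fan.epi_cechAug hX hΔ⟩, fun x => ?_⟩
  obtain ⟨σ, hσ⟩ := hX x
  refine ⟨σ, ToricRes.Fan.mem_orbit hσ, ⟨fun p => ToricRes.Fan.cechStalkIso hσ p,
    ToricRes.Fan.toricConstStalkIso R x,
    fun p => ModuleCat.hom_ext (LinearMap.ext fun z => ToricRes.Fan.cechStalkMap_cechD hσ o p z),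
    ModuleCat.hom_ext (LinearMap.ext fun z => ToricRes.Fan.starAug_cechStalkMap hσ z)⟩,
    fun p => ToricRes.Fan.dualCellEquiv hΔ ho σ p, fun p c => ?_, fun c => ?_⟩
  · exact ToricRes.Fan.dualCell_starD hΔ ho p c
  · exact ToricRes.Fan.linearCombination_dualCell c
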